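/- **Theorem 3.1.** Let $d\ge 1$ and $\alpha\in(-1,\infty)^d$, and write $|\alpha|=\alpha_1+\dots+\alpha_d$ and, for $n\in\mathbb N^d$ with $\mathbb N=\{0,1,2,\dots\}$, $|n|=n_1+\dots+n_d$. Let $\mathbb R_+^d=(0,\infty)^d$ carry the Euclidean norm $|\cdot|$ and the measure $\mu_\alpha(dx)=x_1^{2\alpha_1+1}\cdots x_d^{2\alpha_d+1}\,dx$, and let $B(x,r)=\{y\in\mathbb R_+^d:|x-y|<r\}$. For $t>0$ and $x,y\in\mathbb R_+^d$ let $$G_t^\alpha(x,y)=(\sinh 2t)^{-d}\exp\Big(-\tfrac12\coth(2t)\,(|x|^2+|y|^2)\Big)\prod_{i=1}^d (x_iy_i)^{-\alpha_i}I_{\alpha_i}\Big(\frac{x_iy_i}{\sinh 2t}\Big)$$ be the Laguerre heat kernel, where $I_\nu$ is the modified Bessel function of the first kind and order $\nu$. Put $\delta_{x_i}=\partial_{x_i}+x_i$ and $\delta_x^n=\delta_{x_1}^{n_1}\circ\dots\circ\delta_{x_d}^{n_d}$. For a Banach space $\mathbb B$, a function $K$ from $\{(x,y)\in\mathbb R_+^d\times\mathbb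 R_+^d: x\ne y\}$ to $\mathbb B$ satisfies the *standard estimates* if there is a constant $C>0$ such that for all $x,x',y,y'\in\mathbb R_+^d$ $$\|K(x,y)\|_{\mathbb B}\le \frac{C}{\mu_\alpha(B(x,|x-y|))}\quad\text{if } x\neq y,\tag{3.1}$$ $$\|K(x,y)-K(x',y)\|_{\mathbb B}\le C\,\frac{|x-x'|}{|x-y|}\,\frac{1}{\mu_\alpha(B(x,|x-y|))}\quad\text{if } |x-y|>2|x-x'|,\tag{3.2}$$ $$\|K(x,y)-K(x,y')\|_{\mathbb B}\le C\,\frac{|y-y'|}{|x-y|}\,\frac{1}{\mu_\alpha(B(x,|x-y|))}\quad\text{if } |x-y|>2|y-y'|.\tag{3.3}$$ Then each of the following kernels is well defined (for $x\ne y$ the indicated functions of $t\in(0,\infty)$ belong to $\mathbb B$ in (1) and (3), and the indicated integrals converge absolutely in (2), (4) and (5)) and satisfies the standard estimates (3.1), (3.2) and (3.3), with the Banach space $\mathbb B$ as indicated: 1. $\mathcal G^\alpha(x,y)=\{G_t^\alpha(x,y)\}_{t>0}$, with $\mathbb B=L^\infty((0,\infty),dt)$; 2. $R_n^\alpha(x,y)=\dfrac{1}{\Gamma(|n|/2)}\displaystyle\int_0^\infty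 \delta_x^nG_t^\alpha(x,y)\,t^{|n|/2-1}\,dt$, with $\mathbb B=\mathbb C$, for every $n\in\mathbb N^d$ with $|n|>0$; 3. $\mathcal H_{n,m}^\alpha(x,y)=\{\partial_t^m\delta_x^nG_t^\alpha(x,y)\}_{t>0}$, with $\mathbb B=L^2((0,\infty),t^{|n|+2m-1}dt)$, for all $n\in\mathbb N^d$ and $m\in\mathbb N$ with $|n|+m>0$; 4. $K_\psi^\alpha(x,y)=-\displaystyle\int_0^\infty\psi(t)\,\partial_tG_t^\alpha(x,y)\,dt$, with $\mathbb B=\mathbb C$, for every complex-valued $\psi\in L^\infty((0,\infty),dt)$; 5. $K_\nu^\alpha(x,y)=\displaystyle\int_0^\infty G_t^\alpha(x,y)\,d\nu(t)$, with $\mathbb B=\mathbb C$, for every signed or complex Borel measure $\nu$ on $(0,\infty)$ whose total variation $|\nu|$ satisfies $\displaystyle\int_0^\infty e^{-t(2d+2|\alpha|)}\,d|\nu|(t)<\infty$. (Here $\nu$ may have infinite total variation: $d\nu=h\,d|\nu|$ with $|\nu|$ a positive Borel measure and $h$ a Borel function of modulus $1$.) The constants $C$ may depend on $d$, $\alpha$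 and the kernel (that is, on $n$, $m$, $\psi$, $\nu$), but not on $x,x',y,y'$. -/

import Mathlib

open MeasureTheory

namespace LaguerreCZ

noncomputable section

/-- The open orthant `(0, ∞)^d` inside Euclidean space. -/
def orthant (d : ℕ) : Set (EuclideanSpace ℝ (Fin d)) :=
  {x | ∀ i, 0 < x i}

/-- The measure `x_1^(2 α_1 + 1) ⋯ x_d^(2 α_d + 1) dx` on the orthant. -/
def muMeasure {d : ℕ} (α : Fin d → ℝ) : Measure (EuclideanSpace ℝ (Fin d)) :=
  (volume.restrict (orthant d)).withDensity
    (fun x => ENNReal.ofReal (∏ i, x i ^ (2 * α i + 1)))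

/-- The measure of the ball `{y ∈ (0, ∞)^d : |x - y| < r}`. -/
def muBall {d : ℕ} (α : Fin d → ℝ) (x : EuclideanSpace ℝ (Fin d)) (r : ℝ) : ℝ :=
  (muMeasure α).real (Metric.ball x r ∩ orthant d)

/-- The modified Bessel function of the first kind and order `ν`, on the positive half-line. -/
def besselI (ν z : ℝ) : ℝ :=
  ∑' k : ℕ, (z / 2) ^ (ν + 2 * k) / (k.factorial * Real.Gamma (ν + k + 1))

/-- The Laguerre heat kernel `G_t^α(x, y)`; it is used for `t > 0` and `x, y` in the orthant. -/
def heatKernel {d : ℕ} (α : Fin d → ℝ) (t : ℝ) (x y : EuclideanSpace ℝ (Fin d)) : ℝ :=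
  (Real.sinh (2 * t) ^ d)⁻¹ *
    Real.exp (-(1 / 2) * (Real.cosh (2 * t) / Real.sinh (2 * t)) * (‖x‖ ^ 2 + ‖y‖ ^ 2)) *
    ∏ i, ((x i * y i) ^ (-α i) * besselI (α i) (x i * y i / Real.sinh (2 * t)))

/-- The Laguerre partial derivative `δ_{x_i} = ∂/∂x_i + x_i`. -/
def laguerreDeriv {d : ℕ} (i : Fin d) (f : EuclideanSpace ℝ (Fin d) → ℝ) :
    EuclideanSpace ℝ (Fin d) → ℝ :=
  fun x => lineDeriv ℝ f x (EuclideanSpace.single i 1) + x i * f x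

/-- The composition `δ_{x_1}^{n_1} ∘ ⋯ ∘ δ_{x_d}^{n_d}`. -/
def laguerreDerivMulti {d : ℕ} (n : Fin d → ℕ) :
    (EuclideanSpace ℝ (Fin d) → ℝ) → EuclideanSpace ℝ (Fin d) → ℝ :=
  ((List.finRange d).map (fun i => (laguerreDeriv i)^[n i])).foldr (fun g h => g ∘ h) id

/-- `δ_x^n G_t^α(x, y)`. -/
def deltaHeat {d : ℕ} (α : Fin d → ℝ) (n : Fin d → ℕ) (t : ℝ)
    (x y : EuclideanSpace ℝ (Fin d)) : ℝ :=
  laguerreDerivMulti n (fun z => heatKernel α t z y) x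

/-- `∂_t^m δ_x^n G_t^α(x, y)`. -/
def mixedHeat {d : ℕ} (α : Fin d → ℝ) (n : Fin d → ℕ) (m : ℕ) (t : ℝ)
    (x y : EuclideanSpace ℝ (Fin d)) : ℝ :=
  iteratedDeriv m (fun s => deltaHeat α n s x y) t

/-- The standard estimates (growth, and smoothness in either variable) for a kernel with values in
a normed space `B`, relative to the orthant with `μ_α` and the Euclidean distance.  Only values
of `K` at pairs of distinct points of the orthant matter. -/
structure IsStandardKernel {d : ℕ} (α : Fin d → ℝ) {B : Type*} [NormedAddCommGroup B]
    (K : EuclideanSpace ℝ (Fin d) → EuclideanSpace ℝ (Fin d) → B) : Prop where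
  growth : ∃ C > 0, ∀ x ∈ orthant d, ∀ y ∈ orthant d, x ≠ y →
    ‖K x y‖ ≤ C * (1 / muBall α x ‖x - y‖)
  smooth_left : ∃ C > 0, ∀ x ∈ orthant d, ∀ x' ∈ orthant d, ∀ y ∈ orthant d,
    ‖x - y‖ > 2 * ‖x - x'‖ →
      ‖K x y - K x' y‖ ≤ C * (‖x - x'‖ / ‖x - y‖ * (1 / muBall α x ‖x - y‖))
  smooth_right : ∃ C > 0, ∀ x ∈ orthant d, ∀ y ∈ orthant d, ∀ y' ∈ orthant d,
    ‖x - y‖ > 2 * ‖y - y'‖ →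
      ‖K x y - K x y'‖ ≤ C * (‖y - y'‖ / ‖x - y‖ * (1 / muBall α x ‖x - y‖))

/-- Lebesgue measure `dt` on `(0, ∞)`. -/
def timeMeasure : Measure ℝ := volume.restrict (Set.Ioi 0)

/-- The measure `t^a dt` on `(0, ∞)`. -/
def powerMeasure (a : ℝ) : Measure ℝ :=
  timeMeasure.withDensity (fun t => ENNReal.ofReal (t ^ a))

/-- The family of functions `f x y` on the measure space `(ℝ, μ)`, seen as a kernel valued in
`L^p(μ)`, is a standard kernel: `f x y` belongs to `L^p(μ)` for all distinct `x`, `y` in the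
orthant, and the resulting `L^p(μ)`-valued kernel satisfies the standard estimates. -/
def IsStandardLpKernel {d : ℕ} (α : Fin d → ℝ) (p : ENNReal) [Fact (1 ≤ p)] (μ : Measure ℝ)
    (f : EuclideanSpace ℝ (Fin d) → EuclideanSpace ℝ (Fin d) → ℝ → ℂ) : Prop :=
  ∃ K : EuclideanSpace ℝ (Fin d) → EuclideanSpace ℝ (Fin d) → Lp ℂ p μ,
    (∀ x ∈ orthant d, ∀ y ∈ orthant d, x ≠ y → K x y =ᵐ[μ] f x y) ∧ IsStandardKernel α K

/-- A signed or complex Borel measure `ν` on `(0, ∞)`, not necessarily of finite total variation,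
given by its polar decomposition `dν = phase d|ν|`: a positive Borel measure `|ν|` living on
`(0, ∞)` and a Borel function of modulus one.  Signed measures have `phase` valued in `{1, -1}`
(Hahn decomposition).  The field `variation` is the total variation `|ν|`. -/
structure ComplexBorelMeasure where
  variation : Measure ℝ
  variation_Iic : variation (Set.Iic 0) = 0
  phase : ℝ → ℂ
  measurable_phase : Measurable phase
  norm_phase : ∀ t, ‖phase t‖ = 1

/-- The kernel `Γ(|n|/2)⁻¹ ∫_0^∞ δ_x^n G_t^α(x, y) t^(|n|/2 - 1) dt` of the Riesz-Laguerre
transform of order `n`. -/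
def rieszKernel {d : ℕ} (α : Fin d → ℝ) (n : Fin d → ℕ) (x y : EuclideanSpace ℝ (Fin d)) : ℂ :=
  ((1 / Real.Gamma (((∑ i, n i : ℕ) : ℝ) / 2) *
    ∫ t, deltaHeat α n t x y * t ^ (((∑ i, n i : ℕ) : ℝ) / 2 - 1) ∂timeMeasure : ℝ) : ℂ)

/-- The kernel `-∫_0^∞ ψ(t) ∂_t G_t^α(x, y) dt`. -/
def laplaceKernel {d : ℕ} (α : Fin d → ℝ) (ψ : ℝ → ℂ) (x y : EuclideanSpace ℝ (Fin d)) : ℂ :=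
  -∫ t, ψ t * ((deriv (fun s => heatKernel α s x y) t : ℝ) : ℂ) ∂timeMeasure

/-- The kernel `∫_0^∞ G_t^α(x, y) dν(t)`. -/
def stieltjesKernel {d : ℕ} (α : Fin d → ℝ) (ν : ComplexBorelMeasure)
    (x y : EuclideanSpace ℝ (Fin d)) : ℂ :=
  ∫ t, (heatKernel α t x y : ℂ) * ν.phase t ∂ν.variation

end

end LaguerreCZ

open LaguerreCZ

/-!
The proof computes no derivative of the heat kernel.  In one variable the kernel is
`2^(-ν) (sinh 2t)^(-(1+ν)) exp(-½ coth(2t) (x² + y²)) W_ν(x y / sinh 2t)` with the entire function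
`W_ν(z) = (z/2)^(-ν) I_ν(z)`, so it extends analytically to complex `(t, x, y)`.  A Gaussian bound
for this extension on the complex neighbourhood `|t - t₀| ≤ τ/4`, `|x - x₀|, |y - y₀| ≤ √τ`,
`τ = min t₀ 1`, of a real point yields by Cauchy's inequality all derivatives, each `x`-derivative
costing `τ^(-1/2)` and each `t`-derivative `τ^(-1)`.

The Gaussian bound (`exists_norm_heatC_le`) has two ingredients.  One is
`|W_ν(z)| ≤ C e^R (1 + R)^(-(ν+1/2)) ((1 + |z|) / (1 + R))²`, `R = |Re z|`
(`exists_norm_besselW_le`): it follows from Poisson's integral for `ν > -1/2`, and the relation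
`W_ν = (ν + 1) W_{ν+1} + (z/2)² W_{ν+2}` extends it to `ν > -1`.  The other is the identity
`± x y / sinh 2t - ½ coth(2t) (x² + y²) = -¼ (coth t (x ∓ y)² + tanh t (x ± y)²)`
with `Re coth t ≈ 1/τ` and `Re tanh t ≈ τ` (`mehler_exponent_le`, `hyperbolic_bounds`).  The
operator `δ = ∂ + x` is `e^(-x²/2) ∂ e^(x²/2)`, and the loss from the exponentials is absorbed by
`e^(-c τ (x₀ + y₀)²)` (`exists_norm_deltaC_le`).  The kernel in `d` variables is a product, and
`δ_x^n` acts on it factor by factor; its increments are controlled by the mean value inequality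
(`exists_norm_mixedC_sub_le`).

Write `r = |x - y|` and `V(x, r) = ∏ r (x_i + r)^(2α_i+1)`, which bounds the measure of the ball
from above.  Doubling and reverse doubling of `V` replace `V(x, √τ)⁻¹ e^(-c r²/τ)` by
`V(x, r)⁻¹ Φ(r/√τ)` with `Φ(u) = min(u^ε, u^(-ε))`, `ε > 0`.  Thus
`|∂_t^m δ_x^n G_t(x, y)| ≤ C μ(B(x, r))⁻¹ e^(-(2d+2|α|) t) τ^(-(m+|n|/2)) Φ(r/√τ)`, and the
increments satisfy the same bound with the additional factor `(|x - x'| + |y - y'|)/r`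
(`hasTimeProfile_mixedHeat`).  The dependence on `t` is now explicit.  After multiplication by
`t^(m+|n|/2-1)` it is integrable with a bound uniform in `r`, because `Φ(r/√t) dt/t` is
(`exists_lintegral_timeProfile_le`); this covers the kernels defined by integrals against `dt` and,
after squaring, the `L²`-valued ones.  The remaining two families use `Φ ≤ 1` and
`m = |n| = 0` only.
-/

namespace LaguerreCZ

/-! ### The modified Bessel function as an entire function -/

/-- The coefficients `1 / (k! Γ(ν + k + 1))` of the modified Bessel function. -/
noncomputable def besselCoeff (ν : ℝ) (k : ℕ) : ℝ :=
  1 / (k.factorial * Real.Gamma (ν + k + 1))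

/-- The entire even function `(z / 2)^(-ν) I_ν(z)`, given by its power series. -/
noncomputable def besselW (ν : ℝ) (z : ℂ) : ℂ :=
  ∑' k : ℕ, (besselCoeff ν k : ℂ) * (z / 2) ^ (2 * k)

lemma besselCoeff_pos {ν : ℝ} (hν : -1 < ν) (k : ℕ) : 0 < besselCoeff ν k := by
  have hk : (0 : ℝ) ≤ k := k.cast_nonneg
  have : 0 < Real.Gamma (ν + k + 1) := Real.Gamma_pos_of_pos (by linarith)
  have h2 : (0 : ℝ) < k.factorial := by exact_mod_cast k.factorial_pos
  unfold besselCoeff; positivity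

lemma besselCoeff_succ {ν : ℝ} (hν : -1 < ν) (k : ℕ) :
    besselCoeff ν (k + 1) = besselCoeff ν k / ((k + 1) * (ν + k + 1)) := by
  have hk : (0 : ℝ) ≤ k := k.cast_nonneg
  have h0 : ν + k + 1 ≠ 0 := by linarith
  have : 0 < Real.Gamma (ν + k + 1) := Real.Gamma_pos_of_pos (by linarith)
  have h2 : (0 : ℝ) < k.factorial := by exact_mod_cast k.factorial_pos
  have h3 : Real.Gamma (ν + (k + 1 : ℕ) + 1) = (ν + k + 1) * Real.Gamma (ν + k + 1) := by
    rw [← Real.Gamma_add_one h0]; push_cast; ring_nf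
  unfold besselCoeff
  rw [h3, Nat.factorial_succ]
  push_cast
  field_simp

lemma summable_besselCoeff {ν : ℝ} (hν : -1 < ν) (r : ℝ) :
    Summable (fun k => besselCoeff ν k * r ^ k) := by
  rcases eq_or_ne r 0 with rfl | hr
  · refine summable_of_ne_finset_zero (s := {0}) fun k hk => ?_
    rw [zero_pow (by simpa using hk), mul_zero]
  refine summable_of_ratio_test_tendsto_lt_one (l := 0) one_pos ?_ ?_
  · exact Filter.Eventually.of_forall fun k =>
      mul_ne_zero (besselCoeff_pos hν k).ne' (pow_ne_zero _ hr)
  · have h1 : Filter.Tendsto (fun k : ℕ => (‖r‖ / (ν + k + 1)) * (1 / ((k : ℝ) + 1)))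
        Filter.atTop (nhds (0 * 0)) := by
      refine Filter.Tendsto.mul ?_ tendsto_one_div_add_atTop_nhds_zero_nat
      refine Filter.Tendsto.div_atTop tendsto_const_nhds ?_
      refine Filter.tendsto_atTop_add_const_right _ _ ?_
      exact Filter.tendsto_atTop_add_const_left _ _ tendsto_natCast_atTop_atTop
    rw [mul_zero] at h1
    refine h1.congr fun k => ?_
    have hk : (0 : ℝ) ≤ k := k.cast_nonneg
    have h0 : 0 < ν + k + 1 := by linarith
    have hc := besselCoeff_pos hν k
    rw [besselCoeff_succ hν, norm_mul, norm_mul, norm_div, norm_pow, norm_pow, pow_succ,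
      Real.norm_of_nonneg (r := (k + 1 : ℝ) * (ν + k + 1)) (by positivity),
      Real.norm_of_nonneg hc.le]
    have : 0 < ‖r‖ := norm_pos_iff.2 hr
    field_simp

lemma norm_besselW_term (ν : ℝ) (hν : -1 < ν) (z : ℂ) (k : ℕ) :
    ‖(besselCoeff ν k : ℂ) * (z / 2) ^ (2 * k)‖ = besselCoeff ν k * (‖z‖ ^ 2 / 4) ^ k := by
  rw [norm_mul, Complex.norm_real, Real.norm_of_nonneg (besselCoeff_pos hν k).le, norm_pow,
    norm_div, pow_mul]
  norm_num [div_pow]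

lemma summable_besselW {ν : ℝ} (hν : -1 < ν) (z : ℂ) :
    Summable fun k : ℕ => (besselCoeff ν k : ℂ) * (z / 2) ^ (2 * k) := by
  refine Summable.of_norm ?_
  simp_rw [norm_besselW_term ν hν]
  exact summable_besselCoeff hν _

lemma differentiable_besselW {ν : ℝ} (hν : -1 < ν) : Differentiable ℂ (besselW ν) := by
  intro z
  have h : DifferentiableOn ℂ (besselW ν) (Metric.ball 0 (‖z‖ + 1)) := by
    refine Complex.differentiableOn_tsum_of_summable_norm
      (u := fun k => besselCoeff ν k * ((‖z‖ + 1) ^ 2 / 4) ^ k)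
      (summable_besselCoeff hν _) (fun k => ?_) Metric.isOpen_ball ?_
    · exact Differentiable.differentiableOn (by fun_prop)
    · intro k w hw
      rw [norm_besselW_term ν hν]
      have hc := besselCoeff_pos hν k
      have : ‖w‖ ≤ ‖z‖ + 1 := by simpa using (mem_ball_zero_iff.1 hw).le
      gcongr
  exact h.differentiableAt (Metric.isOpen_ball.mem_nhds (by simp))

/-- The contiguity relation `I_ν - I_{ν+2} = (2 (ν + 1) / z) I_{ν+1}`. -/
lemma besselW_recurrence {ν : ℝ} (hν : -1 < ν) (z : ℂ) :
    besselW ν z = (ν + 1) * besselW (ν + 1) z + (z / 2) ^ 2 * besselW (ν + 2) z := by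
  have s0 := summable_besselW hν z
  have s1 := summable_besselW (ν := ν + 1) (by linarith) z
  have s2 := summable_besselW (ν := ν + 2) (by linarith) z
  have key : ∀ k : ℕ, besselCoeff ν (k + 1) =
      (ν + 1) * besselCoeff (ν + 1) (k + 1) + besselCoeff (ν + 2) k := by
    intro k
    have hk : (0 : ℝ) ≤ k := k.cast_nonneg
    have h0 : ν + k + 2 ≠ 0 := by linarith
    have hG : 0 < Real.Gamma (ν + k + 2) := Real.Gamma_pos_of_pos (by linarith)
    have h2 : (0 : ℝ) < k.factorial := by exact_mod_cast k.factorial_pos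
    have e : Real.Gamma (ν + k + 2 + 1) = (ν + k + 2) * Real.Gamma (ν + k + 2) :=
      Real.Gamma_add_one h0
    unfold besselCoeff
    rw [show ν + ((k + 1 : ℕ) : ℝ) + 1 = ν + k + 2 by push_cast; ring,
      show ν + 1 + ((k + 1 : ℕ) : ℝ) + 1 = ν + k + 2 + 1 by push_cast; ring,
      show ν + 2 + (k : ℝ) + 1 = ν + k + 2 + 1 by ring, e, Nat.factorial_succ]
    push_cast
    field_simp
    ring
  have key0 : besselCoeff ν 0 = (ν + 1) * besselCoeff (ν + 1) 0 := by
    have hG : 0 < Real.Gamma (ν + 1) := Real.Gamma_pos_of_pos (by linarith)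
    have e : Real.Gamma (ν + 1 + 1) = (ν + 1) * Real.Gamma (ν + 1) :=
      Real.Gamma_add_one (by linarith)
    have : ν + 1 ≠ 0 := by linarith
    simp only [besselCoeff, Nat.cast_zero, add_zero, e]
    field_simp
  unfold besselW
  rw [s0.tsum_eq_zero_add, s1.tsum_eq_zero_add, key0]
  have t1 := (summable_nat_add_iff 1).2 s1
  simp only [key]
  rw [mul_add, ← tsum_mul_left, ← tsum_mul_left, add_assoc,
    ← Summable.tsum_add (t1.mul_left _) (s2.mul_left _)]
  congr 1
  · push_cast; ring
  · refine tsum_congr fun k => ?_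
    push_cast; ring

lemma integrableOn_beta {a b : ℝ} (ha : 0 < a) (hb : 0 < b) :
    IntegrableOn (fun u : ℝ => u ^ (a - 1) * (1 - u) ^ (b - 1)) (Set.Ioc 0 1) := by
  have h := Complex.betaIntegral_convergent (u := a) (v := b) (by simpa) (by simpa)
  rw [intervalIntegrable_iff_integrableOn_Ioc_of_le zero_le_one] at h
  have h' : IntegrableOn (fun x : ℝ =>
      ((x : ℂ) ^ ((a : ℂ) - 1) * (1 - (x : ℂ)) ^ ((b : ℂ) - 1)).re) (Set.Ioc 0 1) := h.re
  refine h'.congr_fun (fun u hu => ?_) measurableSet_Ioc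
  beta_reduce
  have h1 : (0 : ℝ) ≤ 1 - u := by linarith [hu.2]
  rw [show ((a : ℂ) - 1) = ((a - 1 : ℝ) : ℂ) by simp,
    show ((b : ℂ) - 1) = ((b - 1 : ℝ) : ℂ) by simp,
    show (1 - (u : ℂ)) = ((1 - u : ℝ) : ℂ) by simp,
    ← Complex.ofReal_cpow hu.1.le, ← Complex.ofReal_cpow h1, ← Complex.ofReal_mul,
    Complex.ofReal_re]

lemma integral_beta {a b : ℝ} (ha : 0 < a) (hb : 0 < b) :
    ∫ u in Set.Ioc (0 : ℝ) 1, u ^ (a - 1) * (1 - u) ^ (b - 1) =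
      Real.Gamma a * Real.Gamma b / Real.Gamma (a + b) := by
  have h := Complex.betaIntegral_eq_Gamma_mul_div a b (by simpa) (by simpa)
  rw [Complex.betaIntegral, intervalIntegral.integral_of_le zero_le_one] at h
  have h2 : ∫ x in Set.Ioc (0 : ℝ) 1, (x : ℂ) ^ ((a : ℂ) - 1) * (1 - (x : ℂ)) ^ ((b : ℂ) - 1)
      = ∫ x in Set.Ioc (0 : ℝ) 1, ((x ^ (a - 1) * (1 - x) ^ (b - 1) : ℝ) : ℂ) := by
    refine setIntegral_congr_fun measurableSet_Ioc fun u hu => ?_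
    have h1 : (0 : ℝ) ≤ 1 - u := by linarith [hu.2]
    rw [Complex.ofReal_mul, Complex.ofReal_cpow hu.1.le, Complex.ofReal_cpow h1]
    push_cast; rfl
  rw [h2, integral_complex_ofReal, ← Complex.ofReal_add, Complex.Gamma_ofReal,
    Complex.Gamma_ofReal, Complex.Gamma_ofReal] at h
  exact_mod_cast h

/-- The moments of the Poisson density produce the Bessel coefficients. -/
lemma besselCoeff_eq_moment {ν : ℝ} (hν : -(1 / 2) < ν) (k : ℕ) :
    besselCoeff ν k * (1 / 4) ^ k = (√Real.pi * Real.Gamma (ν + 1 / 2))⁻¹ *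
      ((((2 * k).factorial : ℕ) : ℝ)⁻¹ * ∫ u in Set.Ioc (0 : ℝ) 1,
        u ^ ((k + 1 / 2 : ℝ) - 1) * (1 - u) ^ ((ν + 1 / 2) - 1)) := by
  have hk : (0 : ℝ) ≤ k := k.cast_nonneg
  rw [integral_beta (by linarith) (by linarith)]
  have d := Real.Gamma_mul_Gamma_add_half (k + 1 / 2)
  have e1 : (k : ℝ) + 1 / 2 + 1 / 2 = k + 1 := by ring
  have e2 : 2 * ((k : ℝ) + 1 / 2) = ((2 * k : ℕ) : ℝ) + 1 := by push_cast; ring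
  rw [e1, e2, Real.Gamma_nat_eq_factorial, Real.Gamma_nat_eq_factorial] at d
  have e3 : (2 : ℝ) ^ (1 - (((2 * k : ℕ) : ℝ) + 1)) = (1 / 4) ^ k := by
    rw [show 1 - (((2 * k : ℕ) : ℝ) + 1) = -((2 * k : ℕ) : ℝ) by ring, Real.rpow_neg two_pos.le,
      Real.rpow_natCast, pow_mul, one_div, inv_pow]
    norm_num
  rw [e3] at d
  have hG : 0 < Real.Gamma (ν + k + 1) := Real.Gamma_pos_of_pos (by linarith)
  have hG2 : 0 < Real.Gamma (ν + 1 / 2) := Real.Gamma_pos_of_pos (by linarith)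
  have h2 : (0 : ℝ) < k.factorial := by exact_mod_cast k.factorial_pos
  have h3 : (0 : ℝ) < (2 * k).factorial := by exact_mod_cast (2 * k).factorial_pos
  have h4 : 0 < √Real.pi := Real.sqrt_pos.2 Real.pi_pos
  have h5 : Real.Gamma (k + 1 / 2) =
      (2 * k).factorial * (1 / 4) ^ k * √Real.pi / k.factorial := by
    rw [eq_div_iff h2.ne', d]
  rw [h5, show (k : ℝ) + 1 / 2 + (ν + 1 / 2) = ν + k + 1 by ring]
  unfold besselCoeff
  generalize Real.Gamma (ν + 1 / 2) = g at *
  field_simp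

/-! ### Growth of the Bessel function in the complex plane -/

lemma exists_one_add_rpow_mul_exp_neg_le (a : ℝ) {c : ℝ} (hc : 0 < c) :
    ∃ C > 0, ∀ x : ℝ, 0 ≤ x → (1 + x) ^ a * Real.exp (-(c * x)) ≤ C := by
  obtain ⟨n, hn⟩ := exists_nat_ge a
  refine ⟨n.factorial / c ^ n * Real.exp c, by positivity, fun x hx => ?_⟩
  have h1 : (1 + x) ^ a ≤ (1 + x) ^ n := by
    rw [← Real.rpow_natCast]
    exact Real.rpow_le_rpow_of_exponent_le (by linarith) hn
  have h2 := Real.pow_div_factorial_le_exp (c * (1 + x)) (by positivity) n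
  have h3 : (1 + x) ^ n ≤ n.factorial / c ^ n * Real.exp (c * (1 + x)) := by
    rw [mul_pow, div_le_iff₀ (by positivity)] at h2
    rw [div_mul_eq_mul_div, le_div_iff₀ (by positivity)]
    linarith
  calc (1 + x) ^ a * Real.exp (-(c * x))
      ≤ (n.factorial / c ^ n * Real.exp (c * (1 + x))) * Real.exp (-(c * x)) := by
        gcongr; exact h1.trans h3
    _ = _ := by
        rw [mul_assoc, ← Real.exp_add]; ring_nf

lemma norm_cosh_le (z : ℂ) : ‖Complex.cosh z‖ ≤ Real.exp |z.re| := by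
  have h : Complex.cosh z = (Complex.exp z + Complex.exp (-z)) / 2 := rfl
  rw [h, norm_div]
  have h1 := norm_add_le (Complex.exp z) (Complex.exp (-z))
  rw [Complex.norm_exp, Complex.norm_exp, Complex.neg_re] at h1
  have h2 := Real.exp_le_exp.2 (le_abs_self z.re)
  have h3 := Real.exp_le_exp.2 (neg_le_abs z.re)
  rw [Complex.norm_ofNat, div_le_iff₀ two_pos]
  linarith

/-- Poisson's integral representation of `I_ν` for `ν > -1/2`, used only through this bound. -/
lemma norm_besselW_le_integral {ν : ℝ} (hν : -(1 / 2) < ν) (z : ℂ) :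
    ‖besselW ν z‖ ≤ (√Real.pi * Real.Gamma (ν + 1 / 2))⁻¹ *
      ∫ u in Set.Ioc (0 : ℝ) 1, Real.exp (|z.re| * √u) *
        (u ^ ((1 / 2 : ℝ) - 1) * (1 - u) ^ ((ν + 1 / 2) - 1)) := by
  set c : ℝ := (√Real.pi * Real.Gamma (ν + 1 / 2))⁻¹ with hc
  have hG : 0 < Real.Gamma (ν + 1 / 2) := Real.Gamma_pos_of_pos (by linarith)
  have hcpos : 0 < c := by
    have := Real.sqrt_pos.2 Real.pi_pos
    positivity
  set dens : ℕ → ℝ → ℝ := fun k u => u ^ ((k + 1 / 2 : ℝ) - 1) * (1 - u) ^ ((ν + 1 / 2) - 1)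
    with hdens
  have hdi : ∀ k, IntegrableOn (dens k) (Set.Ioc 0 1) := fun k =>
    integrableOn_beta (by positivity) (by linarith)
  have hdnn : ∀ k, ∀ u ∈ Set.Ioc (0 : ℝ) 1, 0 ≤ dens k u := fun k u hu =>
    mul_nonneg (Real.rpow_nonneg hu.1.le _) (Real.rpow_nonneg (by linarith [hu.2]) _)
  set F : ℕ → ℝ → ℂ := fun k u =>
    ((c : ℂ) * (z ^ (2 * k) / ((2 * k).factorial : ℂ))) * (dens k u : ℂ) with hF
  have hFi : ∀ k, Integrable (F k) (volume.restrict (Set.Ioc 0 1)) := fun k =>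
    ((hdi k).ofReal (𝕜 := ℂ)).const_mul _
  have hmom := fun k => besselCoeff_eq_moment hν k
  have hFint : ∀ k, ∫ u in Set.Ioc (0 : ℝ) 1, F k u
      = (besselCoeff ν k : ℂ) * (z / 2) ^ (2 * k) := by
    intro k
    have h1 : ∫ u in Set.Ioc (0 : ℝ) 1, F k u =
        ((c : ℂ) * (z ^ (2 * k) / ((2 * k).factorial : ℂ))) *
          ((∫ u in Set.Ioc (0 : ℝ) 1, dens k u : ℝ) : ℂ) := by
      rw [← integral_complex_ofReal, ← integral_const_mul]
    have h2 := congrArg (fun r : ℝ => (r : ℂ)) (hmom k)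
    simp only [Complex.ofReal_mul, Complex.ofReal_pow, Complex.ofReal_inv] at h2
    rw [h1, div_pow, pow_mul 2 2 k, show ((2 : ℂ) ^ 2) ^ k = 4 ^ k by norm_num]
    have h4 : (besselCoeff ν k : ℂ) * (z ^ (2 * k) / 4 ^ k) =
        ((besselCoeff ν k : ℂ) * (((1 / 4 : ℝ) : ℂ)) ^ k) * z ^ (2 * k) := by
      push_cast
      rw [one_div, inv_pow]; ring
    rw [h4, h2, hc]
    push_cast
    ring
  have hFnorm : ∀ k, ∫ u in Set.Ioc (0 : ℝ) 1, ‖F k u‖ =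
      besselCoeff ν k * (‖z‖ ^ 2 / 4) ^ k := by
    intro k
    have h1 : ∫ u in Set.Ioc (0 : ℝ) 1, ‖F k u‖ = ∫ u in Set.Ioc (0 : ℝ) 1,
        (c * (‖z‖ ^ (2 * k) / ((2 * k).factorial : ℝ))) * dens k u := by
      refine setIntegral_congr_fun measurableSet_Ioc fun u hu => ?_
      simp only [hF, norm_mul, norm_div, norm_pow, Complex.norm_real, Complex.norm_natCast]
      rw [Real.norm_of_nonneg hcpos.le, Real.norm_of_nonneg (hdnn k u hu)]
    rw [h1, integral_const_mul, div_pow, show (‖z‖ ^ 2) ^ k = ‖z‖ ^ (2 * k) by rw [pow_mul],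
      show besselCoeff ν k * (‖z‖ ^ (2 * k) / 4 ^ k) =
        (besselCoeff ν k * (1 / 4) ^ k) * ‖z‖ ^ (2 * k) by rw [one_div, inv_pow]; ring, hmom k]
    simp only [hdens]
    ring
  have hsum := hasSum_integral_of_summable_integral_norm hFi
    (by simp_rw [hFnorm]; exact summable_besselCoeff (by linarith) _)
  simp_rw [hFint] at hsum
  have hW : besselW ν z = ∫ u in Set.Ioc (0 : ℝ) 1, ∑' k, F k u := hsum.tsum_eq
  have hpt : ∀ u ∈ Set.Ioc (0 : ℝ) 1,
      ∑' k, F k u = (c : ℂ) * (Complex.cosh (z * (√u : ℝ)) * (dens 0 u : ℂ)) := by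
    intro u hu
    rw [Complex.cosh_eq_tsum, ← tsum_mul_right, ← tsum_mul_left]
    refine tsum_congr fun k => ?_
    have h1 : dens k u = u ^ k * dens 0 u := by
      simp only [hdens]
      rw [show ((k : ℝ) + 1 / 2 - 1) = (((0 : ℕ) : ℝ) + 1 / 2 - 1) + k by push_cast; ring,
        Real.rpow_add_natCast hu.1.ne']
      ring
    have h2 : ((√u : ℝ) : ℂ) ^ (2 * k) = (u : ℂ) ^ k := by
      rw [pow_mul, ← Complex.ofReal_pow, Real.sq_sqrt hu.1.le]
    simp only [hF]
    rw [h1, mul_pow, h2]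
    push_cast
    ring
  rw [hW, ← integral_const_mul]
  refine norm_integral_le_of_norm_le ?_ ?_
  · refine Integrable.const_mul ?_ _
    refine Integrable.bdd_mul (c := Real.exp |z.re|)
      (integrableOn_beta (by norm_num) (by linarith)) (by fun_prop) ?_
    refine (ae_restrict_iff' measurableSet_Ioc).2 (Filter.Eventually.of_forall fun u hu => ?_)
    rw [Real.norm_of_nonneg (Real.exp_pos _).le, Real.exp_le_exp]
    exact mul_le_of_le_one_right (abs_nonneg _) (Real.sqrt_le_one.2 hu.2)
  · refine (ae_restrict_iff' measurableSet_Ioc).2 (Filter.Eventually.of_forall fun u hu => ?_)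
    have hd := hdnn 0 u hu
    rw [hpt u hu, norm_mul, norm_mul, Complex.norm_real, Complex.norm_real,
      Real.norm_of_nonneg hcpos.le, Real.norm_of_nonneg hd]
    have h1 := norm_cosh_le (z * (√u : ℝ))
    rw [Complex.re_mul_ofReal, abs_mul, abs_of_nonneg (Real.sqrt_nonneg u)] at h1
    have h2 : dens 0 u = u ^ ((1 / 2 : ℝ) - 1) * (1 - u) ^ ((ν + 1 / 2) - 1) := by
      simp [hdens]
    rw [← h2]
    gcongr

lemma integral_one_sub_rpow_mul_exp_le {b s : ℝ} (hb : 0 < b) (hs : 0 < s) :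
    IntegrableOn (fun u : ℝ => (1 - u) ^ (b - 1) * Real.exp (-(s * (1 - u)))) (Set.Ioc 0 1) ∧
    ∫ u in Set.Ioc (0 : ℝ) 1, (1 - u) ^ (b - 1) * Real.exp (-(s * (1 - u))) ≤
      (1 / s) ^ b * Real.Gamma b := by
  have hval := Real.integral_rpow_mul_exp_neg_mul_Ioi hb hs
  have hint : IntegrableOn (fun t : ℝ => t ^ (b - 1) * Real.exp (-(s * t))) (Set.Ioi 0) := by
    by_contra h
    rw [integral_undef h] at hval
    have : 0 < (1 / s) ^ b * Real.Gamma b :=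
      mul_pos (by positivity) (Real.Gamma_pos_of_pos hb)
    linarith
  have hint1 : IntegrableOn (fun t : ℝ => t ^ (b - 1) * Real.exp (-(s * t))) (Set.Ioc 0 1) :=
    hint.mono_set Set.Ioc_subset_Ioi_self
  constructor
  · rw [← intervalIntegrable_iff_integrableOn_Ioc_of_le zero_le_one] at hint1 ⊢
    simpa using (hint1.comp_sub_left 1).symm
  · rw [← intervalIntegral.integral_of_le zero_le_one, intervalIntegral.integral_comp_sub_left
      (fun t : ℝ => t ^ (b - 1) * Real.exp (-(s * t))) 1, sub_self, sub_zero,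
      intervalIntegral.integral_of_le zero_le_one, ← hval]
    refine setIntegral_mono_set hint ?_ (Set.Ioc_subset_Ioi_self.eventuallyLE)
    refine (ae_restrict_iff' measurableSet_Ioi).2 (Filter.Eventually.of_forall fun u hu => ?_)
    exact mul_nonneg (Real.rpow_nonneg (le_of_lt hu) _) (Real.exp_pos _).le

/-- In Poisson's integral the exponential `e^(R √u) ≤ e^R e^(-R (1 - u) / 2)`, `R = |Re z|`,
concentrates at `u = 1`, where the weight `(1 - u)^(ν - 1/2)` produces the decay
`(1 + R)^(-(ν + 1/2))`. -/
lemma exists_norm_besselW_le_of_half {ν : ℝ} (hν : -(1 / 2) < ν) :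
    ∃ C > 0, ∀ z : ℂ,
      ‖besselW ν z‖ ≤ C * Real.exp |z.re| * (1 + |z.re|) ^ (-(ν + 1 / 2)) := by
  have hb : 0 < ν + 1 / 2 := by linarith
  set b := ν + 1 / 2 with hbdef
  set c : ℝ := (√Real.pi * Real.Gamma b)⁻¹ with hc
  have hG : 0 < Real.Gamma b := Real.Gamma_pos_of_pos hb
  have hcpos : 0 < c := by
    have := Real.sqrt_pos.2 Real.pi_pos
    positivity
  obtain ⟨C1, hC1, hC1'⟩ := exists_one_add_rpow_mul_exp_neg_le b (c := 1 / 4) (by norm_num)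
  have hbeta := integrableOn_beta (a := 1 / 2) (b := b) (by norm_num) hb
  set M := ∫ u in Set.Ioc (0 : ℝ) 1, u ^ ((1 / 2 : ℝ) - 1) * (1 - u) ^ (b - 1) with hM
  have hM0 : 0 ≤ M := setIntegral_nonneg measurableSet_Ioc fun u hu =>
    mul_nonneg (Real.rpow_nonneg hu.1.le _) (Real.rpow_nonneg (by linarith [hu.2]) _)
  set C2 := 2 * Real.exp (1 / 2) * (2 ^ b * Real.Gamma b) with hC2
  refine ⟨c * (C2 + C1 * M), by positivity, fun z => ?_⟩
  refine (norm_besselW_le_integral hν z).trans ?_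
  set R := |z.re| with hR
  have hR0 : 0 ≤ R := abs_nonneg _
  have hs : 0 < (1 + R) / 2 := by positivity
  obtain ⟨hi, hle⟩ := integral_one_sub_rpow_mul_exp_le hb hs
  -- near `u = 1` the weight is `(1 - u)^(b - 1)`, elsewhere the exponential gains `e^(-R/4)`
  have key : ∫ u in Set.Ioc (0 : ℝ) 1, Real.exp (R * √u) *
        (u ^ ((1 / 2 : ℝ) - 1) * (1 - u) ^ (b - 1)) ≤
      ∫ u in Set.Ioc (0 : ℝ) 1, (Real.exp R * (2 * Real.exp (1 / 2))) *
        ((1 - u) ^ (b - 1) * Real.exp (-((1 + R) / 2 * (1 - u)))) +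
        (Real.exp R * Real.exp (-(1 / 4 * R))) * (u ^ ((1 / 2 : ℝ) - 1) * (1 - u) ^ (b - 1)) := by
    refine integral_mono_of_nonneg ?_ ((hi.const_mul _).add (hbeta.const_mul _)) ?_
    · refine (ae_restrict_iff' measurableSet_Ioc).2 (Filter.Eventually.of_forall fun u hu => ?_)
      exact mul_nonneg (Real.exp_pos _).le
        (mul_nonneg (Real.rpow_nonneg hu.1.le _) (Real.rpow_nonneg (by linarith [hu.2]) _))
    · refine (ae_restrict_iff' measurableSet_Ioc).2 (Filter.Eventually.of_forall fun u hu => ?_)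
      beta_reduce
      have hu1 : 0 ≤ 1 - u := by linarith [hu.2]
      have hw : 0 ≤ (1 - u) ^ (b - 1) := Real.rpow_nonneg hu1 _
      have hv : 0 ≤ u ^ ((1 / 2 : ℝ) - 1) := Real.rpow_nonneg hu.1.le _
      have hsq : √u ≤ (1 + u) / 2 := by
        have := Real.sq_sqrt hu.1.le
        nlinarith [sq_nonneg (√u - 1)]
      have hexp : Real.exp (R * √u) ≤ Real.exp R * Real.exp (-(R * (1 - u) / 2)) := by
        rw [← Real.exp_add, Real.exp_le_exp]
        nlinarith
      rcases le_total (1 / 2) u with h | h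
      · have h1 : u ^ ((1 / 2 : ℝ) - 1) ≤ 2 := by
          calc u ^ ((1 / 2 : ℝ) - 1) ≤ (1 / 2 : ℝ) ^ ((1 / 2 : ℝ) - 1) :=
                Real.rpow_le_rpow_of_nonpos (by norm_num) h (by norm_num)
            _ ≤ (1 / 2 : ℝ) ^ (-1 : ℝ) :=
                Real.rpow_le_rpow_of_exponent_ge (by norm_num) (by norm_num) (by norm_num)
            _ = 2 := by rw [Real.rpow_neg_one]; norm_num
        have h2 : Real.exp (-(R * (1 - u) / 2)) ≤
            Real.exp (1 / 2) * Real.exp (-((1 + R) / 2 * (1 - u))) := by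
          rw [← Real.exp_add, Real.exp_le_exp]
          nlinarith [hu.1]
        have h3 : 0 ≤ (Real.exp R * Real.exp (-(1 / 4 * R))) *
            (u ^ ((1 / 2 : ℝ) - 1) * (1 - u) ^ (b - 1)) := by positivity
        calc Real.exp (R * √u) * (u ^ ((1 / 2 : ℝ) - 1) * (1 - u) ^ (b - 1))
            ≤ (Real.exp R * (Real.exp (1 / 2) * Real.exp (-((1 + R) / 2 * (1 - u))))) *
              (2 * (1 - u) ^ (b - 1)) := by
              gcongr
              exact hexp.trans (by gcongr)
          _ = (Real.exp R * (2 * Real.exp (1 / 2))) *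
              ((1 - u) ^ (b - 1) * Real.exp (-((1 + R) / 2 * (1 - u)))) := by ring
          _ ≤ _ := le_add_of_nonneg_right h3
      · have h2 : Real.exp (-(R * (1 - u) / 2)) ≤ Real.exp (-(1 / 4 * R)) := by
          rw [Real.exp_le_exp]; nlinarith
        have h3 : 0 ≤ (Real.exp R * (2 * Real.exp (1 / 2))) *
              ((1 - u) ^ (b - 1) * Real.exp (-((1 + R) / 2 * (1 - u)))) := by positivity
        calc Real.exp (R * √u) * (u ^ ((1 / 2 : ℝ) - 1) * (1 - u) ^ (b - 1))
            ≤ (Real.exp R * Real.exp (-(1 / 4 * R))) *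
              (u ^ ((1 / 2 : ℝ) - 1) * (1 - u) ^ (b - 1)) := by
              gcongr
              exact hexp.trans (by gcongr)
          _ ≤ _ := le_add_of_nonneg_left h3
  have hpow : (1 / ((1 + R) / 2)) ^ b = 2 ^ b * (1 + R) ^ (-b) := by
    rw [one_div_div, Real.div_rpow two_pos.le (by positivity), Real.rpow_neg (by positivity)]
    rfl
  have hexp4 : Real.exp (-(1 / 4 * R)) ≤ C1 * (1 + R) ^ (-b) := by
    have := hC1' R hR0
    rw [Real.rpow_neg (by positivity), ← div_eq_mul_inv, le_div_iff₀ (by positivity)]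
    linarith
  rw [integral_add (hi.const_mul _) (hbeta.const_mul _), integral_const_mul, integral_const_mul,
    ← hM] at key
  rw [hpow] at hle
  calc c * ∫ u in Set.Ioc (0 : ℝ) 1, Real.exp (R * √u) *
        (u ^ ((1 / 2 : ℝ) - 1) * (1 - u) ^ (b - 1))
      ≤ c * ((Real.exp R * (2 * Real.exp (1 / 2))) * (2 ^ b * (1 + R) ^ (-b) * Real.Gamma b)
        + (Real.exp R * (C1 * (1 + R) ^ (-b))) * M) := by
        gcongr
        exact key.trans (by gcongr)
    _ = _ := by rw [hC2]; ring

/-- The growth of `z^(-ν) I_ν(z)` for all `ν > -1`; the last factor is bounded in a cone around the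
real axis and is harmless elsewhere.  Two upward shifts of the order reduce to `ν > -1/2`. -/
lemma exists_norm_besselW_le {ν : ℝ} (hν : -1 < ν) :
    ∃ C > 0, ∀ z : ℂ, ‖besselW ν z‖ ≤ C * Real.exp |z.re| *
      ((1 + |z.re|) ^ (-(ν + 1 / 2)) * ((1 + ‖z‖) / (1 + |z.re|)) ^ 2) := by
  obtain ⟨C1, hC1, h1⟩ := exists_norm_besselW_le_of_half (ν := ν + 1) (by linarith)
  obtain ⟨C2, hC2, h2⟩ := exists_norm_besselW_le_of_half (ν := ν + 2) (by linarith)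
  have hν1 : 0 < ν + 1 := by linarith
  refine ⟨(ν + 1) * C1 + C2, by positivity, fun z => ?_⟩
  set R := |z.re| with hR
  have hR0 : 0 ≤ R := abs_nonneg _
  have hRz : R ≤ ‖z‖ := Complex.abs_re_le_norm z
  have e2 : (1 + R) ^ (-(ν + 2 + 1 / 2)) = (1 + R) ^ (-(ν + 1 / 2)) / (1 + R) ^ 2 := by
    rw [← Real.rpow_natCast, ← Real.rpow_sub (by positivity)]
    congr 1; push_cast; ring
  have e1 : (1 + R) ^ (-(ν + 1 + 1 / 2)) ≤ (1 + R) ^ (-(ν + 1 / 2)) :=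
    Real.rpow_le_rpow_of_exponent_le (by linarith) (by linarith)
  have hratio : 1 ≤ ((1 + ‖z‖) / (1 + R)) ^ 2 := by
    refine one_le_pow₀ ?_
    rw [le_div_iff₀ (by positivity)]; linarith
  have hp : 0 < (1 + R) ^ (-(ν + 1 / 2)) := by positivity
  rw [besselW_recurrence hν]
  have n1 : ‖((ν : ℂ) + 1) * besselW (ν + 1) z‖ ≤ (ν + 1) * C1 * Real.exp R *
      ((1 + R) ^ (-(ν + 1 / 2)) * ((1 + ‖z‖) / (1 + R)) ^ 2) := by
    rw [norm_mul, show (ν : ℂ) + 1 = ((ν + 1 : ℝ) : ℂ) by push_cast; ring, Complex.norm_real,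
      Real.norm_of_nonneg hν1.le]
    calc (ν + 1) * ‖besselW (ν + 1) z‖
        ≤ (ν + 1) * (C1 * Real.exp R * ((1 + R) ^ (-(ν + 1 / 2)) * 1)) := by
          gcongr
          refine (h1 z).trans ?_
          rw [mul_one]
          gcongr
      _ ≤ (ν + 1) * (C1 * Real.exp R *
          ((1 + R) ^ (-(ν + 1 / 2)) * ((1 + ‖z‖) / (1 + R)) ^ 2)) := by gcongr
      _ = _ := by ring
  have n2 : ‖(z / 2) ^ 2 * besselW (ν + 2) z‖ ≤ C2 * Real.exp R *
      ((1 + R) ^ (-(ν + 1 / 2)) * ((1 + ‖z‖) / (1 + R)) ^ 2) := by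
    have hz : ‖(z / 2) ^ 2‖ ≤ (1 + ‖z‖) ^ 2 := by
      rw [norm_pow, norm_div, Complex.norm_ofNat]
      have := norm_nonneg z
      gcongr
      linarith
    rw [norm_mul]
    calc ‖(z / 2) ^ 2‖ * ‖besselW (ν + 2) z‖
        ≤ (1 + ‖z‖) ^ 2 * (C2 * Real.exp R * ((1 + R) ^ (-(ν + 1 / 2)) / (1 + R) ^ 2)) := by
          gcongr
          rw [← e2]; exact h2 z
      _ = _ := by rw [div_pow]; ring
  calc _ ≤ _ := norm_add_le _ _
    _ ≤ _ := add_le_add n1 n2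
    _ = _ := by ring

/-! ### Hyperbolic functions near the positive half-line -/

lemma sinh_le_two_mul_cosh {a : ℝ} (ha : 0 ≤ a) : Real.sinh a ≤ 2 * a * Real.cosh a := by
  have h1 : 1 - 2 * a ≤ Real.exp (-(2 * a)) := by
    have := Real.add_one_le_exp (-(2 * a)); linarith
  have h2 : Real.exp (-a) = Real.exp a * Real.exp (-(2 * a)) := by rw [← Real.exp_add]; ring_nf
  have h3 := Real.exp_pos a
  have h4 := Real.exp_pos (-a)
  rw [Real.sinh_eq, Real.cosh_eq]
  have h5 : Real.exp a * (1 - 2 * a) ≤ Real.exp (-a) := by rw [h2]; gcongr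
  nlinarith

/-- The hyperbolic functions at a real point near `t₀`, compared with `min(t₀, 1)`. -/
lemma real_hyperbolic_bounds {t0 a : ℝ} (ht0 : 0 < t0) (h : |a - t0| ≤ min t0 1 / 4) :
    Real.sinh a ≤ 5 / 2 * min t0 1 * Real.cosh a ∧
    min t0 1 * Real.cosh a ≤ 7 / 3 * Real.sinh a ∧
    3 / 16 * (min t0 1 * Real.exp (2 * t0)) ≤ Real.sinh (2 * a) := by
  set τ := min t0 1 with hτ
  have hτ0 : 0 < τ := lt_min ht0 one_pos
  have hτ1 : τ ≤ 1 := min_le_right _ _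
  have hτt : τ ≤ t0 := min_le_left _ _
  rw [abs_le] at h
  have ha2 : a ≤ 5 / 4 * t0 := by linarith
  have ha3 : 3 / 4 * τ ≤ a := by linarith
  have ha0 : 0 < a := by linarith
  have hA0 : 0 < Real.sinh a := Real.sinh_pos_iff.2 ha0
  have hC0 : 0 < Real.cosh a := Real.cosh_pos a
  refine ⟨?_, ?_, ?_⟩
  · rcases le_total t0 1 with h1 | h1
    · rw [hτ, min_eq_left h1]
      exact (sinh_le_two_mul_cosh ha0.le).trans
        (mul_le_mul_of_nonneg_right (by linarith) hC0.le)
    · rw [hτ, min_eq_right h1]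
      have := Real.sinh_lt_cosh a
      linarith
  · have h1 : Real.cosh a - Real.sinh a ≤ 1 := by
      rw [Real.cosh_sub_sinh, Real.exp_le_one_iff]; linarith
    have h2 : a ≤ Real.sinh a := Real.self_le_sinh_iff.2 ha0.le
    have h3 : a * Real.cosh a ≤ (a + 1) * Real.sinh a := by nlinarith
    have h4 : τ * (a + 1) ≤ 7 / 3 * a := by nlinarith
    refine le_of_mul_le_mul_left ?_ ha0
    calc a * (τ * Real.cosh a) = τ * (a * Real.cosh a) := by ring
      _ ≤ τ * ((a + 1) * Real.sinh a) := by gcongr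
      _ = τ * (a + 1) * Real.sinh a := by ring
      _ ≤ 7 / 3 * a * Real.sinh a := by gcongr
      _ = _ := by ring
  · rw [Real.sinh_eq]
    have e1 : Real.exp (2 * t0) * Real.exp (-(1 / 2)) ≤ Real.exp (2 * a) := by
      rw [← Real.exp_add, Real.exp_le_exp]; linarith
    have e2 : (1 : ℝ) / 2 ≤ Real.exp (-(1 / 2)) := by
      have := Real.add_one_le_exp (-(1 / 2) : ℝ); linarith
    have e3 : Real.exp (-(2 * a)) = Real.exp (2 * a) * Real.exp (-(4 * a)) := by
      rw [← Real.exp_add]; ring_nf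
    have e4 : Real.exp (-(4 * a)) * (1 + 3 * τ) ≤ 1 := by
      have h1 := Real.add_one_le_exp (4 * a)
      have h2 : Real.exp (-(4 * a)) * Real.exp (4 * a) = 1 := by
        rw [← Real.exp_add]; simp
      rw [← h2]
      gcongr
      linarith
    have e5 : 3 / 4 * τ ≤ 1 - Real.exp (-(4 * a)) := by
      have h6 : 3 / 4 * τ * (1 + 3 * τ) ≤ 3 * τ := by nlinarith
      refine le_of_mul_le_mul_right ?_ (by linarith : 0 < 1 + 3 * τ)
      linarith
    have e6 : Real.exp (2 * t0) * (1 / 2) ≤ Real.exp (2 * a) := by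
      refine le_trans ?_ e1
      gcongr
    have e7 : Real.exp (2 * t0) * (1 / 2) * (3 / 4 * τ) ≤
        Real.exp (2 * a) * (1 - Real.exp (-(4 * a))) := by gcongr
    rw [e3]
    linarith

lemma sinh_eq_mk (t : ℂ) : Complex.sinh t =
    ⟨Real.sinh t.re * Real.cos t.im, Real.cosh t.re * Real.sin t.im⟩ := by
  conv_lhs => rw [← Complex.re_add_im t, Complex.sinh_add, Complex.sinh_mul_I,
    Complex.cosh_mul_I]
  apply Complex.ext <;>
    simp [← Complex.ofReal_sinh, ← Complex.ofReal_cosh, ← Complex.ofReal_sin,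
      ← Complex.ofReal_cos]

lemma cosh_eq_mk (t : ℂ) : Complex.cosh t =
    ⟨Real.cosh t.re * Real.cos t.im, Real.sinh t.re * Real.sin t.im⟩ := by
  conv_lhs => rw [← Complex.re_add_im t, Complex.cosh_add, Complex.sinh_mul_I,
    Complex.cosh_mul_I]
  apply Complex.ext <;>
    simp [← Complex.ofReal_sinh, ← Complex.ofReal_cosh, ← Complex.ofReal_sin,
      ← Complex.ofReal_cos]

lemma norm_sinh_sq (t : ℂ) :
    ‖Complex.sinh t‖ ^ 2 = Real.sinh t.re ^ 2 + Real.sin t.im ^ 2 := by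
  rw [← Complex.normSq_eq_norm_sq, sinh_eq_mk, Complex.normSq_mk]
  linear_combination Real.sinh t.re ^ 2 * Real.sin_sq_add_cos_sq t.im +
    Real.sin t.im ^ 2 * Real.cosh_sq t.re

lemma norm_cosh_sq (t : ℂ) :
    ‖Complex.cosh t‖ ^ 2 = Real.cosh t.re ^ 2 - Real.sin t.im ^ 2 := by
  rw [← Complex.normSq_eq_norm_sq, cosh_eq_mk, Complex.normSq_mk]
  linear_combination Real.cosh t.re ^ 2 * Real.sin_sq_add_cos_sq t.im -
    Real.sin t.im ^ 2 * Real.cosh_sq t.re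

lemma re_cosh_mul_conj_sinh (t : ℂ) :
    (Complex.cosh t).re * (Complex.sinh t).re + (Complex.cosh t).im * (Complex.sinh t).im =
      Real.sinh t.re * Real.cosh t.re := by
  rw [cosh_eq_mk, sinh_eq_mk]
  linear_combination Real.sinh t.re * Real.cosh t.re * Real.sin_sq_add_cos_sq t.im

lemma sinh_mem_slitPlane {t : ℂ} (h1 : 0 < t.re) (h2 : |t.im| < Real.pi / 2) :
    Complex.sinh t ∈ Complex.slitPlane := by
  left
  rw [sinh_eq_mk]
  rw [abs_lt] at h2
  exact mul_pos (Real.sinh_pos_iff.2 h1) (Real.cos_pos_of_mem_Ioo ⟨by linarith, by linarith⟩)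

/-- Hyperbolic functions on the disc `|t - t₀| ≤ min(t₀, 1) / 4`. -/
lemma hyperbolic_bounds {t0 : ℝ} (ht0 : 0 < t0) {t : ℂ} (ht : ‖t - t0‖ ≤ min t0 1 / 4) :
    Complex.sinh t ≠ 0 ∧ Complex.cosh t ≠ 0 ∧
    (1 / 5) / min t0 1 ≤ (Complex.cosh t / Complex.sinh t).re ∧
    ‖Complex.cosh t / Complex.sinh t‖ ≤ (7 / 2) / min t0 1 ∧
    (3 / 7) * min t0 1 ≤ (Complex.sinh t / Complex.cosh t).re ∧
    ‖Complex.sinh t / Complex.cosh t‖ ≤ 5 * min t0 1 ∧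
    3 / 16 * (min t0 1 * Real.exp (2 * t0)) ≤ ‖Complex.sinh (2 * t)‖ ∧
    Complex.sinh (2 * t) ∈ Complex.slitPlane := by
  have hre : |t.re - t0| ≤ min t0 1 / 4 := by
    simpa using (Complex.abs_re_le_norm (t - t0)).trans ht
  have him : |t.im| ≤ min t0 1 / 4 := by
    simpa using (Complex.abs_im_le_norm (t - t0)).trans ht
  obtain ⟨hτA, hτC, hsinh⟩ := real_hyperbolic_bounds ht0 hre
  have hτ0 : 0 < min t0 1 := lt_min ht0 one_pos
  have hτ1 : min t0 1 ≤ 1 := min_le_right _ _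
  have hτt : min t0 1 ≤ t0 := min_le_left _ _
  have hns := norm_sinh_sq t
  have hnc := norm_cosh_sq t
  have hn2 := norm_sinh_sq (2 * t)
  have hrs := re_cosh_mul_conj_sinh t
  have hAC := Real.cosh_sq t.re
  have ha : 3 / 4 * min t0 1 ≤ t.re := by
    have := (abs_le.1 hre).1
    linarith
  have hA0 : 0 < Real.sinh t.re := Real.sinh_pos_iff.2 (by linarith)
  have hAa : t.re ≤ Real.sinh t.re := Real.self_le_sinh_iff.2 (by linarith)
  have hC0 : 0 < Real.cosh t.re := Real.cosh_pos _
  have hsb1 : |Real.sin t.im| ≤ min t0 1 / 4 := (Real.abs_sin_le_abs).trans him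
  have hsb2 : Real.sin t.im ^ 2 ≤ (min t0 1 / 4) ^ 2 :=
    sq_le_sq' (by linarith [(abs_le.1 hsb1).1]) (abs_le.1 hsb1).2
  have hsbA : Real.sin t.im ^ 2 ≤ Real.sinh t.re ^ 2 :=
    hsb2.trans (pow_le_pow_left₀ (by linarith) (by linarith) 2)
  have hsb16 : Real.sin t.im ^ 2 ≤ 1 / 16 :=
    hsb2.trans ((pow_le_pow_left₀ (by linarith) (by linarith : min t0 1 / 4 ≤ 1 / 4) 2).trans
      (by norm_num))
  have hslit : Complex.sinh (2 * t) ∈ Complex.slitPlane := by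
    refine sinh_mem_slitPlane (by simp; linarith) ?_
    have := Real.pi_gt_three
    have e : |(2 * t).im| = 2 * |t.im| := by simp [abs_mul]
    rw [e]; linarith
  have hlow : 3 / 16 * (min t0 1 * Real.exp (2 * t0)) ≤ ‖Complex.sinh (2 * t)‖ := by
    refine hsinh.trans ?_
    refine le_of_sq_le_sq ?_ (norm_nonneg _)
    have e : (2 * t).re = 2 * t.re := by simp
    rw [hn2, e]
    exact le_add_of_nonneg_right (sq_nonneg _)
  have dre : (Complex.cosh t / Complex.sinh t).re =
      Real.sinh t.re * Real.cosh t.re / ‖Complex.sinh t‖ ^ 2 := by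
    rw [Complex.div_re, ← add_div, hrs, Complex.normSq_eq_norm_sq]
  have dre' : (Complex.sinh t / Complex.cosh t).re =
      Real.sinh t.re * Real.cosh t.re / ‖Complex.cosh t‖ ^ 2 := by
    rw [Complex.div_re, ← add_div, ← hrs, Complex.normSq_eq_norm_sq]
    ring_nf
  rw [dre, dre', norm_div, norm_div, hns, hnc]
  set A := Real.sinh t.re
  set C := Real.cosh t.re
  set s := Real.sin t.im
  set τ := min t0 1
  clear_value A C s τ
  have hns1 : A ≤ ‖Complex.sinh t‖ := by
    refine le_of_sq_le_sq ?_ (norm_nonneg _)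
    rw [hns]; linarith [sq_nonneg s]
  have hns2 : ‖Complex.sinh t‖ ≤ 3 / 2 * A := by
    refine le_of_sq_le_sq ?_ (by positivity)
    rw [hns, mul_pow]; linarith [sq_nonneg A]
  have hnc1 : 3 / 4 * C ≤ ‖Complex.cosh t‖ := by
    refine le_of_sq_le_sq ?_ (norm_nonneg _)
    rw [hnc, mul_pow]; linarith [sq_nonneg A]
  have hnc2 : ‖Complex.cosh t‖ ≤ C := by
    refine le_of_sq_le_sq ?_ (by positivity)
    rw [hnc]; linarith [sq_nonneg s]
  refine ⟨norm_pos_iff.1 (by linarith), norm_pos_iff.1 (by linarith), ?_, ?_, ?_, ?_, hlow, hslit⟩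
  · rw [div_le_div_iff₀ hτ0 (by positivity)]
    have : A * A ≤ A * (5 / 2 * τ * C) := by gcongr
    linarith
  · rw [div_le_div_iff₀ (by linarith) hτ0]
    have : ‖Complex.cosh t‖ * τ ≤ C * τ := by gcongr
    linarith
  · have hC16 : 0 < C ^ 2 - s ^ 2 := by linarith [sq_nonneg A]
    rw [le_div_iff₀ hC16]
    have h1 : 3 / 7 * τ * (C ^ 2 - s ^ 2) ≤ 3 / 7 * τ * C ^ 2 := by
      gcongr; linarith [sq_nonneg s]
    have h2 : C * (τ * C) ≤ C * (7 / 3 * A) := by gcongr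
    linarith
  · rw [div_le_iff₀ (by linarith)]
    have h3 : 5 * τ * (3 / 4 * C) ≤ 5 * τ * ‖Complex.cosh t‖ := by gcongr
    linarith

/-! ### The Gaussian exponent in a complex tube -/

/-- A complex quadratic form whose coefficient has positive real part stays coercive when its
argument is moved off the real axis by a bounded amount. -/
lemma re_mul_sq_ge {p w : ℂ} {a m L δ : ℝ} (hm : 0 < m) (hpm : m ≤ p.re) (hpL : ‖p‖ ≤ L)
    (hw : ‖w - a‖ ≤ δ) :
    m / 2 * a ^ 2 - (L + 2 * L ^ 2 / m) * δ ^ 2 ≤ (p * w ^ 2).re := by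
  have hδ : 0 ≤ δ := (norm_nonneg _).trans hw
  have hL : 0 ≤ L := (norm_nonneg _).trans hpL
  set z := w - a with hz
  have e : p * w ^ 2 = p * (a ^ 2 : ℝ) + ((2 * a : ℝ) : ℂ) * (p * z) + p * z ^ 2 := by
    rw [hz]; push_cast; ring
  have h1 : |(p * z).re| ≤ L * δ := by
    refine (Complex.abs_re_le_norm _).trans ?_
    rw [norm_mul]; gcongr
  have h2 : |(p * z ^ 2).re| ≤ L * δ ^ 2 := by
    refine (Complex.abs_re_le_norm _).trans ?_
    rw [norm_mul, norm_pow]; gcongr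
  rw [e, Complex.add_re, Complex.add_re, Complex.re_mul_ofReal, Complex.re_ofReal_mul]
  have h3 : -(2 * |a| * (L * δ)) ≤ 2 * a * (p * z).re := by
    have : |2 * a * (p * z).re| ≤ 2 * |a| * (L * δ) := by
      rw [abs_mul, abs_mul, abs_two]; gcongr
    exact (abs_le.1 this).1
  have h4 := (abs_le.1 h2).1
  have h5 : m * a ^ 2 ≤ p.re * a ^ 2 := by gcongr
  have h6 : 2 * |a| * (L * δ) ≤ m / 2 * a ^ 2 + 2 * L ^ 2 / m * δ ^ 2 := by
    have : 0 ≤ m / 2 * (|a| - 2 * L * δ / m) ^ 2 := by positivity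
    have e2 : m / 2 * (|a| - 2 * L * δ / m) ^ 2 =
        m / 2 * |a| ^ 2 - 2 * |a| * (L * δ) + 2 * L ^ 2 / m * δ ^ 2 := by
      field_simp; ring
    rw [e2, sq_abs] at this
    linarith
  linarith

/-- The growth of the Bessel factor is compensated by the Gaussian factor, with a gain
`(x₀ - y₀)² / τ + τ (x₀ + y₀)²`; here `p`, `q` stand for `coth t`, `tanh t`. -/
lemma mehler_exponent_le {p q x y : ℂ} {x0 y0 τ δ : ℝ} (hx0 : 0 < x0) (hy0 : 0 < y0)
    (hτ0 : 0 < τ) (hτ1 : τ ≤ 1) (hp1 : (1 / 5) / τ ≤ p.re) (hp2 : ‖p‖ ≤ (7 / 2) / τ)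
    (hq1 : (3 / 7) * τ ≤ q.re) (hq2 : ‖q‖ ≤ 5 * τ)
    (hx : ‖x - x0‖ ≤ δ) (hy : ‖y - y0‖ ≤ δ) :
    |(x * y * ((p - q) / 2)).re| + (-(1 / 2) * ((p + q) / 2) * (x ^ 2 + y ^ 2)).re ≤
      -(1 / 80 * ((x0 - y0) ^ 2 / τ + τ * (x0 + y0) ^ 2)) + 300 * (δ ^ 2 / τ) := by
  have hm : ‖(x - y) - ((x0 - y0 : ℝ) : ℂ)‖ ≤ 2 * δ := by
    rw [show (x - y) - ((x0 - y0 : ℝ) : ℂ) = (x - x0) - (y - y0) by push_cast; ring]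
    exact (norm_sub_le _ _).trans (by linarith)
  have hP : ‖(x + y) - ((x0 + y0 : ℝ) : ℂ)‖ ≤ 2 * δ := by
    rw [show (x + y) - ((x0 + y0 : ℝ) : ℂ) = (x - x0) + (y - y0) by push_cast; ring]
    exact (norm_add_le _ _).trans (by linarith)
  have k1 : ((7 / 2) / τ + 2 * ((7 / 2) / τ) ^ 2 / ((1 / 5) / τ)) * (2 * δ) ^ 2 =
      504 * (δ ^ 2 / τ) := by field_simp; ring
  have k2 : (5 * τ + 2 * (5 * τ) ^ 2 / ((3 / 7) * τ)) * (2 * δ) ^ 2 ≤ 500 * (δ ^ 2 / τ) := by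
    have e : (5 * τ + 2 * (5 * τ) ^ 2 / ((3 / 7) * τ)) * (2 * δ) ^ 2 =
      (20 + 1400 / 3) * τ ^ 2 * (δ ^ 2 / τ) := by field_simp; ring
    rw [e]
    have : τ ^ 2 ≤ 1 := pow_le_one₀ hτ0.le hτ1
    gcongr
    linarith
  have a1 := re_mul_sq_ge (by positivity) hp1 hp2 hm
  have a2 := re_mul_sq_ge (by positivity) hp1 hp2 hP
  have b1 := re_mul_sq_ge (by positivity) hq1 hq2 hm
  have b2 := re_mul_sq_ge (by positivity) hq1 hq2 hP
  rw [k1] at a1 a2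
  have d1 : (1 / 5) / τ / 2 * (x0 - y0) ^ 2 = 1 / 10 * ((x0 - y0) ^ 2 / τ) := by ring
  have d2 : (1 / 5) / τ / 2 * (x0 + y0) ^ 2 = 1 / 10 * ((x0 + y0) ^ 2 / τ) := by ring
  rw [d1] at a1
  rw [d2] at a2
  have c1 : (x0 - y0) ^ 2 / τ ≤ (x0 + y0) ^ 2 / τ := by gcongr 1; nlinarith [mul_pos hx0 hy0]
  have c2 : τ * (x0 + y0) ^ 2 ≤ (x0 + y0) ^ 2 / τ := by
    rw [le_div_iff₀ hτ0]
    have : τ * τ ≤ 1 := by nlinarith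
    nlinarith [sq_nonneg (x0 + y0)]
  have c3 : 0 ≤ τ * (x0 - y0) ^ 2 := by positivity
  have c4 : 0 ≤ (x0 - y0) ^ 2 / τ := by positivity
  have c5 : 0 ≤ δ ^ 2 / τ := by positivity
  have c6 : 0 ≤ τ * (x0 + y0) ^ 2 := by positivity
  rcases abs_cases (x * y * ((p - q) / 2)).re with ⟨h, -⟩ | ⟨h, -⟩
  · have e : x * y * ((p - q) / 2) + -(1 / 2) * ((p + q) / 2) * (x ^ 2 + y ^ 2) =
        ((-(1 / 4) : ℝ) : ℂ) * (p * (x - y) ^ 2 + q * (x + y) ^ 2) := by push_cast; ring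
    rw [h, ← Complex.add_re, e, Complex.re_ofReal_mul, Complex.add_re]
    linarith
  · have e : -(x * y * ((p - q) / 2)) + -(1 / 2) * ((p + q) / 2) * (x ^ 2 + y ^ 2) =
        ((-(1 / 4) : ℝ) : ℂ) * (p * (x + y) ^ 2 + q * (x - y) ^ 2) := by push_cast; ring
    rw [h, ← Complex.neg_re, ← Complex.add_re, e, Complex.re_ofReal_mul, Complex.add_re]
    linarith

lemma rpow_le_of_comparable {a b L : ℝ} (ha : 0 < a) (hb : 0 < b) (hL : 1 ≤ L) (h1 : a ≤ L * b)
    (h2 : b ≤ L * a) (e : ℝ) : b ^ e ≤ L ^ |e| * a ^ e := by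
  have hL0 : 0 < L := by linarith
  rcases le_total 0 e with he | he
  · rw [abs_of_nonneg he, ← Real.mul_rpow hL0.le ha.le]
    exact Real.rpow_le_rpow hb.le h2 he
  · have h3 : a / L ≤ b := by rw [div_le_iff₀ hL0]; linarith
    rw [abs_of_nonpos he, Real.rpow_neg hL0.le, mul_comm, ← div_eq_mul_inv,
      ← Real.div_rpow ha.le hL0.le]
    exact Real.rpow_le_rpow_of_nonpos (by positivity) h3 he

/-- The Laguerre heat kernel in one variable with all its variables complex. -/
noncomputable def heatC (ν : ℝ) (t x y : ℂ) : ℂ :=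
  ((2 ^ (-ν) : ℝ) : ℂ) * Complex.sinh (2 * t) ^ ((-(1 + ν) : ℝ) : ℂ) *
    Complex.exp (-(1 / 2) * (Complex.cosh (2 * t) / Complex.sinh (2 * t)) * (x ^ 2 + y ^ 2)) *
    besselW ν (x * y / Complex.sinh (2 * t))

/-- The model `r (x + r)^(2ν + 1)` for the measure of the interval of centre `x` and radius `r`. -/
noncomputable def vol1 (ν x r : ℝ) : ℝ := r * (x + r) ^ (2 * ν + 1)

lemma vol1_pos {ν x r : ℝ} (hx : 0 < x) (hr : 0 < r) : 0 < vol1 ν x r := by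
  unfold vol1; positivity

/-- If `X` and `Y` differ by `D`, and `X Y` is at most `R` up to terms linear in `X + Y`, then `X²`
is at most `R` up to a factor quadratic in `D`. -/
lemma sq_le_of_mul_le {X Y D R : ℝ} (hX : 0 ≤ X) (hD : 0 ≤ D) (hR : 0 ≤ R) (hYX : Y ≤ X + D)
    (hXY : X ≤ Y + D) (h : 3 / 40 * (X * Y) ≤ R + 17 / 4 * (X + Y + 1)) :
    (1 + X) ^ 2 ≤ 1000000 * (1 + D ^ 2) * (1 + R) := by
  have h2 : X * X ≤ X * (Y + D) := mul_le_mul_of_nonneg_left hXY hX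
  have h3 : X ^ 2 ≤ 60 * R + 60 * (2 * X + D + 1) + X * D := by linarith
  have h4 : X ^ 2 ≤ 120 * R + 120 * (D + 1) + (120 + D) ^ 2 := by
    linarith [sq_nonneg (X - (120 + D))]
  have h6 : (1 + X) ^ 2 ≤ 2 + 2 * X ^ 2 := by linarith [sq_nonneg (1 - X)]
  have h7 : 0 ≤ D ^ 2 * R := by positivity
  linarith [sq_nonneg (D - 1), sq_nonneg (D - 120), sq_nonneg D]

/-- The argument `z = x y / sinh 2t` of the Bessel function has size about `(1 + X)²`, `X = x₀ / ρ`,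
up to powers of the Gaussian exponent `A`. -/
lemma bessel_argument_comparison {p q x y : ℂ} {x0 y0 ρ : ℝ} (hx0 : 0 < x0) (hy0 : 0 < y0)
    (hρ0 : 0 < ρ) (hρ1 : ρ ≤ 1) (hp1 : (1 / 5) / ρ ^ 2 ≤ p.re) (hp2 : ‖p‖ ≤ (7 / 2) / ρ ^ 2)
    (hq2 : ‖q‖ ≤ 5 * ρ ^ 2) (hx : ‖x - x0‖ ≤ ρ) (hy : ‖y - y0‖ ≤ ρ) :
    (1 + ‖x * y * ((p - q) / 2)‖ ≤ 1000 *
      (1 + ((x0 - y0) ^ 2 / ρ ^ 2 + ρ ^ 2 * (x0 + y0) ^ 2)) * (1 + x0 / ρ) ^ 2) ∧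
    ((1 + x0 / ρ) ^ 2 ≤ 1000000 *
      (1 + ((x0 - y0) ^ 2 / ρ ^ 2 + ρ ^ 2 * (x0 + y0) ^ 2)) *
        (1 + |(x * y * ((p - q) / 2)).re|)) := by
  set X := x0 / ρ with hX
  set Y := y0 / ρ with hY
  have hX0 : 0 < X := by positivity
  have hY0 : 0 < Y := by positivity
  have ex : x0 = ρ * X := by rw [hX]; field_simp
  have ey : y0 = ρ * Y := by rw [hY]; field_simp
  have hA : (x0 - y0) ^ 2 / ρ ^ 2 + ρ ^ 2 * (x0 + y0) ^ 2 = (X - Y) ^ 2 + ρ ^ 4 * (X + Y) ^ 2 := by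
    rw [ex, ey]; field_simp
  rw [hA]
  set S := (p - q) / 2 with hS
  have hρ4 : ρ ^ 4 ≤ 1 := pow_le_one₀ hρ0.le hρ1
  have hSn : ρ ^ 2 * ‖S‖ ≤ 17 / 4 := by
    have h1 : ‖S‖ ≤ ((7 / 2) / ρ ^ 2 + 5 * ρ ^ 2) / 2 := by
      rw [hS, norm_div, Complex.norm_ofNat]
      have := norm_sub_le p q
      gcongr; linarith
    calc ρ ^ 2 * ‖S‖ ≤ ρ ^ 2 * (((7 / 2) / ρ ^ 2 + 5 * ρ ^ 2) / 2) := by gcongr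
      _ = 7 / 4 + 5 / 2 * ρ ^ 4 := by field_simp; ring
      _ ≤ _ := by linarith
  have hD : (0 : ℝ) ≤ |X - Y| := abs_nonneg _
  have hD2 : |X - Y| ^ 2 = (X - Y) ^ 2 := sq_abs _
  have hYX : Y ≤ X + |X - Y| := by linarith [neg_abs_le (X - Y)]
  have hXY : X ≤ Y + |X - Y| := by linarith [le_abs_self (X - Y)]
  have hE : 0 ≤ ρ ^ 4 * (X + Y) ^ 2 := by positivity
  constructor
  · have hxn : ‖x‖ ≤ ρ * (1 + X) := by
      have := norm_add_le (x - x0) (x0 : ℂ)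
      rw [sub_add_cancel, Complex.norm_real, Real.norm_of_nonneg hx0.le] at this
      linarith
    have hyn : ‖y‖ ≤ ρ * (1 + Y) := by
      have := norm_add_le (y - y0) (y0 : ℂ)
      rw [sub_add_cancel, Complex.norm_real, Real.norm_of_nonneg hy0.le] at this
      linarith
    have h1 : ‖x * y * S‖ ≤ 17 / 4 * ((1 + X) * (1 + Y)) := by
      rw [norm_mul, norm_mul]
      calc ‖x‖ * ‖y‖ * ‖S‖ ≤ (ρ * (1 + X)) * (ρ * (1 + Y)) * ‖S‖ := by gcongr
        _ = (ρ ^ 2 * ‖S‖) * ((1 + X) * (1 + Y)) := by ring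
        _ ≤ _ := by gcongr
    have h2 : (1 + X) * (1 + Y) ≤ (1 + X) ^ 2 * (1 + |X - Y|) := by
      have : 1 + Y ≤ (1 + X) * (1 + |X - Y|) := by nlinarith [mul_nonneg hX0.le hD]
      calc (1 + X) * (1 + Y) ≤ (1 + X) * ((1 + X) * (1 + |X - Y|)) := by gcongr
        _ = _ := by ring
    have h3 : 1 + |X - Y| ≤ 2 * (1 + (X - Y) ^ 2) := by nlinarith [sq_nonneg (|X - Y| - 1)]
    have h4 : (1 : ℝ) ≤ (1 + X) ^ 2 := one_le_pow₀ (by linarith)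
    have h5 : (1 + X) ^ 2 * (1 + |X - Y|) ≤
        (1 + X) ^ 2 * (2 * (1 + ((X - Y) ^ 2 + ρ ^ 4 * (X + Y) ^ 2))) := by
      gcongr; linarith
    have h6 : (1 : ℝ) ≤ (1 + X) ^ 2 * (1 + ((X - Y) ^ 2 + ρ ^ 4 * (X + Y) ^ 2)) := by
      have : (1 : ℝ) ≤ 1 + ((X - Y) ^ 2 + ρ ^ 4 * (X + Y) ^ 2) := by
        linarith [sq_nonneg (X - Y)]
      exact one_le_mul_of_one_le_of_one_le h4 this
    linarith
  · set R := |(x * y * S).re| with hR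
    have hR0 : 0 ≤ R := abs_nonneg _
    -- for `ρ` bounded below the exponent `A` itself controls `X²`
    rcases le_total ρ (3 / 10) with hρ | hρ
    · have hSre : 3 / 40 ≤ ρ ^ 2 * S.re := by
        have h1 : -(5 * ρ ^ 2) ≤ -q.re := by
          have := (Complex.re_le_norm q).trans hq2
          linarith
        have h2 : S.re = (p.re + -q.re) / 2 := by
          rw [hS]
          simp [sub_eq_add_neg]
        have h3 : 1 / 5 ≤ ρ ^ 2 * p.re := by
          rw [div_le_iff₀ (by positivity)] at hp1; linarith
        have h4 : ρ ^ 2 * -(5 * ρ ^ 2) ≤ ρ ^ 2 * -q.re := by gcongr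
        have h5 : ρ ^ 2 * ρ ^ 2 ≤ (3 / 10) ^ 2 * (3 / 10) ^ 2 := by gcongr
        rw [h2]
        nlinarith
      have e : x * y * S = ((x0 * y0 : ℝ) : ℂ) * S +
          ((x - x0) * y0 + x0 * (y - y0) + (x - x0) * (y - y0)) * S := by push_cast; ring
      have hrest : ‖((x - x0) * y0 + x0 * (y - y0) + (x - x0) * (y - y0)) * S‖ ≤
          17 / 4 * (X + Y + 1) := by
        rw [norm_mul]
        have h1 : ‖(x - x0) * y0 + x0 * (y - y0) + (x - x0) * (y - y0)‖ ≤
            ρ * y0 + x0 * ρ + ρ * ρ := by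
          refine (norm_add₃_le).trans ?_
          rw [norm_mul, norm_mul, norm_mul, Complex.norm_real, Complex.norm_real,
            Real.norm_of_nonneg hx0.le, Real.norm_of_nonneg hy0.le]
          gcongr
        calc _ ≤ (ρ * y0 + x0 * ρ + ρ * ρ) * ‖S‖ := by gcongr
          _ = (ρ ^ 2 * ‖S‖) * (X + Y + 1) := by rw [ex, ey]; ring
          _ ≤ _ := by gcongr
      have h1 : 3 / 40 * (X * Y) ≤ R + 17 / 4 * (X + Y + 1) := by
        have h2 : x0 * y0 * S.re ≤ R + 17 / 4 * (X + Y + 1) := by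
          have h3 := congrArg Complex.re e
          rw [Complex.add_re, Complex.re_ofReal_mul] at h3
          have h4 := (Complex.abs_re_le_norm _).trans hrest
          have h5 := (abs_le.1 h4).1
          have h6 := le_abs_self (x * y * S).re
          rw [← hR] at h6
          linarith
        have h7 : x0 * y0 * S.re = (ρ ^ 2 * S.re) * (X * Y) := by rw [ex, ey]; ring
        rw [h7] at h2
        have : 3 / 40 * (X * Y) ≤ (ρ ^ 2 * S.re) * (X * Y) := by gcongr
        linarith
      have h5 := sq_le_of_mul_le hX0.le hD hR0 hYX hXY h1
      rw [hD2] at h5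
      refine h5.trans ?_
      gcongr
      linarith
    · have h1 : (3 / 10) ^ 4 * X ^ 2 ≤ ρ ^ 4 * (X + Y) ^ 2 := by gcongr; linarith
      have h2 : (1 + X) ^ 2 ≤ 1000000 * (1 + ((X - Y) ^ 2 + ρ ^ 4 * (X + Y) ^ 2)) := by
        generalize ρ ^ 4 * (X + Y) ^ 2 = E at h1 hE ⊢
        norm_num1 at h1
        have h3 : 0 ≤ (X - Y) ^ 2 := sq_nonneg _
        have h4 : (1 + X) ^ 2 ≤ 2 + 2 * X ^ 2 := by linarith [sq_nonneg (1 - X)]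
        linarith
      refine h2.trans (le_mul_of_one_le_right ?_ (by linarith))
      have := sq_nonneg (X - Y)
      positivity

/-! ### The Gaussian bound for the complexified heat kernel -/

/-- The powers left by `(sinh 2t)^(-(1+ν))` and by the Bessel function combine to an inverse
volume at the scale `ρ = √(min t 1)`. -/
lemma inv_vol1_eq {ν x ρ : ℝ} (hx : 0 < x) (hρ : 0 < ρ) :
    (ρ ^ 2) ^ (-(1 + ν)) * ((1 + x / ρ) ^ 2) ^ (-(ν + 1 / 2)) = (vol1 ν x ρ)⁻¹ := by
  have e1 : 1 + x / ρ = (x + ρ) / ρ := by field_simp; ring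
  have hxρ : 0 < x + ρ := by positivity
  rw [e1, ← Real.rpow_natCast, ← Real.rpow_natCast, ← Real.rpow_mul hρ.le,
    ← Real.rpow_mul (by positivity), Real.div_rpow hxρ.le hρ.le, vol1, mul_inv,
    ← Real.rpow_neg hxρ.le, mul_div_assoc', mul_comm, mul_div_assoc, ← Real.rpow_sub hρ, mul_comm,
    ← Real.rpow_neg_one]
  congr 2 <;> push_cast <;> ring

/-- The Gaussian bound for the heat kernel in one variable, in a complex neighbourhood of the real
point `(t₀, x₀, y₀)` adapted to the parabolic scaling. -/
lemma exists_norm_heatC_le {ν : ℝ} (hν : -1 < ν) : ∃ C > 0, ∀ t0 > 0, ∀ x0 > 0, ∀ y0 > 0,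
    ∀ t x y : ℂ, ‖t - (t0 : ℝ)‖ ≤ min t0 1 / 4 → ‖x - (x0 : ℝ)‖ ≤ √(min t0 1) →
      ‖y - (y0 : ℝ)‖ ≤ √(min t0 1) →
      ‖heatC ν t x y‖ ≤ C * Real.exp (-(2 * (1 + ν) * t0)) * (vol1 ν x0 √(min t0 1))⁻¹ *
        Real.exp (-(1 / 160 * ((x0 - y0) ^ 2 / min t0 1 + min t0 1 * (x0 + y0) ^ 2))) := by
  obtain ⟨C1, hC1, hW⟩ := exists_norm_besselW_le hν
  obtain ⟨C2, hC2, hE⟩ := exists_one_add_rpow_mul_exp_neg_le (|(-(ν + 1 / 2))| + (4 : ℕ))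
    (c := 1 / 160) (by norm_num)
  set e := |(-(ν + 1 / 2))| with he
  refine ⟨2 ^ (-ν) * (3 / 16) ^ (-(1 + ν)) * C1 * Real.exp 300 * (1000000 ^ e * 1000000000 ^ 2) *
    C2, by positivity, fun t0 ht0 x0 hx0 y0 hy0 t x y ht hx hy => ?_⟩
  have hτ0 : 0 < min t0 1 := lt_min ht0 one_pos
  have hτ1 : min t0 1 ≤ 1 := min_le_right _ _
  obtain ⟨hs, hc, hp1, hp2, hq1, hq2, hsl, -⟩ := hyperbolic_bounds ht0 ht
  set τ := min t0 1 with hτ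
  set ρ := √τ with hρ
  have hρ0 : 0 < ρ := Real.sqrt_pos.2 hτ0
  have hρ1 : ρ ≤ 1 := Real.sqrt_le_one.2 hτ1
  have hρ2 : ρ ^ 2 = τ := Real.sq_sqrt hτ0.le
  set p := Complex.cosh t / Complex.sinh t with hp
  set q := Complex.sinh t / Complex.cosh t with hq
  have hS : x * y / Complex.sinh (2 * t) = x * y * ((p - q) / 2) := by
    have h1 := Complex.cosh_sq_sub_sinh_sq t
    rw [hp, hq, Complex.sinh_two_mul]
    field_simp
    rw [h1]; ring
  have hK : Complex.cosh (2 * t) / Complex.sinh (2 * t) = (p + q) / 2 := by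
    rw [hp, hq, Complex.sinh_two_mul, Complex.cosh_two_mul]
    field_simp
  have hexp := mehler_exponent_le hx0 hy0 hτ0 hτ1 hp1 hp2 hq1 hq2 hx hy
  rw [hρ2, div_self hτ0.ne', mul_one] at hexp
  obtain ⟨hcmp1, hcmp2⟩ := bessel_argument_comparison hx0 hy0 hρ0 hρ1 (by rwa [hρ2])
    (by rwa [hρ2]) (by rwa [hρ2]) hx hy
  rw [hρ2] at hcmp1 hcmp2
  set A := (x0 - y0) ^ 2 / τ + τ * (x0 + y0) ^ 2 with hA
  have hA0 : 0 ≤ A := by positivity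
  unfold heatC
  rw [hS, hK, norm_mul, norm_mul, norm_mul, Complex.norm_real, Complex.norm_cpow_real,
    Complex.norm_exp, Real.norm_of_nonneg (by positivity)]
  set z := x * y * ((p - q) / 2) with hz
  set R := |z.re| with hR
  have hR0 : 0 ≤ R := abs_nonneg _
  set Θ := (1 + x0 / ρ) ^ 2 with hΘ
  have hΘ0 : 0 < Θ := by positivity
  set N := (-(1 / 2) * ((p + q) / 2) * (x ^ 2 + y ^ 2)).re with hN
  have f1 : ‖Complex.sinh (2 * t)‖ ^ (-(1 + ν)) ≤
      (3 / 16) ^ (-(1 + ν)) * (τ ^ (-(1 + ν)) * Real.exp (-(2 * (1 + ν) * t0))) := by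
    refine (Real.rpow_le_rpow_of_nonpos (by positivity) hsl (by linarith)).trans_eq ?_
    rw [Real.mul_rpow (by norm_num) (by positivity), Real.mul_rpow hτ0.le (Real.exp_pos _).le,
      ← Real.exp_mul]
    ring_nf
  have hzR : R ≤ ‖z‖ := Complex.abs_re_le_norm z
  have f2 : (1 + R) ^ (-(ν + 1 / 2)) ≤
      1000000 ^ e * (1 + A) ^ e * Θ ^ (-(ν + 1 / 2)) := by
    rw [← Real.mul_rpow (by norm_num) (by positivity)]
    refine rpow_le_of_comparable hΘ0 (by positivity) (by linarith) hcmp2 ?_ _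
    have : 1000 * (1 + A) * Θ ≤ 1000000 * (1 + A) * Θ := by gcongr; norm_num
    linarith
  have f3 : ((1 + ‖z‖) / (1 + R)) ^ 2 ≤ 1000000000 ^ 2 * (1 + A) ^ 4 := by
    have : (1 + ‖z‖) / (1 + R) ≤ 1000000000 * (1 + A) ^ 2 := by
      rw [div_le_iff₀ (by positivity)]
      calc 1 + ‖z‖ ≤ 1000 * (1 + A) * Θ := hcmp1
        _ ≤ 1000 * (1 + A) * (1000000 * (1 + A) * (1 + R)) := by gcongr
        _ = _ := by ring
    calc ((1 + ‖z‖) / (1 + R)) ^ 2 ≤ (1000000000 * (1 + A) ^ 2) ^ 2 := by gcongr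
      _ = _ := by ring
  have f4 : Real.exp N * Real.exp R ≤
      Real.exp 300 * (Real.exp (-(1 / 160 * A)) * Real.exp (-(1 / 160 * A))) := by
    rw [← Real.exp_add, ← Real.exp_add, ← Real.exp_add, Real.exp_le_exp]
    linarith
  have f5 := hE A hA0
  rw [Real.rpow_add (by positivity), Real.rpow_natCast] at f5
  have f6 := inv_vol1_eq (ν := ν) hx0 hρ0
  rw [hρ2, ← hΘ] at f6
  calc 2 ^ (-ν) * ‖Complex.sinh (2 * t)‖ ^ (-(1 + ν)) * Real.exp N * ‖besselW ν z‖
      ≤ 2 ^ (-ν) * ((3 / 16) ^ (-(1 + ν)) * (τ ^ (-(1 + ν)) * Real.exp (-(2 * (1 + ν) * t0)))) *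
          Real.exp N * (C1 * Real.exp R * ((1000000 ^ e * (1 + A) ^ e * Θ ^ (-(ν + 1 / 2))) *
            (1000000000 ^ 2 * (1 + A) ^ 4))) := by
        gcongr
        refine (hW z).trans ?_
        gcongr
    _ = 2 ^ (-ν) * (3 / 16) ^ (-(1 + ν)) * C1 * (Real.exp N * Real.exp R) *
          (1000000 ^ e * 1000000000 ^ 2) * ((1 + A) ^ e * (1 + A) ^ 4) *
          Real.exp (-(2 * (1 + ν) * t0)) * (τ ^ (-(1 + ν)) * Θ ^ (-(ν + 1 / 2))) := by ring
    _ ≤ 2 ^ (-ν) * (3 / 16) ^ (-(1 + ν)) * C1 *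
          (Real.exp 300 * (Real.exp (-(1 / 160 * A)) * Real.exp (-(1 / 160 * A)))) *
          (1000000 ^ e * 1000000000 ^ 2) * ((1 + A) ^ e * (1 + A) ^ 4) *
          Real.exp (-(2 * (1 + ν) * t0)) * (τ ^ (-(1 + ν)) * Θ ^ (-(ν + 1 / 2))) := by
        gcongr
    _ = 2 ^ (-ν) * (3 / 16) ^ (-(1 + ν)) * C1 * Real.exp 300 * (1000000 ^ e * 1000000000 ^ 2) *
          ((1 + A) ^ e * (1 + A) ^ 4 * Real.exp (-(1 / 160 * A))) *
          Real.exp (-(2 * (1 + ν) * t0)) * (τ ^ (-(1 + ν)) * Θ ^ (-(ν + 1 / 2))) *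
          Real.exp (-(1 / 160 * A)) := by ring
    _ ≤ 2 ^ (-ν) * (3 / 16) ^ (-(1 + ν)) * C1 * Real.exp 300 * (1000000 ^ e * 1000000000 ^ 2) *
          C2 * Real.exp (-(2 * (1 + ν) * t0)) * (τ ^ (-(1 + ν)) * Θ ^ (-(ν + 1 / 2))) *
          Real.exp (-(1 / 160 * A)) := by gcongr
    _ = _ := by rw [f6]

/-! ### Laguerre derivatives through Cauchy estimates -/

/-- Joint analyticity where `sinh 2t` avoids the cut of the principal power; this contains all
positive real times. -/
lemma analyticAt_heatC {ν : ℝ} (hν : -1 < ν) {p : ℂ × ℂ × ℂ}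
    (hp : Complex.sinh (2 * p.1) ∈ Complex.slitPlane) :
    AnalyticAt ℂ (fun p : ℂ × ℂ × ℂ => heatC ν p.1 p.2.1 p.2.2) p := by
  have hne : Complex.sinh (2 * p.1) ≠ 0 := Complex.slitPlane_ne_zero hp
  have h1 : AnalyticAt ℂ (fun p : ℂ × ℂ × ℂ => p.1) p := analyticAt_fst
  have h2 : AnalyticAt ℂ (fun p : ℂ × ℂ × ℂ => p.2.1) p :=
    analyticAt_fst.fun_comp analyticAt_snd
  have h3 : AnalyticAt ℂ (fun p : ℂ × ℂ × ℂ => p.2.2) p :=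
    analyticAt_snd.fun_comp analyticAt_snd
  have h4 : AnalyticAt ℂ (fun p : ℂ × ℂ × ℂ => 2 * p.1) p := analyticAt_const.mul h1
  have hsh : AnalyticAt ℂ (fun p : ℂ × ℂ × ℂ => Complex.sinh (2 * p.1)) p :=
    ((Complex.differentiable_sinh.analyticAt _).fun_comp h4)
  have hch : AnalyticAt ℂ (fun p : ℂ × ℂ × ℂ => Complex.cosh (2 * p.1)) p :=
    ((Complex.differentiable_cosh.analyticAt _).fun_comp h4)
  have hW : AnalyticAt ℂ (fun p : ℂ × ℂ × ℂ =>
      besselW ν (p.2.1 * p.2.2 / Complex.sinh (2 * p.1))) p :=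
    ((differentiable_besselW hν).analyticAt _).fun_comp ((h2.mul h3).div hsh hne)
  have hc : AnalyticAt ℂ (fun p : ℂ × ℂ × ℂ =>
      Complex.sinh (2 * p.1) ^ ((-(1 + ν) : ℝ) : ℂ)) p := hsh.cpow analyticAt_const hp
  have hE : AnalyticAt ℂ (fun p : ℂ × ℂ × ℂ =>
      Complex.exp (-(1 / 2) * (Complex.cosh (2 * p.1) / Complex.sinh (2 * p.1)) *
        (p.2.1 ^ 2 + p.2.2 ^ 2))) p :=
    AnalyticAt.cexp' ((analyticAt_const.mul (hch.div hsh hne)).mul ((h2.pow 2).add (h3.pow 2)))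
  exact ((analyticAt_const.mul hc).mul hE).mul hW

/-- Partial derivatives in the middle variable of a jointly analytic function are jointly
analytic. -/
lemma analyticAt_iteratedDeriv_middle {f : ℂ × ℂ × ℂ → ℂ} {T : Set ℂ} (hT : IsOpen T)
    (hf : ∀ p : ℂ × ℂ × ℂ, p.1 ∈ T → AnalyticAt ℂ f p) (n : ℕ) :
    ∀ p : ℂ × ℂ × ℂ, p.1 ∈ T →
      AnalyticAt ℂ (fun p => iteratedDeriv n (fun z => f (p.1, z, p.2.2)) p.2.1) p := by
  induction n with
  | zero => simpa using hf
  | succ n ih =>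
    intro p hp
    set F : ℂ × ℂ × ℂ → ℂ := fun p => iteratedDeriv n (fun z => f (p.1, z, p.2.2)) p.2.1 with hF
    have h1 : AnalyticAt ℂ (fun p => fderiv ℂ F p ((0 : ℂ), (1 : ℂ), (0 : ℂ))) p :=
      ((ContinuousLinearMap.apply ℂ ℂ ((0 : ℂ), (1 : ℂ), (0 : ℂ))).analyticAt _).fun_comp
        (ih p hp).fderiv
    refine h1.congr ?_
    have hev : ∀ᶠ q : ℂ × ℂ × ℂ in nhds p, q.1 ∈ T :=
      continuous_fst.continuousAt.eventually (hT.mem_nhds hp)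
    filter_upwards [hev] with q hq
    rw [iteratedDeriv_succ]
    have h2 : HasFDerivAt F (fderiv ℂ F q) (q.1, q.2.1, q.2.2) :=
      (ih q hq).differentiableAt.hasFDerivAt
    have h3 : HasDerivAt (fun z : ℂ => (q.1, z, q.2.2)) ((0 : ℂ), (1 : ℂ), (0 : ℂ)) q.2.1 :=
      (hasDerivAt_const _ _).prodMk ((hasDerivAt_id _).prodMk (hasDerivAt_const _ _))
    exact (h2.comp_hasDerivAt q.2.1 h3).deriv.symm

/-- The `n`-th Laguerre derivative in `x` of `heatC`, through
`∂_x + x = e^(-x²/2) ∘ ∂_x ∘ e^(x²/2)`. -/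
noncomputable def deltaC (ν : ℝ) (n : ℕ) (t x y : ℂ) : ℂ :=
  Complex.exp (-x ^ 2 / 2) *
    iteratedDeriv n (fun z => Complex.exp (z ^ 2 / 2) * heatC ν t z y) x

lemma isOpen_sinh_slitPlane : IsOpen {t : ℂ | Complex.sinh (2 * t) ∈ Complex.slitPlane} :=
  Complex.isOpen_slitPlane.preimage (by fun_prop)

lemma analyticAt_deltaC {ν : ℝ} (hν : -1 < ν) (n : ℕ) {p : ℂ × ℂ × ℂ}
    (hp : Complex.sinh (2 * p.1) ∈ Complex.slitPlane) :
    AnalyticAt ℂ (fun p : ℂ × ℂ × ℂ => deltaC ν n p.1 p.2.1 p.2.2) p := by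
  have h2 : ∀ p : ℂ × ℂ × ℂ, AnalyticAt ℂ (fun p : ℂ × ℂ × ℂ => p.2.1) p := fun p =>
    analyticAt_fst.fun_comp analyticAt_snd
  refine AnalyticAt.mul (AnalyticAt.cexp' (((h2 p).pow 2).neg.div_const)) ?_
  refine analyticAt_iteratedDeriv_middle
    (f := fun p => Complex.exp (p.2.1 ^ 2 / 2) * heatC ν p.1 p.2.1 p.2.2)
    isOpen_sinh_slitPlane (fun q hq => ?_) n p hp
  exact (AnalyticAt.cexp' (((h2 q).pow 2).div_const)).mul (analyticAt_heatC hν hq)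

lemma differentiable_heatC {ν : ℝ} (hν : -1 < ν) (t y : ℂ) :
    Differentiable ℂ (fun z => heatC ν t z y) := by
  have h := differentiable_besselW hν
  have h2 : Differentiable ℂ fun z : ℂ => besselW ν (z * y / Complex.sinh (2 * t)) :=
    h.comp (by fun_prop)
  unfold heatC
  fun_prop

/-- Cauchy's estimate in `x` on a circle of radius `√(min t 1) / 2`. -/
lemma exists_norm_deltaC_le {ν : ℝ} (hν : -1 < ν) (n : ℕ) : ∃ C > 0, ∀ t0 > 0, ∀ x0 > 0, ∀ y0 > 0,
    ∀ t x y : ℂ, ‖t - (t0 : ℝ)‖ ≤ min t0 1 / 4 → ‖x - (x0 : ℝ)‖ ≤ √(min t0 1) / 2 →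
      ‖y - (y0 : ℝ)‖ ≤ √(min t0 1) →
      ‖deltaC ν n t x y‖ ≤ C * (√(min t0 1) ^ n)⁻¹ * Real.exp (-(2 * (1 + ν) * t0)) *
        (vol1 ν x0 √(min t0 1))⁻¹ * Real.exp (-(1 / 320 * ((x0 - y0) ^ 2 / min t0 1))) := by
  obtain ⟨C, hC, hH⟩ := exists_norm_heatC_le hν
  refine ⟨n.factorial * (Real.exp 21 * C) * 2 ^ n, by positivity,
    fun t0 ht0 x0 hx0 y0 hy0 t x y ht hx hy => ?_⟩
  have hτ0 : 0 < min t0 1 := lt_min ht0 one_pos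
  have hτ1 : min t0 1 ≤ 1 := min_le_right _ _
  replace hH := fun z => hH t0 ht0 x0 hx0 y0 hy0 t z y ht
  set τ := min t0 1 with hτ
  set ρ := √τ with hρ
  have hρ0 : 0 < ρ := Real.sqrt_pos.2 hτ0
  have hρ1 : ρ ≤ 1 := Real.sqrt_le_one.2 hτ1
  have hρ2 : ρ ^ 2 = τ := Real.sq_sqrt hτ0.le
  have hv := vol1_pos (ν := ν) hx0 hρ0
  set B := Real.exp (-(2 * (1 + ν) * t0)) * (vol1 ν x0 ρ)⁻¹ *
    Real.exp (-(1 / 320 * ((x0 - y0) ^ 2 / τ))) with hB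
  have hB0 : 0 < B := by positivity
  have hd : Differentiable ℂ (fun z => Complex.exp (z ^ 2 / 2) * heatC ν t z y) := by
    have := differentiable_heatC hν t y
    fun_prop
  have hsup : ∀ z ∈ Metric.sphere x (ρ / 2), ‖Complex.exp (z ^ 2 / 2) * heatC ν t z y‖ ≤
      Real.exp (x ^ 2 / 2).re * (Real.exp 21 * C * B) := by
    intro z hz
    rw [mem_sphere_iff_norm] at hz
    have hzx : ‖z - x0‖ ≤ ρ := by
      have := norm_add_le (z - x) (x - x0)
      rw [sub_add_sub_cancel] at this
      linarith
    have h1 := hH z hzx hy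
    -- multiplying by `e^{z²/2}` costs `e^{ρ x₀}`, which the factor `e^{-c τ x₀²}` absorbs
    have h2 : (z ^ 2 / 2).re ≤ (x ^ 2 / 2).re + (ρ * x0 / 2 + 1 / 2) := by
      have e : z ^ 2 / 2 = x ^ 2 / 2 + (z - x) * (z + x) / 2 := by ring
      have h3 : ‖(z - x) * (z + x) / 2‖ ≤ ρ / 2 * (2 * x0 + 2 * ρ) / 2 := by
        rw [norm_div, norm_mul, hz, Complex.norm_ofNat]
        have h4 : ‖z + x‖ ≤ 2 * x0 + 2 * ρ := by
          rw [show z + x = (z - x0) + (x - x0) + ((2 * x0 : ℝ) : ℂ) by push_cast; ring]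
          refine (norm_add₃_le).trans ?_
          rw [Complex.norm_real, Real.norm_of_nonneg (by positivity)]
          linarith
        gcongr
      have h5 := (Complex.re_le_norm _).trans h3
      rw [e, Complex.add_re]
      have : ρ * ρ ≤ 1 := by nlinarith
      linarith
    have h6 : ρ * x0 / 2 ≤ 1 / 320 * (τ * (x0 + y0) ^ 2) + 20 := by
      have h7 : τ * x0 ^ 2 ≤ τ * (x0 + y0) ^ 2 := by gcongr; linarith
      rw [← hρ2] at h7 ⊢
      nlinarith [sq_nonneg (ρ * x0 - 80)]
    have h8 : 0 ≤ (x0 - y0) ^ 2 / τ := by positivity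
    have h9 : 0 ≤ τ * (x0 + y0) ^ 2 := by positivity
    rw [norm_mul, Complex.norm_exp]
    calc Real.exp (z ^ 2 / 2).re * ‖heatC ν t z y‖
        ≤ Real.exp (z ^ 2 / 2).re * (C * Real.exp (-(2 * (1 + ν) * t0)) * (vol1 ν x0 ρ)⁻¹ *
          Real.exp (-(1 / 160 * ((x0 - y0) ^ 2 / τ + τ * (x0 + y0) ^ 2)))) := by gcongr
      _ = C * Real.exp (-(2 * (1 + ν) * t0)) * (vol1 ν x0 ρ)⁻¹ * (Real.exp (z ^ 2 / 2).re *
          Real.exp (-(1 / 160 * ((x0 - y0) ^ 2 / τ + τ * (x0 + y0) ^ 2)))) := by ring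
      _ ≤ C * Real.exp (-(2 * (1 + ν) * t0)) * (vol1 ν x0 ρ)⁻¹ * (Real.exp (x ^ 2 / 2).re *
          (Real.exp 21 * Real.exp (-(1 / 320 * ((x0 - y0) ^ 2 / τ))))) := by
          refine mul_le_mul_of_nonneg_left ?_ (by positivity)
          rw [← Real.exp_add, ← Real.exp_add, ← Real.exp_add, Real.exp_le_exp]
          linarith
      _ = _ := by rw [hB]; ring
  have hcau := Complex.norm_iteratedDeriv_le_of_forall_mem_sphere_norm_le n
    (by positivity : 0 < ρ / 2) hd.diffContOnCl hsup
  unfold deltaC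
  rw [norm_mul, Complex.norm_exp]
  calc Real.exp (-x ^ 2 / 2).re * ‖iteratedDeriv n (fun z => Complex.exp (z ^ 2 / 2) *
          heatC ν t z y) x‖
      ≤ Real.exp (-x ^ 2 / 2).re * (n.factorial * (Real.exp (x ^ 2 / 2).re *
          (Real.exp 21 * C * B)) / (ρ / 2) ^ n) := by gcongr
    _ = (Real.exp (-x ^ 2 / 2).re * Real.exp (x ^ 2 / 2).re) * (n.factorial *
          (Real.exp 21 * C * B) / (ρ / 2) ^ n) := by ring
    _ = n.factorial * (Real.exp 21 * C * B) / (ρ / 2) ^ n := by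
        rw [← Real.exp_add, neg_div, Complex.neg_re, neg_add_cancel, Real.exp_zero, one_mul]
    _ = _ := by rw [hB, div_pow]; field_simp

variable {d : ℕ}

/-- The Laguerre derivative `δ_x^n G_t^α(x, y)` with all its variables complex. -/
noncomputable def deltaCProd (α : Fin d → ℝ) (n : Fin d → ℕ) (t : ℂ) (x y : Fin d → ℂ) : ℂ :=
  ∏ i, deltaC (α i) (n i) t (x i) (y i)

/-- The model `∏ r (x_i + r)^(2 α_i + 1)` for the measure of the ball of centre `x` and
radius `r`. -/
noncomputable def vol (α : Fin d → ℝ) (x : Fin d → ℝ) (r : ℝ) : ℝ := ∏ i, vol1 (α i) (x i) r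

lemma vol_pos {α x : Fin d → ℝ} {r : ℝ} (hx : ∀ i, 0 < x i) (hr : 0 < r) : 0 < vol α x r :=
  Finset.prod_pos fun i _ => vol1_pos (hx i) hr

/-- The Gaussian majorant of `δ_x^n G_t^α(x, y)`. -/
noncomputable def gaussMaj (α : Fin d → ℝ) (N : ℕ) (t : ℝ) (x y : Fin d → ℝ) : ℝ :=
  (√(min t 1) ^ N)⁻¹ * Real.exp (-(t * (2 * d + 2 * ∑ i, α i))) * (vol α x √(min t 1))⁻¹ *
    Real.exp (-(1 / 320 * ((∑ i, (x i - y i) ^ 2) / min t 1)))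

lemma exists_norm_deltaCProd_le {α : Fin d → ℝ} (hα : ∀ i, -1 < α i) (n : Fin d → ℕ) :
    ∃ C > 0, ∀ t0 > 0, ∀ x0 y0 : Fin d → ℝ, (∀ i, 0 < x0 i) → (∀ i, 0 < y0 i) →
    ∀ (t : ℂ) (x y : Fin d → ℂ), ‖t - (t0 : ℝ)‖ ≤ min t0 1 / 4 →
      (∀ i, ‖x i - (x0 i : ℝ)‖ ≤ √(min t0 1) / 2) → (∀ i, ‖y i - (y0 i : ℝ)‖ ≤ √(min t0 1)) →
      ‖deltaCProd α n t x y‖ ≤ C * gaussMaj α (∑ i, n i) t0 x0 y0 := by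
  choose C hC hb using fun i => exists_norm_deltaC_le (hα i) (n i)
  refine ⟨∏ i, C i, Finset.prod_pos fun i _ => hC i, fun t0 ht0 x0 y0 hx0 hy0 t x y ht hx hy => ?_⟩
  unfold deltaCProd
  rw [norm_prod]
  refine (Finset.prod_le_prod (fun i _ => norm_nonneg _) fun i _ =>
    hb i t0 ht0 (x0 i) (hx0 i) (y0 i) (hy0 i) t (x i) (y i) ht (hx i) (hy i)).trans_eq ?_
  unfold gaussMaj vol
  rw [Finset.prod_mul_distrib, Finset.prod_mul_distrib, Finset.prod_mul_distrib,
    Finset.prod_mul_distrib, Finset.prod_inv_distrib, Finset.prod_inv_distrib,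
    Finset.prod_pow_eq_pow_sum, ← Real.exp_sum, ← Real.exp_sum, Finset.sum_neg_distrib,
    Finset.sum_neg_distrib, ← Finset.mul_sum, ← Finset.sum_div, ← Finset.sum_mul,
    ← Finset.mul_sum, Finset.sum_add_distrib]
  simp only [Finset.sum_const, Finset.card_univ, Fintype.card_fin, nsmul_eq_mul, mul_one]
  rw [show 2 * ((d : ℝ) + ∑ i, α i) * t0 = t0 * (2 * d + 2 * ∑ i, α i) by ring]
  ring

/-- Differentiability of the product kernel along a curve in the space of its variables. -/
lemma differentiableAt_deltaCProd_comp {α : Fin d → ℝ} (hα : ∀ i, -1 < α i) (n : Fin d → ℕ)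
    {T : ℂ → ℂ} {X Y : ℂ → Fin d → ℂ} {s : ℂ} (hT : DifferentiableAt ℂ T s)
    (hX : ∀ i, DifferentiableAt ℂ (fun s => X s i) s)
    (hY : ∀ i, DifferentiableAt ℂ (fun s => Y s i) s)
    (hs : Complex.sinh (2 * T s) ∈ Complex.slitPlane) :
    DifferentiableAt ℂ (fun s => deltaCProd α n (T s) (X s) (Y s)) s := by
  unfold deltaCProd
  refine DifferentiableAt.fun_finsetProd fun i _ => ?_
  have h := (analyticAt_deltaC (hα i) (n i) (p := (T s, X s i, Y s i)) hs).differentiableAt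
  exact h.comp s (hT.prodMk ((hX i).prodMk (hY i)))

/-- `∂_t^m δ_x^n G_t^α(x, y)` with all its variables complex. -/
noncomputable def mixedC (α : Fin d → ℝ) (n : Fin d → ℕ) (m : ℕ) (t : ℂ) (x y : Fin d → ℂ) : ℂ :=
  iteratedDeriv m (fun s => deltaCProd α n s x y) t

lemma sinh_two_mul_mem_slitPlane {t0 : ℝ} (ht0 : 0 < t0) {t : ℂ} (ht : ‖t - t0‖ ≤ min t0 1 / 4) :
    Complex.sinh (2 * t) ∈ Complex.slitPlane :=
  (hyperbolic_bounds ht0 ht).2.2.2.2.2.2.2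

lemma sinh_two_mul_ofReal_mem_slitPlane {t : ℝ} (ht : 0 < t) :
    Complex.sinh (2 * (t : ℂ)) ∈ Complex.slitPlane :=
  sinh_two_mul_mem_slitPlane ht
    (by rw [sub_self, norm_zero]; exact div_nonneg (le_min ht.le zero_le_one) (by norm_num))

/-- Cauchy's estimate in the time variable. -/
lemma norm_iteratedDeriv_time_le {F : ℂ → ℂ} {t0 M : ℝ} (m : ℕ) (ht0 : 0 < t0)
    (hF : ∀ t : ℂ, Complex.sinh (2 * t) ∈ Complex.slitPlane → DifferentiableAt ℂ F t)
    (hM : ∀ t : ℂ, ‖t - t0‖ ≤ min t0 1 / 4 → ‖F t‖ ≤ M) :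
    ‖iteratedDeriv m F t0‖ ≤ m.factorial * 4 ^ m * ((min t0 1) ^ m)⁻¹ * M := by
  have hτ0 : 0 < min t0 1 := lt_min ht0 one_pos
  have h := Complex.norm_iteratedDeriv_le_of_forall_mem_sphere_norm_le (f := F) (C := M)
    (c := (t0 : ℂ)) m (by positivity : 0 < min t0 1 / 4) ?_ ?_
  · refine h.trans_eq ?_
    rw [div_pow]; field_simp
  · refine DifferentiableOn.diffContOnCl fun t ht => ?_
    have : ‖t - t0‖ ≤ min t0 1 / 4 := by
      simpa [dist_eq_norm] using Metric.closure_ball_subset_closedBall ht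
    exact (hF t (sinh_two_mul_mem_slitPlane ht0 this)).differentiableWithinAt
  · intro t ht
    exact hM t (mem_sphere_iff_norm.1 ht).le

lemma differentiableAt_deltaCProd {α : Fin d → ℝ} (hα : ∀ i, -1 < α i) (n : Fin d → ℕ)
    (x y : Fin d → ℂ) (t : ℂ) (ht : Complex.sinh (2 * t) ∈ Complex.slitPlane) :
    DifferentiableAt ℂ (fun s => deltaCProd α n s x y) t :=
  differentiableAt_deltaCProd_comp hα n (T := id) (X := fun _ => x) (Y := fun _ => y)
    differentiableAt_id (fun _ => differentiableAt_const _) (fun _ => differentiableAt_const _) ht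

lemma analyticAt_deltaCProd {α : Fin d → ℝ} (hα : ∀ i, -1 < α i) (n : Fin d → ℕ)
    (x y : Fin d → ℂ) {t : ℂ} (ht : Complex.sinh (2 * t) ∈ Complex.slitPlane) :
    AnalyticAt ℂ (fun s => deltaCProd α n s x y) t := by
  have : DifferentiableOn ℂ (fun s => deltaCProd α n s x y)
      {t : ℂ | Complex.sinh (2 * t) ∈ Complex.slitPlane} := fun t ht =>
    (differentiableAt_deltaCProd hα n x y t ht).differentiableWithinAt
  exact this.analyticAt (isOpen_sinh_slitPlane.mem_nhds ht)

/-- Cauchy's estimate in `t` on a circle of radius `min t 1 / 4`. -/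
lemma exists_norm_mixedC_le {α : Fin d → ℝ} (hα : ∀ i, -1 < α i) (n : Fin d → ℕ) (m : ℕ) :
    ∃ C > 0, ∀ t0 > 0, ∀ x0 y0 : Fin d → ℝ, (∀ i, 0 < x0 i) → (∀ i, 0 < y0 i) →
      ‖mixedC α n m (t0 : ℝ) (fun i => (x0 i : ℝ)) (fun i => (y0 i : ℝ))‖ ≤
        C * ((min t0 1 ^ m)⁻¹ * gaussMaj α (∑ i, n i) t0 x0 y0) := by
  obtain ⟨C, hC, hb⟩ := exists_norm_deltaCProd_le hα n
  refine ⟨m.factorial * 4 ^ m * C, by positivity, fun t0 ht0 x0 y0 hx0 hy0 => ?_⟩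
  refine (norm_iteratedDeriv_time_le m ht0
    (differentiableAt_deltaCProd hα n _ _) fun t ht =>
      hb t0 ht0 x0 y0 hx0 hy0 t _ _ ht (fun i => by rw [sub_self, norm_zero]; positivity)
        (fun i => by rw [sub_self, norm_zero]; positivity)).trans_eq (by ring)

/-- The mean value inequality along the segment from `(x₀, y₀)` to `(x₁, y₁)`, with the derivative
along the segment estimated by Cauchy's inequality.  It is applied to `δ_x^n G` at complex times and
is followed by Cauchy's estimate in `t`, so that no mixed derivative has to be computed. -/
lemma exists_norm_mixedC_sub_le {α : Fin d → ℝ} (hα : ∀ i, -1 < α i) (n : Fin d → ℕ) (m : ℕ) :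
    ∃ C > 0, ∀ t0 > 0, ∀ x0 y0 x1 y1 : Fin d → ℝ, (∀ i, 0 < x0 i) → (∀ i, 0 < y0 i) →
      (∀ i, 0 < x1 i) → (∀ i, 0 < y1 i) → ∀ L > 0, (∀ i, |x1 i - x0 i| ≤ L) →
      (∀ i, |y1 i - y0 i| ≤ L) → ∀ M,
      (∀ s : ℝ, 0 ≤ s → s ≤ 1 → gaussMaj α (∑ i, n i) t0 (fun i => x0 i + s * (x1 i - x0 i))
        (fun i => y0 i + s * (y1 i - y0 i)) ≤ M) →
      ‖mixedC α n m (t0 : ℝ) (fun i => (x1 i : ℝ)) (fun i => (y1 i : ℝ)) -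
        mixedC α n m (t0 : ℝ) (fun i => (x0 i : ℝ)) (fun i => (y0 i : ℝ))‖ ≤
        C * ((min t0 1 ^ m)⁻¹ * (L / √(min t0 1) * M)) := by
  obtain ⟨C, hC, hb⟩ := exists_norm_deltaCProd_le hα n
  refine ⟨m.factorial * 4 ^ m * (2 * C), by positivity,
    fun t0 ht0 x0 y0 x1 y1 hx0 hy0 hx1 hy1 L hL hxL hyL M hM => ?_⟩
  have hρ0 : 0 < √(min t0 1) := Real.sqrt_pos.2 (lt_min ht0 one_pos)
  have hda := fun x y => differentiableAt_deltaCProd hα n x y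
  have hsub : mixedC α n m (t0 : ℝ) (fun i => (x1 i : ℝ)) (fun i => (y1 i : ℝ)) -
      mixedC α n m (t0 : ℝ) (fun i => (x0 i : ℝ)) (fun i => (y0 i : ℝ)) =
      iteratedDeriv m ((fun s => deltaCProd α n s (fun i => (x1 i : ℝ)) (fun i => (y1 i : ℝ))) -
        (fun s => deltaCProd α n s (fun i => (x0 i : ℝ)) (fun i => (y0 i : ℝ)))) (t0 : ℂ) := by
    have hcd : ∀ x y : Fin d → ℂ, ContDiffAt ℂ m (fun s => deltaCProd α n s x y) (t0 : ℂ) :=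
      fun x y => (analyticAt_deltaCProd hα n x y (sinh_two_mul_ofReal_mem_slitPlane ht0)).contDiffAt
    rw [iteratedDeriv_sub (hcd _ _) (hcd _ _)]
    rfl
  rw [hsub]
  refine (norm_iteratedDeriv_time_le (M := 2 * C * (L / √(min t0 1)) * M) m ht0
    (fun t ht => (hda _ _ t ht).sub (hda _ _ t ht)) fun t ht => ?_).trans_eq (by ring)
  set ρ := √(min t0 1) with hρ
  set X : ℂ → Fin d → ℂ := fun s i => (x0 i : ℂ) + s * ((x1 i - x0 i : ℝ) : ℂ) with hX
  set Y : ℂ → Fin d → ℂ := fun s i => (y0 i : ℂ) + s * ((y1 i - y0 i : ℝ) : ℂ) with hY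
  have hdiff : Differentiable ℂ (fun s => deltaCProd α n t (X s) (Y s)) := fun s =>
    differentiableAt_deltaCProd_comp hα n (T := fun _ => t) (differentiableAt_const _)
      (fun i => by simp only [hX]; fun_prop) (fun i => by simp only [hY]; fun_prop)
      (sinh_two_mul_mem_slitPlane ht0 ht)
  have hseg : ∀ s ∈ segment ℝ (0 : ℂ) 1, ∃ r : ℝ, 0 ≤ r ∧ r ≤ 1 ∧ s = r := by
    intro s hs
    rw [segment_eq_image] at hs
    obtain ⟨θ, hθ, rfl⟩ := hs
    exact ⟨θ, hθ.1, hθ.2, by simp⟩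
  have hderiv : ∀ s ∈ segment ℝ (0 : ℂ) 1,
      ‖deriv (fun s => deltaCProd α n t (X s) (Y s)) s‖ ≤ 2 * C * (L / ρ) * M := by
    intro s hs
    obtain ⟨r, hr0, hr1, rfl⟩ := hseg s hs
    have hpos : ∀ a b : ℝ, 0 < a → 0 < b → 0 < a + r * (b - a) := by
      intro a b ha hb
      rcases eq_or_lt_of_le hr1 with h | h
      · rw [h]; linarith
      · have : a + r * (b - a) = (1 - r) * a + r * b := by ring
        rw [this]
        have := mul_pos (sub_pos.2 h) ha
        have := mul_nonneg hr0 hb.le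
        linarith
    have hcoord : ∀ (z : ℂ) (a b : ℝ), ‖z - r‖ = ρ / (2 * L) → |b - a| ≤ L →
        ‖(a : ℂ) + z * ((b - a : ℝ) : ℂ) - ((a + r * (b - a) : ℝ) : ℂ)‖ ≤ ρ / 2 := by
      intro z a b hz hab
      have : (a : ℂ) + z * ((b - a : ℝ) : ℂ) - ((a + r * (b - a) : ℝ) : ℂ) =
          (z - r) * ((b - a : ℝ) : ℂ) := by push_cast; ring
      rw [this, norm_mul, hz, Complex.norm_real, Real.norm_eq_abs]
      calc ρ / (2 * L) * |b - a| ≤ ρ / (2 * L) * L := by gcongr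
        _ = ρ / 2 := by field_simp
    have h := Complex.norm_deriv_le_of_forall_mem_sphere_norm_le (c := (r : ℂ))
      (C := C * M) (f := fun s => deltaCProd α n t (X s) (Y s))
      (by positivity : 0 < ρ / (2 * L)) hdiff.diffContOnCl ?_
    · refine h.trans_eq ?_
      field_simp
    · intro z hz
      rw [mem_sphere_iff_norm] at hz
      refine (hb t0 ht0 _ _ (fun i => hpos (x0 i) (x1 i) (hx0 i) (hx1 i))
        (fun i => hpos (y0 i) (y1 i) (hy0 i) (hy1 i)) t _ _ ht
        (fun i => hcoord z _ _ hz (hxL i))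
        (fun i => (hcoord z _ _ hz (hyL i)).trans (by linarith))).trans ?_
      gcongr
      exact hM r hr0 hr1
  have hmv := (convex_segment (𝕜 := ℝ) (0 : ℂ) 1).norm_image_sub_le_of_norm_deriv_le
    (f := fun s => deltaCProd α n t (X s) (Y s)) (fun s _ => hdiff s) hderiv
    (left_mem_segment ℝ _ _) (right_mem_segment ℝ _ _)
  have hX1 : X 1 = fun i => ((x1 i : ℝ) : ℂ) := by funext i; simp [hX]
  have hX0 : X 0 = fun i => ((x0 i : ℝ) : ℂ) := by funext i; simp [hX]
  have hY1 : Y 1 = fun i => ((y1 i : ℝ) : ℂ) := by funext i; simp [hY]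
  have hY0 : Y 0 = fun i => ((y0 i : ℝ) : ℂ) := by funext i; simp [hY]
  simpa [hX1, hX0, hY1, hY0] using hmv

/-! ### From complex to real derivatives -/

/-- The heat kernel in one real variable, as it enters the product `heatKernel`. -/
noncomputable def heatFactor (ν t u v : ℝ) : ℝ :=
  (Real.sinh (2 * t))⁻¹ *
    Real.exp (-(1 / 2) * (Real.cosh (2 * t) / Real.sinh (2 * t)) * (u ^ 2 + v ^ 2)) *
    ((u * v) ^ (-ν) * besselI ν (u * v / Real.sinh (2 * t)))

lemma heatKernel_eq_prod (α : Fin d → ℝ) (t : ℝ) (x y : EuclideanSpace ℝ (Fin d)) :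
    heatKernel α t x y = ∏ i, heatFactor (α i) t (x i) (y i) := by
  unfold heatKernel heatFactor
  simp only [Finset.prod_mul_distrib, Finset.prod_const, Finset.card_univ, Fintype.card_fin,
    ← Real.exp_sum, ← Finset.mul_sum, Finset.sum_add_distrib, EuclideanSpace.norm_sq_eq, inv_pow,
    Real.norm_eq_abs, sq_abs]

lemma ofReal_besselI {ν z : ℝ} (hz : 0 < z) :
    ((besselI ν z : ℝ) : ℂ) = (((z / 2) ^ ν : ℝ) : ℂ) * besselW ν z := by
  have h : besselI ν z = (z / 2) ^ ν * ∑' k : ℕ, besselCoeff ν k * (z / 2) ^ (2 * k) := by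
    unfold besselI besselCoeff
    rw [← tsum_mul_left]
    refine tsum_congr fun k => ?_
    rw [Real.rpow_add (by positivity), show (2 * (k : ℝ)) = ((2 * k : ℕ) : ℝ) by push_cast; ring,
      Real.rpow_natCast]
    ring
  rw [h, Complex.ofReal_mul, Complex.ofReal_tsum]
  unfold besselW
  push_cast
  rfl

lemma ofReal_heatFactor {ν t u v : ℝ} (ht : 0 < t) (hu : 0 < u) (hv : 0 < v) :
    ((heatFactor ν t u v : ℝ) : ℂ) = heatC ν t u v := by
  have hs : 0 < Real.sinh (2 * t) := Real.sinh_pos_iff.2 (by linarith)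
  have huv : 0 < u * v := mul_pos hu hv
  have e1 : (Real.sinh (2 * t))⁻¹ * ((u * v) ^ (-ν) * (u * v / Real.sinh (2 * t) / 2) ^ ν) =
      2 ^ (-ν) * Real.sinh (2 * t) ^ (-(1 + ν)) := by
    rw [div_div, Real.div_rpow huv.le (by positivity), Real.rpow_neg huv.le,
      Real.mul_rpow hs.le two_pos.le, Real.rpow_neg two_pos.le, Real.rpow_neg hs.le,
      Real.rpow_add hs, Real.rpow_one]
    have := Real.rpow_pos_of_pos huv ν
    field_simp
  have e2 : (Complex.sinh (2 * t)) ^ ((-(1 + ν) : ℝ) : ℂ) =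
      ((Real.sinh (2 * t) ^ (-(1 + ν)) : ℝ) : ℂ) := by
    rw [Complex.ofReal_cpow hs.le]; push_cast; rfl
  unfold heatFactor heatC
  rw [e2, Complex.ofReal_mul, Complex.ofReal_mul, Complex.ofReal_mul,
    ofReal_besselI (by positivity)]
  have e3 := congrArg (fun r : ℝ => (r : ℂ)) e1
  simp only [Complex.ofReal_mul] at e3
  rw [← e3]
  push_cast
  ring

/-- The one-dimensional Laguerre derivative `f' + u f`. -/
noncomputable def laguerre1 (f : ℝ → ℝ) : ℝ → ℝ := fun u => deriv f u + u * f u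

/-- No differentiability is needed: only one factor depends on the `i`-th coordinate, and `deriv`
commutes with multiplication by a constant also at its junk value. -/
lemma laguerreDeriv_prod (i : Fin d) (φ : Fin d → ℝ → ℝ) :
    laguerreDeriv i (fun z => ∏ j, φ j (z j)) =
      fun z => ∏ j, Function.update φ i (laguerre1 (φ i)) j (z j) := by
  funext x
  have h1 : ∀ f : Fin d → ℝ → ℝ, ∀ z : Fin d → ℝ, ∏ j, f j (z j) =
      f i (z i) * ∏ j ∈ Finset.univ.erase i, f j (z j) := fun f z =>
    (Finset.mul_prod_erase _ _ (Finset.mem_univ i)).symm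
  have h2 : ∀ t : ℝ, ∏ j, φ j ((x + t • EuclideanSpace.single i (1 : ℝ)) j) =
      φ i (x i + t) * ∏ j ∈ Finset.univ.erase i, φ j (x j) := by
    intro t
    rw [h1 φ (fun j => (x + t • EuclideanSpace.single i (1 : ℝ)) j)]
    congr 1
    · simp
    · refine Finset.prod_congr rfl fun j hj => ?_
      simp [Finset.ne_of_mem_erase hj]
  have h3 : ∏ j ∈ Finset.univ.erase i, Function.update φ i (laguerre1 (φ i)) j (x j) =
      ∏ j ∈ Finset.univ.erase i, φ j (x j) :=
    Finset.prod_congr rfl fun j hj => by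
      rw [Function.update_of_ne (Finset.ne_of_mem_erase hj)]
  unfold laguerreDeriv lineDeriv
  simp only [h2]
  rw [deriv_mul_const_field, deriv_comp_const_add, add_zero,
    h1 (Function.update φ i (laguerre1 (φ i))) (fun j => x j), h3, Function.update_self,
    h1 φ (fun j => x j), laguerre1]
  ring

lemma laguerreDeriv_iterate_prod (i : Fin d) (k : ℕ) (φ : Fin d → ℝ → ℝ) :
    (laguerreDeriv i)^[k] (fun z => ∏ j, φ j (z j)) =
      fun z => ∏ j, Function.update φ i (laguerre1^[k] (φ i)) j (z j) := by
  induction k with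
  | zero => simp
  | succ k ih =>
    rw [Function.iterate_succ_apply', ih, laguerreDeriv_prod, Function.iterate_succ_apply']
    simp

lemma laguerreDerivMulti_prod (n : Fin d → ℕ) (φ : Fin d → ℝ → ℝ) :
    laguerreDerivMulti n (fun z => ∏ j, φ j (z j)) =
      fun z => ∏ j, (laguerre1^[n j] (φ j)) (z j) := by
  have h : ∀ l : List (Fin d), l.Nodup →
      ((l.map (fun i => (laguerreDeriv i)^[n i])).foldr (fun g h => g ∘ h) id)
        (fun z => ∏ j, φ j (z j)) =
      fun z => ∏ j, (if j ∈ l then laguerre1^[n j] (φ j) else φ j) (z j) := by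
    intro l
    induction l with
    | nil => simp
    | cons i l ih =>
      intro hl
      rw [List.nodup_cons] at hl
      rw [List.map_cons, List.foldr_cons, Function.comp_apply, ih hl.2,
        laguerreDeriv_iterate_prod i (n i) (fun j => if j ∈ l then laguerre1^[n j] (φ j) else φ j)]
      funext z
      refine Finset.prod_congr rfl fun j _ => ?_
      rcases eq_or_ne j i with rfl | hj
      · simp [hl.1]
      · simp [hj]
  unfold laguerreDerivMulti
  rw [h _ (List.nodup_finRange d)]
  simp

/-- The real derivative of a real function with a complex differentiable extension. -/
lemma ofReal_deriv_eq {f : ℝ → ℝ} {F : ℂ → ℂ} {s : Set ℝ} (hs : IsOpen s)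
    (h : ∀ u ∈ s, ((f u : ℝ) : ℂ) = F u) {u : ℝ} (hu : u ∈ s) (hF : DifferentiableAt ℂ F u) :
    HasDerivAt f (deriv F u).re u ∧ ((deriv f u : ℝ) : ℂ) = deriv F u := by
  have h1 : HasDerivAt (fun v : ℝ => F v) (deriv F u) u := hF.hasDerivAt.comp_ofReal
  have h2 : HasDerivAt (fun v : ℝ => ((f v : ℝ) : ℂ)) (deriv F u) u :=
    h1.congr_of_eventuallyEq (Filter.eventually_of_mem (hs.mem_nhds hu) h)
  have h3 : HasDerivAt f (deriv F u).re u :=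
    Complex.reCLM.hasFDerivAt.comp_hasDerivAt u h2
  have h4 : HasDerivAt (fun _ : ℝ => (0 : ℝ)) (deriv F u).im u :=
    Complex.imCLM.hasFDerivAt.comp_hasDerivAt u h2
  have h5 : (deriv F u).im = 0 := h4.unique (hasDerivAt_const _ _)
  refine ⟨h3, ?_⟩
  rw [h3.deriv]
  exact Complex.ext (by simp) (by simp [h5])

lemma ofReal_iteratedDeriv_eq {f : ℝ → ℝ} {F : ℂ → ℂ} {s : Set ℝ} (hs : IsOpen s)
    (h : ∀ u ∈ s, ((f u : ℝ) : ℂ) = F u) (hF : ∀ u ∈ s, AnalyticAt ℂ F u) (m : ℕ) :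
    ∀ u ∈ s, ((iteratedDeriv m f u : ℝ) : ℂ) = iteratedDeriv m F u := by
  have hA : ∀ m, ∀ u ∈ s, AnalyticAt ℂ (iteratedDeriv m F) u := by
    intro m
    induction m with
    | zero => simpa using hF
    | succ m ih => intro u hu; rw [iteratedDeriv_succ]; exact (ih u hu).deriv
  induction m with
  | zero => simpa using h
  | succ m ih =>
    intro u hu
    rw [iteratedDeriv_succ, iteratedDeriv_succ]
    exact (ofReal_deriv_eq hs ih hu (hA m u hu).differentiableAt).2

/-- On the half-line, where `φ` is the restriction of the entire function `Φ`, the iterates of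
`∂ + u` are the conjugates by `e^(u²/2)` of complex derivatives. -/
lemma ofReal_laguerre1_iterate {φ : ℝ → ℝ} {Φ : ℂ → ℂ} (hΦ : Differentiable ℂ Φ)
    (h : ∀ u ∈ Set.Ioi (0 : ℝ), ((φ u : ℝ) : ℂ) = Φ u) (k : ℕ) :
    ∀ u ∈ Set.Ioi (0 : ℝ), ((laguerre1^[k] φ u : ℝ) : ℂ) =
      Complex.exp (-(u : ℂ) ^ 2 / 2) *
        iteratedDeriv k (fun z => Complex.exp (z ^ 2 / 2) * Φ z) u := by
  have hd : ∀ k, Differentiable ℂ (iteratedDeriv k (fun z => Complex.exp (z ^ 2 / 2) * Φ z)) := by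
    intro k
    have : Differentiable ℂ (fun z => Complex.exp (z ^ 2 / 2) * Φ z) := by fun_prop
    have h2 : ContDiff ℂ ⊤ (fun z => Complex.exp (z ^ 2 / 2) * Φ z) := this.contDiff
    exact h2.differentiable_iteratedDeriv k (by exact_mod_cast WithTop.coe_lt_top _)
  induction k with
  | zero =>
    intro u hu
    rw [iteratedDeriv_zero, ← mul_assoc, ← Complex.exp_add, neg_div, neg_add_cancel,
      Complex.exp_zero, one_mul]
    exact h u hu
  | succ k ih =>
    intro u hu
    set g := iteratedDeriv k (fun z => Complex.exp (z ^ 2 / 2) * Φ z) with hg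
    have h1 : HasDerivAt (fun z : ℂ => Complex.exp (-z ^ 2 / 2) * g z)
        (Complex.exp (-(u : ℂ) ^ 2 / 2) * (-(u : ℂ)) * g u +
          Complex.exp (-(u : ℂ) ^ 2 / 2) * deriv g u) u := by
      have h2 : HasDerivAt (fun z : ℂ => -z ^ 2 / 2) (-(u : ℂ)) u := by
        have := ((hasDerivAt_pow 2 (u : ℂ)).neg).div_const 2
        refine this.congr_deriv ?_
        push_cast; ring
      exact h2.cexp.mul (hd k u).hasDerivAt
    have h3 := (ofReal_deriv_eq (F := fun z : ℂ => Complex.exp (-z ^ 2 / 2) * g z) isOpen_Ioi ih hu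
      h1.differentiableAt).2
    rw [h1.deriv] at h3
    rw [Function.iterate_succ_apply', laguerre1, Complex.ofReal_add, Complex.ofReal_mul, h3,
      ih u hu, iteratedDeriv_succ]
    ring

lemma ofReal_deltaHeat {α : Fin d → ℝ} (hα : ∀ i, -1 < α i) (n : Fin d → ℕ) {t : ℝ} (ht : 0 < t)
    {x y : EuclideanSpace ℝ (Fin d)} (hx : x ∈ orthant d) (hy : y ∈ orthant d) :
    ((deltaHeat α n t x y : ℝ) : ℂ) =
      deltaCProd α n t (fun i => (x i : ℝ)) (fun i => (y i : ℝ)) := by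
  unfold deltaHeat deltaCProd
  simp only [heatKernel_eq_prod]
  rw [laguerreDerivMulti_prod n (fun i u => heatFactor (α i) t u (y i)), Complex.ofReal_prod]
  refine Finset.prod_congr rfl fun i _ => ?_
  exact ofReal_laguerre1_iterate (differentiable_heatC (hα i) t (y i))
    (fun u hu => ofReal_heatFactor ht hu (hy i)) (n i) (x i) (hx i)

lemma ofReal_mixedHeat {α : Fin d → ℝ} (hα : ∀ i, -1 < α i) (n : Fin d → ℕ) (m : ℕ) {t : ℝ}
    (ht : 0 < t) {x y : EuclideanSpace ℝ (Fin d)} (hx : x ∈ orthant d) (hy : y ∈ orthant d) :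
    ((mixedHeat α n m t x y : ℝ) : ℂ) =
      mixedC α n m t (fun i => (x i : ℝ)) (fun i => (y i : ℝ)) :=
  ofReal_iteratedDeriv_eq isOpen_Ioi (fun _ hu => ofReal_deltaHeat hα n hu hx hy)
    (fun _ hu => analyticAt_deltaCProd hα n _ _ (sinh_two_mul_ofReal_mem_slitPlane hu)) m t ht

lemma continuousOn_mixedHeat {α : Fin d → ℝ} (hα : ∀ i, -1 < α i) (n : Fin d → ℕ) (m : ℕ)
    {x y : EuclideanSpace ℝ (Fin d)} (hx : x ∈ orthant d) (hy : y ∈ orthant d) :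
    ContinuousOn (fun t => mixedHeat α n m t x y) (Set.Ioi 0) := by
  have hA : ∀ m, ∀ t : ℂ, Complex.sinh (2 * t) ∈ Complex.slitPlane →
      AnalyticAt ℂ (iteratedDeriv m
        (fun s => deltaCProd α n s (fun i => (x i : ℂ)) (fun i => (y i : ℂ)))) t := by
    intro m
    induction m with
    | zero => intro t ht; simpa using analyticAt_deltaCProd hα n _ _ ht
    | succ m ih => intro t ht; rw [iteratedDeriv_succ]; exact (ih t ht).deriv
  have h1 : ContinuousOn (fun t : ℝ => (mixedC α n m (t : ℂ) (fun i => (x i : ℝ))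
      (fun i => (y i : ℝ))).re) (Set.Ioi 0) := by
    intro t ht
    refine ContinuousAt.continuousWithinAt ?_
    have h2 := (hA m t (sinh_two_mul_ofReal_mem_slitPlane ht)).continuousAt
    exact Complex.continuous_re.continuousAt.comp
      (ContinuousAt.comp (f := fun t : ℝ => (t : ℂ)) h2 Complex.continuous_ofReal.continuousAt)
  refine h1.congr fun t ht => ?_
  beta_reduce
  rw [← ofReal_mixedHeat hα n m ht hx hy, Complex.ofReal_re]

/-! ### Volume of balls -/

/-- Reverse doubling in one variable. -/
lemma vol1_le_of_le {ν x r ρ : ℝ} (hx : 0 < x) (hr : 0 < r) (h : r ≤ ρ) :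
    vol1 ν x r ≤ (r / ρ) ^ min 1 (2 * ν + 2) * vol1 ν x ρ := by
  have hρ : 0 < ρ := by linarith
  have hq : 0 < r / ρ := by positivity
  unfold vol1
  rcases le_total 0 (2 * ν + 1) with he | he
  · rw [min_eq_left (by linarith), Real.rpow_one]
    calc r * (x + r) ^ (2 * ν + 1) ≤ r * (x + ρ) ^ (2 * ν + 1) := by gcongr
      _ = _ := by field_simp
  · rw [min_eq_right (by linarith), show 2 * ν + 2 = 1 + (2 * ν + 1) by ring, Real.rpow_add hq,
      Real.rpow_one]
    have h1 : r / ρ * (x + ρ) ≤ x + r := by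
      have : r / ρ ≤ 1 := (div_le_one hρ).2 h
      have e : r / ρ * ρ = r := by field_simp
      nlinarith
    calc r * (x + r) ^ (2 * ν + 1) ≤ r * (r / ρ * (x + ρ)) ^ (2 * ν + 1) := by
          gcongr 1
          exact Real.rpow_le_rpow_of_nonpos (by positivity) h1 he
      _ = _ := by rw [Real.mul_rpow hq.le (by positivity)]; field_simp

/-- Doubling in one variable. -/
lemma vol1_le_of_ge {ν x r ρ : ℝ} (hx : 0 < x) (hρ : 0 < ρ) (h : ρ ≤ r) :
    vol1 ν x r ≤ (r / ρ) ^ max 1 (2 * ν + 2) * vol1 ν x ρ := by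
  have hr : 0 < r := by linarith
  have hq : 0 < r / ρ := by positivity
  unfold vol1
  rcases le_total 0 (2 * ν + 1) with he | he
  · rw [max_eq_right (by linarith), show 2 * ν + 2 = 1 + (2 * ν + 1) by ring, Real.rpow_add hq,
      Real.rpow_one]
    have h1 : x + r ≤ r / ρ * (x + ρ) := by
      have : 1 ≤ r / ρ := (one_le_div hρ).2 h
      have e : r / ρ * ρ = r := by field_simp
      nlinarith
    calc r * (x + r) ^ (2 * ν + 1) ≤ r * (r / ρ * (x + ρ)) ^ (2 * ν + 1) := by gcongr
      _ = _ := by rw [Real.mul_rpow hq.le (by positivity)]; field_simp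
  · rw [max_eq_left (by linarith), Real.rpow_one]
    calc r * (x + r) ^ (2 * ν + 1) ≤ r * (x + ρ) ^ (2 * ν + 1) := by
          gcongr 1
          exact Real.rpow_le_rpow_of_nonpos (by positivity) (by linarith) he
      _ = _ := by field_simp

/-- The reverse doubling exponent of `vol α`. -/
noncomputable def lowerDim (α : Fin d → ℝ) : ℝ := ∑ i, min 1 (2 * α i + 2)

/-- The doubling exponent of `vol α`. -/
noncomputable def upperDim (α : Fin d → ℝ) : ℝ := ∑ i, max 1 (2 * α i + 2)

lemma lowerDim_pos (hd : 1 ≤ d) {α : Fin d → ℝ} (hα : ∀ i, -1 < α i) : 0 < lowerDim α := by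
  refine Finset.sum_pos (fun i _ => lt_min one_pos (by linarith [hα i])) ?_
  exact ⟨⟨0, hd⟩, Finset.mem_univ _⟩

lemma upperDim_nonneg (α : Fin d → ℝ) : 0 ≤ upperDim α :=
  Finset.sum_nonneg fun _ _ => zero_le_one.trans (le_max_left _ _)

lemma vol_le_of_le {α x : Fin d → ℝ} {r ρ : ℝ} (hx : ∀ i, 0 < x i) (hr : 0 < r) (h : r ≤ ρ) :
    vol α x r ≤ (r / ρ) ^ lowerDim α * vol α x ρ := by
  have hρ : 0 < ρ := by linarith
  unfold vol lowerDim
  rw [Real.rpow_sum_of_pos (by positivity), ← Finset.prod_mul_distrib]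
  exact Finset.prod_le_prod (fun i _ => (vol1_pos (hx i) hr).le)
    fun i _ => vol1_le_of_le (hx i) hr h

lemma vol_le_of_ge {α x : Fin d → ℝ} {r ρ : ℝ} (hx : ∀ i, 0 < x i) (hρ : 0 < ρ) (h : ρ ≤ r) :
    vol α x r ≤ (r / ρ) ^ upperDim α * vol α x ρ := by
  have hr : 0 < r := by linarith
  unfold vol upperDim
  rw [Real.rpow_sum_of_pos (by positivity), ← Finset.prod_mul_distrib]
  exact Finset.prod_le_prod (fun i _ => (vol1_pos (hx i) hr).le)
    fun i _ => vol1_le_of_ge (hx i) hρ h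

/-- The volumes of balls of radius `r` with centres at distance at most `r / 2` are comparable. -/
lemma exists_vol_le_of_near (α : Fin d → ℝ) : ∃ C > 0, ∀ x x' : Fin d → ℝ, (∀ i, 0 < x i) →
    (∀ i, 0 < x' i) → ∀ r > 0, (∀ i, |x i - x' i| ≤ r / 2) → vol α x r ≤ C * vol α x' r := by
  refine ⟨∏ i, 2 ^ |2 * α i + 1|, Finset.prod_pos fun _ _ => by positivity,
    fun x x' hx hx' r hr h => ?_⟩
  unfold vol
  rw [← Finset.prod_mul_distrib]
  refine Finset.prod_le_prod (fun i _ => (vol1_pos (hx i) hr).le) fun i _ => ?_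
  have h1 := abs_le.1 (h i)
  have hx1 := hx i
  have hx2 := hx' i
  have := rpow_le_of_comparable (a := x' i + r) (b := x i + r) (L := 2) (by positivity)
    (by positivity) one_le_two (by linarith) (by linarith) (2 * α i + 1)
  unfold vol1
  calc r * (x i + r) ^ (2 * α i + 1)
      ≤ r * (2 ^ |2 * α i + 1| * (x' i + r) ^ (2 * α i + 1)) := by gcongr
    _ = _ := by ring

lemma integrableOn_rpow_Ioc {e b : ℝ} (he : -1 < e) (hb : 0 < b) :
    IntegrableOn (fun u : ℝ => u ^ e) (Set.Ioc 0 b) := by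
  rw [← intervalIntegrable_iff_integrableOn_Ioc_of_le hb.le]
  exact intervalIntegral.intervalIntegrable_rpow' he

lemma exists_integral_rpow_le {ν : ℝ} (hν : -1 < ν) : ∃ C > 0, ∀ x > 0, ∀ r > 0,
    IntegrableOn (fun u : ℝ => u ^ (2 * ν + 1)) (Set.Ioi 0 ∩ Set.Ioo (x - r) (x + r)) ∧
    ∫ u in Set.Ioi 0 ∩ Set.Ioo (x - r) (x + r), u ^ (2 * ν + 1) ≤ C * vol1 ν x r := by
  set e := 2 * ν + 1 with he
  have he1 : -1 < e := by linarith
  have he2 : 0 < e + 1 := by linarith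
  refine ⟨2 * 3 ^ |e| + 3 / (e + 1), by positivity, fun x hx r hr => ?_⟩
  have hsub : Set.Ioi 0 ∩ Set.Ioo (x - r) (x + r) ⊆ Set.Ioc 0 (x + r) := fun u hu =>
    ⟨hu.1, hu.2.2.le⟩
  have hI := integrableOn_rpow_Ioc he1 (by positivity : 0 < x + r)
  refine ⟨hI.mono_set hsub, ?_⟩
  have hp : 0 < (x + r) ^ e := by positivity
  have hv : vol1 ν x r = r * (x + r) ^ e := rfl
  rw [hv]
  -- far from the origin the density is almost constant; otherwise `x + r` is at most `3 r`
  rcases le_total (2 * r) x with h | h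
  · have h1 : ∀ u ∈ Set.Ioi 0 ∩ Set.Ioo (x - r) (x + r), ‖u ^ e‖ ≤ 3 ^ |e| * (x + r) ^ e := by
      intro u hu
      have hu0 : 0 < u := hu.1
      rw [Real.norm_of_nonneg (by positivity)]
      exact rpow_le_of_comparable (by positivity) hu0 (by norm_num) (by linarith [hu.2.1])
        (by linarith [hu.2.2]) e
    have hfin : volume (Set.Ioi 0 ∩ Set.Ioo (x - r) (x + r)) ≤ ENNReal.ofReal (2 * r) := by
      refine (measure_mono Set.inter_subset_right).trans_eq ?_
      rw [Real.volume_Ioo]; congr 1; ring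
    have h2 := norm_setIntegral_le_of_norm_le_const (hfin.trans_lt ENNReal.ofReal_lt_top) h1
    have h3 : volume.real (Set.Ioi 0 ∩ Set.Ioo (x - r) (x + r)) ≤ 2 * r :=
      ENNReal.toReal_le_of_le_ofReal (by positivity) hfin
    calc _ ≤ _ := Real.le_norm_self _
      _ ≤ _ := h2
      _ ≤ 3 ^ |e| * (x + r) ^ e * (2 * r) := by gcongr
      _ = 2 * 3 ^ |e| * (r * (x + r) ^ e) := by ring
      _ ≤ _ := by
        gcongr
        have : 0 < 3 / (e + 1) := by positivity
        linarith
  · have h1 : ∫ u in Set.Ioi 0 ∩ Set.Ioo (x - r) (x + r), u ^ e ≤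
        ∫ u in Set.Ioc 0 (x + r), u ^ e := by
      refine setIntegral_mono_set hI ?_ hsub.eventuallyLE
      refine (ae_restrict_iff' measurableSet_Ioc).2 (Filter.Eventually.of_forall fun u hu => ?_)
      exact Real.rpow_nonneg hu.1.le _
    refine h1.trans ?_
    rw [← intervalIntegral.integral_of_le (by positivity), integral_rpow (Or.inl he1),
      Real.zero_rpow he2.ne', sub_zero, Real.rpow_add_one (by positivity)]
    calc (x + r) ^ e * (x + r) / (e + 1) ≤ (x + r) ^ e * (3 * r) / (e + 1) := by
          gcongr; linarith
      _ = 3 / (e + 1) * (r * (x + r) ^ e) := by ring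
      _ ≤ _ := by
        gcongr
        have : 0 < 2 * (3 : ℝ) ^ |e| := by positivity
        linarith

lemma measurableSet_orthant : MeasurableSet (orthant d) := by
  have : orthant d = ⋂ i, {x : EuclideanSpace ℝ (Fin d) | 0 < x i} := by
    ext x; simp [orthant]
  rw [this]
  exact MeasurableSet.iInter fun i => measurableSet_lt measurable_const (by fun_prop)

lemma isOpen_orthant : IsOpen (orthant d) := by
  have : orthant d = ⋂ i, {x : EuclideanSpace ℝ (Fin d) | 0 < x i} := by
    ext x; simp [orthant]
  rw [this]
  exact isOpen_iInter_of_finite fun i => isOpen_lt continuous_const (by fun_prop)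

lemma abs_coord_le_norm (x : EuclideanSpace ℝ (Fin d)) (i : Fin d) : |x i| ≤ ‖x‖ := by
  simpa using PiLp.norm_apply_le x i

lemma exists_muMeasure_ball_le {α : Fin d → ℝ} (hα : ∀ i, -1 < α i) : ∃ C > 0,
    ∀ x ∈ orthant d, ∀ r > 0, muMeasure α (Metric.ball x r ∩ orthant d) ≤
      ENNReal.ofReal (C * vol α (fun i => x i) r) := by
  choose C hC hb using fun i => exists_integral_rpow_le (hα i)
  refine ⟨∏ i, C i, Finset.prod_pos fun i _ => hC i, fun x hx r hr => ?_⟩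
  set s : Fin d → Set ℝ := fun i => Set.Ioi 0 ∩ Set.Ioo (x i - r) (x i + r) with hs
  have hsm : ∀ i, MeasurableSet (s i) := fun i => measurableSet_Ioi.inter measurableSet_Ioo
  set f : Fin d → ℝ → ℝ := fun i => (s i).indicator (fun u => u ^ (2 * α i + 1)) with hf
  have hfi : ∀ i, Integrable (f i) := fun i =>
    (integrable_indicator_iff (hsm i)).2 (hb i (x i) (hx i) r hr).1
  have hf0 : ∀ i u, 0 ≤ f i u := fun i u =>
    Set.indicator_nonneg (fun v hv => Real.rpow_nonneg (le_of_lt hv.1) _) u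
  have hm : MeasurableSet (Metric.ball x r ∩ orthant d) :=
    Metric.isOpen_ball.measurableSet.inter measurableSet_orthant
  unfold muMeasure
  rw [withDensity_apply _ hm, Measure.restrict_restrict hm]
  have h1 : ∫⁻ z in Metric.ball x r ∩ orthant d ∩ orthant d,
      ENNReal.ofReal (∏ i, z i ^ (2 * α i + 1)) ≤
      ∫⁻ z : EuclideanSpace ℝ (Fin d), ENNReal.ofReal (∏ i, f i (z i)) := by
    rw [← lintegral_indicator (hm.inter measurableSet_orthant)]
    refine lintegral_mono fun z => ?_
    by_cases hz : z ∈ Metric.ball x r ∩ orthant d ∩ orthant d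
    · rw [Set.indicator_of_mem hz]
      refine ENNReal.ofReal_le_ofReal (le_of_eq (Finset.prod_congr rfl fun i _ => ?_))
      have h2 : |z i - x i| < r := by
        have := abs_coord_le_norm (z - x) i
        have h3 : ‖z - x‖ < r := by simpa [dist_eq_norm] using hz.1.1
        exact lt_of_le_of_lt (by simpa using this) h3
      rw [abs_lt] at h2
      have : z i ∈ s i := ⟨hz.2 i, by linarith, by linarith⟩
      rw [hf]
      simp only
      rw [Set.indicator_of_mem this]
    · rw [Set.indicator_of_notMem hz]; exact bot_le
  refine h1.trans ?_
  have h2 : ∫⁻ z : EuclideanSpace ℝ (Fin d), ENNReal.ofReal (∏ i, f i (z i)) =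
      ∫⁻ z : Fin d → ℝ, ENNReal.ofReal (∏ i, f i (z i)) :=
    (EuclideanSpace.volume_preserving_symm_measurableEquiv_toLp (Fin d)).lintegral_comp_emb
      (MeasurableEquiv.measurableEmbedding _)
      (fun z : Fin d → ℝ => ENNReal.ofReal (∏ i, f i (z i)))
  have h3 : Integrable (fun z : Fin d → ℝ => ∏ i, f i (z i)) := Integrable.fintype_prod hfi
  rw [h2, ← ofReal_integral_eq_lintegral_ofReal h3
    (Filter.Eventually.of_forall fun z => Finset.prod_nonneg fun i _ => hf0 i _),
    integral_fintype_prod_volume_eq_prod]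
  refine ENNReal.ofReal_le_ofReal ?_
  unfold vol
  rw [← Finset.prod_mul_distrib]
  refine Finset.prod_le_prod (fun i _ => integral_nonneg (hf0 i)) fun i _ => ?_
  rw [integral_indicator (hsm i)]
  exact (hb i (x i) (hx i) r hr).2

lemma muMeasure_ball_pos (α : Fin d → ℝ) {x : EuclideanSpace ℝ (Fin d)} (hx : x ∈ orthant d)
    {r : ℝ} (hr : 0 < r) : 0 < muMeasure α (Metric.ball x r ∩ orthant d) := by
  have hac : volume.restrict (orthant d) ≪ muMeasure α := by
    refine withDensity_absolutelyContinuous' (by fun_prop) ?_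
    refine (ae_restrict_iff' measurableSet_orthant).2 (Filter.Eventually.of_forall fun z hz => ?_)
    have : 0 < ∏ i, z i ^ (2 * α i + 1) :=
      Finset.prod_pos fun i _ => Real.rpow_pos_of_pos (hz i) _
    simpa using this
  have hm : MeasurableSet (Metric.ball x r ∩ orthant d) :=
    Metric.isOpen_ball.measurableSet.inter measurableSet_orthant
  rw [pos_iff_ne_zero]
  intro h
  have h1 := hac h
  rw [Measure.restrict_apply hm, Set.inter_assoc, Set.inter_self] at h1
  have hne : (Metric.ball x r ∩ orthant d).Nonempty := ⟨x, by simpa using hr, hx⟩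
  exact ((Metric.isOpen_ball.inter isOpen_orthant).measure_pos volume hne).ne' h1

/-- The only comparison with the true measure of balls that the estimates use is that the model
`vol` bounds it from above.  Positivity of `muBall` matters, since `1 / muBall` is `0` at a null
ball. -/
lemma exists_inv_vol_le {α : Fin d → ℝ} (hα : ∀ i, -1 < α i) : ∃ C > 0,
    ∀ x ∈ orthant d, ∀ r > 0, (vol α (fun i => x i) r)⁻¹ ≤ C * (1 / muBall α x r) := by
  obtain ⟨C, hC, h⟩ := exists_muMeasure_ball_le hα
  refine ⟨C, hC, fun x hx r hr => ?_⟩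
  have hv : 0 < vol α (fun i => x i) r := vol_pos hx hr
  have h1 := h x hx r hr
  have h2 : muBall α x r ≤ C * vol α (fun i => x i) r :=
    ENNReal.toReal_le_of_le_ofReal (by positivity) h1
  have h3 : 0 < muBall α x r :=
    ENNReal.toReal_pos (muMeasure_ball_pos α hx hr).ne' (h1.trans_lt ENNReal.ofReal_lt_top).ne
  rw [mul_one_div, inv_eq_one_div, div_le_div_iff₀ hv h3]
  linarith

/-! ### Pointwise standard estimates with a time profile -/

/-- The profile `min (u^δ) (u^(-δ))`, integrable with respect to `du / u`. -/
noncomputable def bump (δ u : ℝ) : ℝ := min (u ^ δ) (u ^ (-δ))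

lemma bump_nonneg (δ : ℝ) {u : ℝ} (hu : 0 < u) : 0 ≤ bump δ u :=
  le_min (Real.rpow_nonneg hu.le _) (Real.rpow_nonneg hu.le _)

lemma bump_le_one {δ u : ℝ} (hδ : 0 ≤ δ) (hu : 0 < u) : bump δ u ≤ 1 := by
  rcases le_total u 1 with h | h
  · exact (min_le_left _ _).trans (Real.rpow_le_one hu.le h hδ)
  · exact (min_le_right _ _).trans (Real.rpow_le_one_of_one_le_of_nonpos h (by linarith))

lemma bump_of_le_one {δ u : ℝ} (hδ : 0 ≤ δ) (hu : 0 < u) (h : u ≤ 1) : bump δ u = u ^ δ :=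
  min_eq_left (Real.rpow_le_rpow_of_exponent_ge hu h (by linarith))

lemma bump_of_one_le {δ u : ℝ} (hδ : 0 ≤ δ) (h : 1 ≤ u) : bump δ u = u ^ (-δ) :=
  min_eq_right (Real.rpow_le_rpow_of_exponent_le h (by linarith))

/-- The doubling factor of the volume is absorbed by the Gaussian, and for `u ≤ 1` the reverse
doubling leaves the gain `u^δ`. -/
lemma exists_rpow_mul_exp_le_bump {δ N c : ℝ} (hδ : 0 ≤ δ) (hN : 0 ≤ N) (hc : 0 < c) :
    ∃ C > 0, ∀ u > 0, (u ≤ 1 → u ^ δ * Real.exp (-(c * u ^ 2)) ≤ C * (bump δ u * (1 + u)⁻¹)) ∧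
      (1 ≤ u → u ^ N * Real.exp (-(c * u ^ 2)) ≤ C * (bump δ u * (1 + u)⁻¹)) := by
  obtain ⟨C, hC, h⟩ := exists_one_add_rpow_mul_exp_neg_le (N + δ + 1) hc
  refine ⟨2 + 2 * C, by positivity, fun u hu => ⟨fun h1 => ?_, fun h1 => ?_⟩⟩
  · rw [bump_of_le_one hδ hu h1]
    have h2 : Real.exp (-(c * u ^ 2)) ≤ 1 := by
      rw [Real.exp_le_one_iff]; have := mul_pos hc (pow_pos hu 2); linarith
    have h3 : (1 : ℝ) ≤ (2 + 2 * C) * (1 + u)⁻¹ := by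
      rw [← div_eq_mul_inv, one_le_div (by positivity)]; linarith
    calc u ^ δ * Real.exp (-(c * u ^ 2)) ≤ u ^ δ * ((2 + 2 * C) * (1 + u)⁻¹) := by
          gcongr; linarith
      _ = _ := by ring
  · rw [bump_of_one_le hδ h1]
    have h2 := h (u ^ 2) (by positivity)
    have h3 : u ≤ 1 + u ^ 2 := by nlinarith
    have h4 : 1 + u ≤ 2 * (1 + u ^ 2) := by nlinarith
    have h5 : u ^ (N + δ) ≤ (1 + u ^ 2) ^ (N + δ) :=
      Real.rpow_le_rpow hu.le h3 (by linarith)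
    rw [Real.rpow_add_one (by positivity)] at h2
    have h6 : u ^ (N + δ) * (1 + u) * Real.exp (-(c * u ^ 2)) ≤ 2 * C := by
      calc u ^ (N + δ) * (1 + u) * Real.exp (-(c * u ^ 2))
          ≤ (1 + u ^ 2) ^ (N + δ) * (2 * (1 + u ^ 2)) * Real.exp (-(c * u ^ 2)) := by gcongr
        _ = 2 * ((1 + u ^ 2) ^ (N + δ) * (1 + u ^ 2) * Real.exp (-(c * u ^ 2))) := by ring
        _ ≤ 2 * C := by gcongr
    have h7 : u ^ (N + δ) = u ^ N * u ^ δ := Real.rpow_add hu _ _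
    have hp : 0 < u ^ δ := by positivity
    rw [Real.rpow_neg hu.le, ← mul_inv, ← div_eq_mul_inv, le_div_iff₀ (by positivity)]
    rw [h7] at h6
    linarith

/-- The Gaussian majorant at a pair of points `(z, w)` near `(x, y)`, in terms of the volume at `x`
and of `r ≈ |x - y|` only. -/
lemma exists_gaussMaj_le (hd : 1 ≤ d) {α : Fin d → ℝ} (hα : ∀ i, -1 < α i) (N : ℕ) :
    ∃ C > 0, ∀ t > 0, ∀ x z w : Fin d → ℝ, (∀ i, 0 < x i) → (∀ i, 0 < z i) →
      ∀ r > 0, (∀ i, |x i - z i| ≤ r / 2) → (r / 2) ^ 2 ≤ ∑ i, (z i - w i) ^ 2 →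
      gaussMaj α N t z w ≤ C * ((√(min t 1) ^ N)⁻¹ * Real.exp (-(t * (2 * d + 2 * ∑ i, α i))) *
        (bump (lowerDim α) (r / √(min t 1)) * (1 + r / √(min t 1))⁻¹) * (vol α x r)⁻¹) := by
  obtain ⟨C1, hC1, h1⟩ := exists_rpow_mul_exp_le_bump (c := 1 / 1280) (lowerDim_pos hd hα).le
    (upperDim_nonneg α) (by norm_num)
  obtain ⟨C2, hC2, h2⟩ := exists_vol_le_of_near α
  refine ⟨C1 * C2, by positivity, fun t ht x z w hx hz r hr hxz hzw => ?_⟩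
  have hτ0 : 0 < min t 1 := lt_min ht one_pos
  have hρ2 : √(min t 1) ^ 2 = min t 1 := Real.sq_sqrt hτ0.le
  unfold gaussMaj
  set τ := min t 1
  set ρ := √τ
  have hρ0 : 0 < ρ := Real.sqrt_pos.2 hτ0
  set u := r / ρ with hu
  have hu0 : 0 < u := by positivity
  have hvzr := vol_pos (α := α) hz hr
  have hvzρ := vol_pos (α := α) hz hρ0
  have hvxr := vol_pos (α := α) hx hr
  have e1 : Real.exp (-(1 / 320 * ((∑ i, (z i - w i) ^ 2) / τ))) ≤
      Real.exp (-(1 / 1280 * u ^ 2)) := by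
    rw [Real.exp_le_exp, neg_le_neg_iff]
    have e2 : 1 / 1280 * u ^ 2 = 1 / 320 * ((r / 2) ^ 2 / τ) := by
      rw [hu, div_pow, hρ2]; ring
    rw [e2]; gcongr
  have e3 : (vol α z r)⁻¹ ≤ C2 * (vol α x r)⁻¹ := by
    have := h2 x z hx hz r hr hxz
    rw [← div_eq_mul_inv, inv_eq_one_div, div_le_div_iff₀ hvzr hvxr]
    linarith
  have e4 : (vol α z ρ)⁻¹ * Real.exp (-(1 / 1280 * u ^ 2)) ≤
      C1 * (bump (lowerDim α) u * (1 + u)⁻¹) * (vol α z r)⁻¹ := by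
    have key : ∀ e : ℝ, vol α z r ≤ u ^ e * vol α z ρ →
        u ^ e * Real.exp (-(1 / 1280 * u ^ 2)) ≤ C1 * (bump (lowerDim α) u * (1 + u)⁻¹) →
        (vol α z ρ)⁻¹ * Real.exp (-(1 / 1280 * u ^ 2)) ≤
          C1 * (bump (lowerDim α) u * (1 + u)⁻¹) * (vol α z r)⁻¹ := by
      intro e he1 he2
      have : (vol α z ρ)⁻¹ ≤ u ^ e * (vol α z r)⁻¹ := by
        rw [← div_eq_mul_inv, inv_eq_one_div, div_le_div_iff₀ hvzρ hvzr]
        linarith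
      calc _ ≤ u ^ e * (vol α z r)⁻¹ * Real.exp (-(1 / 1280 * u ^ 2)) := by gcongr
        _ = (u ^ e * Real.exp (-(1 / 1280 * u ^ 2))) * (vol α z r)⁻¹ := by ring
        _ ≤ _ := by gcongr
    rcases le_total u 1 with h | h
    · exact key _ (vol_le_of_le hz hr ((div_le_one hρ0).1 h)) ((h1 u hu0).1 h)
    · exact key _ (vol_le_of_ge hz hρ0 ((one_le_div hρ0).1 h)) ((h1 u hu0).2 h)
  have hb := bump_nonneg (lowerDim α) hu0
  calc _ ≤ (ρ ^ N)⁻¹ * Real.exp (-(t * (2 * d + 2 * ∑ i, α i))) * (vol α z ρ)⁻¹ *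
        Real.exp (-(1 / 1280 * u ^ 2)) := by gcongr
    _ = (ρ ^ N)⁻¹ * Real.exp (-(t * (2 * d + 2 * ∑ i, α i))) * ((vol α z ρ)⁻¹ *
        Real.exp (-(1 / 1280 * u ^ 2))) := by ring
    _ ≤ (ρ ^ N)⁻¹ * Real.exp (-(t * (2 * d + 2 * ∑ i, α i))) *
        (C1 * (bump (lowerDim α) u * (1 + u)⁻¹) * (C2 * (vol α x r)⁻¹)) := by
        refine mul_le_mul_of_nonneg_left (e4.trans ?_) (by positivity)
        gcongr
    _ = _ := by ring

/-- The time profile of the kernel `∂_t^m δ_x^n G_t^α(x, y)`, with `a = m + |n| / 2` and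
`r = |x - y|`. -/
noncomputable def timeProfile (α : Fin d → ℝ) (a r t : ℝ) : ℝ :=
  Real.exp (-t * (2 * d + 2 * ∑ i, α i)) * (min t 1) ^ (-a) *
    bump (lowerDim α) (r / √(min t 1))

lemma timeProfile_nonneg (α : Fin d → ℝ) (a : ℝ) {r t : ℝ} (hr : 0 < r) (ht : 0 < t) :
    0 ≤ timeProfile α a r t := by
  have hτ0 : 0 < min t 1 := lt_min ht one_pos
  have := bump_nonneg (lowerDim α) (by positivity : 0 < r / √(min t 1))
  unfold timeProfile
  positivity

/-- Pointwise standard estimates for a family `f x y t`, with a separate time profile. -/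
structure HasTimeProfile (α : Fin d → ℝ) (a : ℝ)
    (f : EuclideanSpace ℝ (Fin d) → EuclideanSpace ℝ (Fin d) → ℝ → ℝ) : Prop where
  continuousOn : ∀ x ∈ orthant d, ∀ y ∈ orthant d, ContinuousOn (f x y) (Set.Ioi 0)
  growth : ∃ C > 0, ∀ x ∈ orthant d, ∀ y ∈ orthant d, x ≠ y → ∀ t > 0,
    |f x y t| ≤ C * (1 / muBall α x ‖x - y‖) * timeProfile α a ‖x - y‖ t
  smooth : ∃ C > 0, ∀ x ∈ orthant d, ∀ y ∈ orthant d, ∀ x' ∈ orthant d, ∀ y' ∈ orthant d,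
    2 * (‖x - x'‖ + ‖y - y'‖) < ‖x - y‖ → ∀ t > 0,
    |f x y t - f x' y' t| ≤ C * ((‖x - x'‖ + ‖y - y'‖) / ‖x - y‖ * (1 / muBall α x ‖x - y‖)) *
      timeProfile α a ‖x - y‖ t

lemma sum_sub_sq_eq (x y : EuclideanSpace ℝ (Fin d)) : ∑ i, (x i - y i) ^ 2 = ‖x - y‖ ^ 2 := by
  rw [EuclideanSpace.norm_sq_eq]
  simp

lemma inv_sqrt_pow_mul_inv_pow {τ : ℝ} (hτ : 0 < τ) (N m : ℕ) :
    (√τ ^ N)⁻¹ * (τ ^ m)⁻¹ = τ ^ (-((m : ℝ) + (N : ℝ) / 2)) := by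
  rw [Real.sqrt_eq_rpow, ← Real.rpow_natCast, ← Real.rpow_natCast, ← Real.rpow_mul hτ.le, ← mul_inv,
    ← Real.rpow_add hτ, ← Real.rpow_neg hτ.le]
  ring_nf

/-- The factor `(1 + r / √(min t 1))⁻¹` kept in `exists_gaussMaj_le` is dropped for the growth
estimate, and turns `|x - x'| / √(min t 1)` into `|x - x'| / r` for the smoothness estimates. -/
theorem hasTimeProfile_mixedHeat (hd : 1 ≤ d) {α : Fin d → ℝ} (hα : ∀ i, -1 < α i)
    (n : Fin d → ℕ) (m : ℕ) :
    HasTimeProfile α (m + ((∑ i, n i : ℕ) : ℝ) / 2) (fun x y t => mixedHeat α n m t x y) := by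
  obtain ⟨C0, hC0, h0⟩ := exists_gaussMaj_le hd hα (∑ i, n i)
  obtain ⟨C1, hC1, h1⟩ := exists_inv_vol_le hα
  refine ⟨fun x hx y hy => continuousOn_mixedHeat hα n m hx hy, ?_, ?_⟩
  · obtain ⟨C, hC, h⟩ := exists_norm_mixedC_le hα n m
    refine ⟨C * C0 * C1, by positivity, fun x hx y hy hxy t ht => ?_⟩
    have hr : 0 < ‖x - y‖ := norm_pos_iff.2 (sub_ne_zero.2 hxy)
    have hτ0 : 0 < min t 1 := lt_min ht one_pos
    have h2 := h t ht (fun i => x i) (fun i => y i) hx hy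
    rw [← ofReal_mixedHeat hα n m ht hx hy, Complex.norm_real, Real.norm_eq_abs] at h2
    have h3 := h0 t ht (fun i => x i) (fun i => x i) (fun i => y i) hx hx ‖x - y‖ hr
      (fun i => by rw [sub_self, abs_zero]; positivity)
      (by rw [sum_sub_sq_eq]; gcongr; linarith)
    have h4 := h1 x hx _ hr
    have hv := (inv_pos.2 (vol_pos (α := α) hx hr)).le
    have hb := bump_nonneg (lowerDim α) (by positivity : 0 < ‖x - y‖ / √(min t 1))
    have h5 : (1 + ‖x - y‖ / √(min t 1))⁻¹ ≤ 1 :=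
      inv_le_one_of_one_le₀ (le_add_of_nonneg_right (by positivity))
    have h6 := inv_sqrt_pow_mul_inv_pow hτ0 (∑ i, n i) m
    unfold timeProfile
    rw [← h6, neg_mul]
    calc _ ≤ _ := h2
      _ ≤ C * ((min t 1 ^ m)⁻¹ * (C0 * ((√(min t 1) ^ (∑ i, n i))⁻¹ *
          Real.exp (-(t * (2 * d + 2 * ∑ i, α i))) *
          (bump (lowerDim α) (‖x - y‖ / √(min t 1)) * 1) *
          (C1 * (1 / muBall α x ‖x - y‖))))) := by
        gcongr
        exact h3.trans (by gcongr)
      _ = _ := by ring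
  · obtain ⟨C, hC, h⟩ := exists_norm_mixedC_sub_le hα n m
    refine ⟨C * C0 * C1, by positivity, fun x hx y hy x' hx' y' hy' hr2 t ht => ?_⟩
    have hL0 : 0 ≤ ‖x - x'‖ + ‖y - y'‖ := by positivity
    rcases eq_or_lt_of_le hL0 with hL | hL
    · have hx0 : ‖x - x'‖ = 0 := by linarith [norm_nonneg (x - x'), norm_nonneg (y - y')]
      have hy0 : ‖y - y'‖ = 0 := by linarith [norm_nonneg (x - x'), norm_nonneg (y - y')]
      rw [← hL, ← sub_eq_zero.1 (norm_eq_zero.1 hx0), ← sub_eq_zero.1 (norm_eq_zero.1 hy0)]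
      simp
    have hr : 0 < ‖x - y‖ := by linarith
    have hτ0 : 0 < min t 1 := lt_min ht one_pos
    have hρ0 : 0 < √(min t 1) := Real.sqrt_pos.2 hτ0
    have hxL : ∀ i, |x' i - x i| ≤ ‖x - x'‖ := fun i => by
      have := abs_coord_le_norm (x - x') i
      rw [abs_sub_comm]; simpa using this
    have hyL : ∀ i, |y' i - y i| ≤ ‖y - y'‖ := fun i => by
      have := abs_coord_le_norm (y - y') i
      rw [abs_sub_comm]; simpa using this
    have h2 := h t ht (fun i => x i) (fun i => y i) (fun i => x' i) (fun i => y' i) hx hy hx' hy' _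
      hL (fun i => (hxL i).trans (by linarith [norm_nonneg (y - y')]))
      (fun i => (hyL i).trans (by linarith [norm_nonneg (x - x')])) _ (fun s hs0 hs1 =>
        h0 t ht (fun i => x i) _ _ hx (fun i => ?_) ‖x - y‖ hr (fun i => ?_) ?_)
    · rw [← ofReal_mixedHeat hα n m ht hx hy, ← ofReal_mixedHeat hα n m ht hx' hy',
        ← Complex.ofReal_sub, Complex.norm_real, Real.norm_eq_abs, abs_sub_comm] at h2
      have h4 := h1 x hx _ hr
      have hv := (inv_pos.2 (vol_pos (α := α) hx hr)).le
      have hb := bump_nonneg (lowerDim α) (by positivity : 0 < ‖x - y‖ / √(min t 1))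
      have h5 : (1 + ‖x - y‖ / √(min t 1))⁻¹ ≤ √(min t 1) / ‖x - y‖ := by
        exact (inv_anti₀ (div_pos hr hρ0) (le_add_of_nonneg_left zero_le_one)).trans_eq
          (inv_div _ _)
      have h6 := inv_sqrt_pow_mul_inv_pow hτ0 (∑ i, n i) m
      unfold timeProfile
      rw [← h6, neg_mul]
      calc _ ≤ _ := h2
        _ ≤ C * ((min t 1 ^ m)⁻¹ * ((‖x - x'‖ + ‖y - y'‖) / √(min t 1) *
            (C0 * ((√(min t 1) ^ (∑ i, n i))⁻¹ *
            Real.exp (-(t * (2 * d + 2 * ∑ i, α i))) *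
            (bump (lowerDim α) (‖x - y‖ / √(min t 1)) * (√(min t 1) / ‖x - y‖)) *
            (C1 * (1 / muBall α x ‖x - y‖)))))) := by gcongr
        _ = _ := by field_simp
    · have h7 : x i + s * (x' i - x i) = (1 - s) * x i + s * x' i := by ring
      rw [h7]
      rcases eq_or_lt_of_le hs1 with h8 | h8
      · rw [h8]; simpa using hx' i
      · have := mul_pos (sub_pos.2 h8) (hx i)
        have := mul_nonneg hs0 (hx' i).le
        linarith
    · have h7 : |x i - (x i + s * (x' i - x i))| = s * |x' i - x i| := by
        rw [show x i - (x i + s * (x' i - x i)) = -(s * (x' i - x i)) by ring, abs_neg, abs_mul,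
          abs_of_nonneg hs0]
      rw [h7]
      have := mul_le_of_le_one_left (abs_nonneg (x' i - x i)) hs1
      have := hxL i
      have := norm_nonneg (y - y')
      linarith
    · set z := (x - y) - s • ((x - x') - (y - y')) with hz
      have h7 : ∑ i, (x i + s * (x' i - x i) - (y i + s * (y' i - y i))) ^ 2 = ‖z‖ ^ 2 := by
        rw [EuclideanSpace.norm_sq_eq]
        refine Finset.sum_congr rfl fun i _ => ?_
        rw [Real.norm_eq_abs, sq_abs, hz]
        simp
        ring
      have h8 : ‖s • ((x - x') - (y - y'))‖ ≤ ‖x - x'‖ + ‖y - y'‖ := by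
        rw [norm_smul, Real.norm_of_nonneg hs0]
        exact (mul_le_of_le_one_left (norm_nonneg _) hs1).trans (norm_sub_le _ _)
      have h9 := norm_sub_norm_le (x - y) (s • ((x - x') - (y - y')))
      rw [← hz] at h9
      rw [h7]
      gcongr
      linarith

/-! ### Kernels obtained from a time profile -/

lemma rate_pos (hd : 1 ≤ d) {α : Fin d → ℝ} (hα : ∀ i, -1 < α i) :
    0 < 2 * (d : ℝ) + 2 * ∑ i, α i := by
  have h : ∑ i : Fin d, (-1 : ℝ) < ∑ i, α i :=
    Finset.sum_lt_sum_of_nonempty ⟨⟨0, hd⟩, Finset.mem_univ _⟩ fun i _ => hα i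
  simp only [Finset.sum_const, Finset.card_univ, Fintype.card_fin, nsmul_eq_mul] at h
  linarith

lemma bump_div_sqrt_mul_inv_eq {δ r t : ℝ} (hδ : 0 ≤ δ) (hr : 0 < r) (ht : 0 < t) :
    (t ≤ r ^ 2 → bump δ (r / √t) * t ^ (-1 : ℝ) = r ^ (-δ) * t ^ (δ / 2 - 1)) ∧
    (r ^ 2 ≤ t → bump δ (r / √t) * t ^ (-1 : ℝ) = r ^ δ * t ^ (-(δ / 2) - 1)) := by
  have hs : 0 < √t := Real.sqrt_pos.2 ht
  constructor
  · intro h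
    have h1 : √t ≤ r := (Real.sqrt_le_left hr.le).2 h
    rw [bump_of_one_le hδ ((one_le_div hs).2 h1), Real.div_rpow hr.le hs.le, Real.sqrt_eq_rpow,
      ← Real.rpow_mul ht.le, div_eq_mul_inv, ← Real.rpow_neg ht.le, mul_assoc, ← Real.rpow_add ht]
    ring_nf
  · intro h
    have h1 : r ≤ √t := (Real.le_sqrt hr.le ht.le).2 h
    rw [bump_of_le_one hδ (by positivity) ((div_le_one hs).2 h1), Real.div_rpow hr.le hs.le,
      Real.sqrt_eq_rpow, ← Real.rpow_mul ht.le, div_eq_mul_inv, ← Real.rpow_neg ht.le, mul_assoc,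
      ← Real.rpow_add ht]
    ring_nf

lemma lintegral_Ioi_rpow {c e : ℝ} (he : e < -1) (hc : 0 < c) :
    ∫⁻ t in Set.Ioi c, ENNReal.ofReal (t ^ e) = ENNReal.ofReal (-c ^ (e + 1) / (e + 1)) := by
  rw [← integral_Ioi_rpow_of_lt he hc,
    ofReal_integral_eq_lintegral_ofReal (integrableOn_Ioi_rpow_of_lt he hc)]
  refine (ae_restrict_iff' measurableSet_Ioi).2 (Filter.Eventually.of_forall fun t ht => ?_)
  exact Real.rpow_nonneg (hc.trans ht).le _

lemma lintegral_Ioc_rpow {c e : ℝ} (he : -1 < e) (hc : 0 < c) :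
    ∫⁻ t in Set.Ioc 0 c, ENNReal.ofReal (t ^ e) = ENNReal.ofReal (c ^ (e + 1) / (e + 1)) := by
  have h := ofReal_integral_eq_lintegral_ofReal (integrableOn_rpow_Ioc he hc)
    ((ae_restrict_iff' measurableSet_Ioc).2 (Filter.Eventually.of_forall fun t ht =>
      Real.rpow_nonneg ht.1.le _))
  rw [← h, ← intervalIntegral.integral_of_le hc.le, integral_rpow (Or.inl he),
    Real.zero_rpow (by linarith), sub_zero]

/-- The time profile is integrable, uniformly in `r`, against the measure that balances its
singularity: the change of variables `u = r / √t` turns `dt / t` into a multiple of `du / u`. -/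
lemma exists_lintegral_timeProfile_le (hd : 1 ≤ d) {α : Fin d → ℝ} (hα : ∀ i, -1 < α i) (b : ℝ) :
    ∃ M > 0, ∀ r > 0, ∫⁻ t, ENNReal.ofReal (timeProfile α b r t * t ^ (b - 1)) ∂timeMeasure ≤
      ENNReal.ofReal M := by
  have hβ := rate_pos hd hα
  set β := 2 * (d : ℝ) + 2 * ∑ i, α i with hβdef
  set δ := lowerDim α with hδdef
  have hδ : 0 < δ := lowerDim_pos hd hα
  obtain ⟨C, hC, hCb⟩ := exists_one_add_rpow_mul_exp_neg_le |b + 1| hβ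
  refine ⟨2 / δ + 2 / δ + C, by positivity, fun r hr => ?_⟩
  have hr2 : 0 < r ^ 2 := by positivity
  set F1 : ℝ → ENNReal := (Set.Ioc 0 (r ^ 2)).indicator
    (fun t => ENNReal.ofReal (r ^ (-δ)) * ENNReal.ofReal (t ^ (δ / 2 - 1))) with hF1
  set F2 : ℝ → ENNReal := (Set.Ioi (r ^ 2)).indicator
    (fun t => ENNReal.ofReal (r ^ δ) * ENNReal.ofReal (t ^ (-(δ / 2) - 1))) with hF2
  set F3 : ℝ → ENNReal := (Set.Ioi (1 : ℝ)).indicator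
    (fun t => ENNReal.ofReal C * ENNReal.ofReal (t ^ (-2 : ℝ))) with hF3
  have hm1 : Measurable F1 := Measurable.indicator (by fun_prop) measurableSet_Ioc
  have hm2 : Measurable F2 := Measurable.indicator (by fun_prop) measurableSet_Ioi
  have hm3 : Measurable F3 := Measurable.indicator (by fun_prop) measurableSet_Ioi
  have i1 : ∫⁻ t, F1 t = ENNReal.ofReal (2 / δ) := by
    rw [hF1, lintegral_indicator measurableSet_Ioc, lintegral_const_mul _ (by fun_prop),
      lintegral_Ioc_rpow (by linarith) hr2, ← ENNReal.ofReal_mul (by positivity)]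
    congr 1
    rw [← Real.rpow_natCast, ← Real.rpow_mul hr.le, sub_add_cancel, Real.rpow_neg hr.le,
      show ((2 : ℕ) : ℝ) * (δ / 2) = δ by push_cast; ring]
    have := Real.rpow_pos_of_pos hr δ
    field_simp
  have i2 : ∫⁻ t, F2 t = ENNReal.ofReal (2 / δ) := by
    rw [hF2, lintegral_indicator measurableSet_Ioi, lintegral_const_mul _ (by fun_prop),
      lintegral_Ioi_rpow (by linarith) hr2, ← ENNReal.ofReal_mul (by positivity)]
    congr 1
    rw [← Real.rpow_natCast, ← Real.rpow_mul hr.le, sub_add_cancel,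
      show ((2 : ℕ) : ℝ) * (-(δ / 2)) = -δ by push_cast; ring, Real.rpow_neg hr.le]
    have := Real.rpow_pos_of_pos hr δ
    field_simp
  have i3 : ∫⁻ t, F3 t = ENNReal.ofReal C := by
    rw [hF3, lintegral_indicator measurableSet_Ioi, lintegral_const_mul _ (by fun_prop),
      lintegral_Ioi_rpow (by norm_num) one_pos, ← ENNReal.ofReal_mul (by positivity)]
    congr 1
    norm_num
  have hpt : ∀ t ∈ Set.Ioi (0 : ℝ),
      ENNReal.ofReal (timeProfile α b r t * t ^ (b - 1)) ≤ F1 t + F2 t + F3 t := by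
    intro t ht
    have ht0 : 0 < t := ht
    rcases le_or_gt t 1 with h1 | h1
    · have hle : timeProfile α b r t * t ^ (b - 1) ≤ bump δ (r / √t) * t ^ (-1 : ℝ) := by
        unfold timeProfile
        rw [min_eq_left h1]
        have hb := bump_nonneg δ (by positivity : 0 < r / √t)
        have hE : Real.exp (-t * β) ≤ 1 := by
          rw [Real.exp_le_one_iff]; have := mul_pos ht0 hβ; linarith
        calc Real.exp (-t * β) * t ^ (-b) * bump δ (r / √t) * t ^ (b - 1)
            ≤ 1 * t ^ (-b) * bump δ (r / √t) * t ^ (b - 1) := by gcongr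
          _ = bump δ (r / √t) * (t ^ (-b) * t ^ (b - 1)) := by ring
          _ = _ := by rw [← Real.rpow_add ht0]; ring_nf
      refine (ENNReal.ofReal_le_ofReal hle).trans ?_
      refine le_trans ?_ le_self_add
      rcases le_or_gt t (r ^ 2) with h2 | h2
      · rw [(bump_div_sqrt_mul_inv_eq hδ.le hr ht0).1 h2, ENNReal.ofReal_mul (by positivity)]
        have : t ∈ Set.Ioc 0 (r ^ 2) := ⟨ht0, h2⟩
        rw [hF1, Set.indicator_of_mem this]
        exact le_self_add
      · rw [(bump_div_sqrt_mul_inv_eq hδ.le hr ht0).2 h2.le, ENNReal.ofReal_mul (by positivity)]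
        have : t ∈ Set.Ioi (r ^ 2) := h2
        rw [hF2, Set.indicator_of_mem this]
        exact le_add_self
    · have hle : timeProfile α b r t * t ^ (b - 1) ≤ C * t ^ (-2 : ℝ) := by
        unfold timeProfile
        rw [min_eq_right h1.le, Real.one_rpow, mul_one]
        have hb := bump_le_one hδ.le (by positivity : 0 < r / √1)
        have h3 : t ^ (b + 1) * Real.exp (-(β * t)) ≤ C := by
          refine le_trans ?_ (hCb t ht0.le)
          gcongr
          calc t ^ (b + 1) ≤ t ^ |b + 1| :=
                Real.rpow_le_rpow_of_exponent_le h1.le (le_abs_self _)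
            _ ≤ (1 + t) ^ |b + 1| :=
                Real.rpow_le_rpow ht0.le (by linarith) (abs_nonneg _)
        calc Real.exp (-t * β) * bump δ (r / √1) * t ^ (b - 1)
            ≤ Real.exp (-t * β) * 1 * t ^ (b - 1) := by gcongr
          _ = (t ^ (b + 1) * Real.exp (-(β * t))) * t ^ (-2 : ℝ) := by
              rw [show b - 1 = (b + 1) + (-2) by ring, Real.rpow_add ht0]; ring_nf
          _ ≤ _ := by gcongr
      refine (ENNReal.ofReal_le_ofReal hle).trans ?_
      rw [ENNReal.ofReal_mul hC.le]
      have : t ∈ Set.Ioi (1 : ℝ) := h1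
      rw [hF3, Set.indicator_of_mem this]
      exact le_add_self
  calc ∫⁻ t, ENNReal.ofReal (timeProfile α b r t * t ^ (b - 1)) ∂timeMeasure
      ≤ ∫⁻ t in Set.Ioi (0 : ℝ), (F1 t + F2 t + F3 t) :=
        setLIntegral_mono ((hm1.add hm2).add hm3) hpt
    _ ≤ ∫⁻ t, (F1 t + F2 t + F3 t) := setLIntegral_le_lintegral _ _
    _ = ENNReal.ofReal (2 / δ + 2 / δ + C) := by
      rw [lintegral_add_right _ hm3, lintegral_add_right _ hm2, i1, i2, i3,
        ← ENNReal.ofReal_add (by positivity) (by positivity),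
        ← ENNReal.ofReal_add (by positivity) (by positivity)]

/-- If the size of `K x y` and of its increments is governed by pointwise bounds on `f` relative to
the time profile, then `K` inherits the standard estimates from `f`. -/
lemma HasTimeProfile.isStandardKernel {α : Fin d → ℝ} {a : ℝ}
    {f : EuclideanSpace ℝ (Fin d) → EuclideanSpace ℝ (Fin d) → ℝ → ℝ} (hf : HasTimeProfile α a f)
    {B : Type*} [NormedAddCommGroup B]
    {K : EuclideanSpace ℝ (Fin d) → EuclideanSpace ℝ (Fin d) → B} {M : ℝ} (hM : 0 < M)
    (h1 : ∀ x ∈ orthant d, ∀ y ∈ orthant d, x ≠ y → ∀ c, 0 ≤ c →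
      (∀ t > 0, |f x y t| ≤ c * timeProfile α a ‖x - y‖ t) → ‖K x y‖ ≤ c * M)
    (h2 : ∀ x ∈ orthant d, ∀ y ∈ orthant d, ∀ x' ∈ orthant d, ∀ y' ∈ orthant d, x ≠ y → x' ≠ y' →
      ∀ c, 0 ≤ c → (∀ t > 0, |f x y t - f x' y' t| ≤ c * timeProfile α a ‖x - y‖ t) →
      ‖K x y - K x' y'‖ ≤ c * M) : IsStandardKernel α K := by
  have hmu : ∀ x r, 0 ≤ 1 / muBall α x r := fun x r => by
    unfold muBall; positivity
  obtain ⟨C1, hC1, hg⟩ := hf.growth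
  obtain ⟨C2, hC2, hs⟩ := hf.smooth
  have key : ∀ x ∈ orthant d, ∀ y ∈ orthant d, ∀ x' ∈ orthant d, ∀ y' ∈ orthant d,
      2 * (‖x - x'‖ + ‖y - y'‖) < ‖x - y‖ → ‖K x y - K x' y'‖ ≤
        C2 * M * ((‖x - x'‖ + ‖y - y'‖) / ‖x - y‖ * (1 / muBall α x ‖x - y‖)) := by
    intro x hx y hy x' hx' y' hy' hr
    have hne : x ≠ y := by
      rintro rfl
      have : ‖x - x‖ = 0 := by simp
      linarith [norm_nonneg (x - x'), norm_nonneg (x - y')]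
    have hne' : x' ≠ y' := by
      rintro rfl
      have h3 := norm_sub_le (x - x') (y - x')
      rw [sub_sub_sub_cancel_right] at h3
      linarith [norm_nonneg (x - x'), norm_nonneg (y - x')]
    have hnn : 0 ≤ (‖x - x'‖ + ‖y - y'‖) / ‖x - y‖ * (1 / muBall α x ‖x - y‖) :=
      mul_nonneg (by positivity) (hmu _ _)
    refine (h2 x hx y hy x' hx' y' hy' hne hne' _ (mul_nonneg hC2.le hnn)
      (hs x hx y hy x' hx' y' hy' hr)).trans_eq ?_
    ring
  refine ⟨⟨C1 * M, by positivity, fun x hx y hy hxy => ?_⟩,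
    ⟨C2 * M, by positivity, fun x hx x' hx' y hy hr => ?_⟩,
    ⟨C2 * M, by positivity, fun x hx y hy y' hy' hr => ?_⟩⟩
  · refine (h1 x hx y hy hxy _ (mul_nonneg hC1.le (hmu _ _)) (hg x hx y hy hxy)).trans_eq ?_
    ring
  · simpa using key x hx y hy x' hx' y hy (by simpa using hr)
  · simpa using key x hx y hy x hx y' hy' (by simpa using hr)

lemma ae_pos_of_measure_Iic {μ : Measure ℝ} (hμ : μ (Set.Iic 0) = 0) : ∀ᵐ t ∂μ, 0 < t := by
  rw [ae_iff]
  simpa [Set.Iic] using hμ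

lemma aestronglyMeasurable_of_continuousOn_Ioi {μ : Measure ℝ} (hμ : μ (Set.Iic 0) = 0) {g : ℝ → ℝ}
    (hg : ContinuousOn g (Set.Ioi 0)) : AEStronglyMeasurable g μ := by
  rw [← Measure.restrict_eq_self_of_ae_mem (s := Set.Ioi 0) (ae_pos_of_measure_Iic hμ)]
  exact hg.aestronglyMeasurable measurableSet_Ioi

/-- Integration in time against a density balancing the profile produces a standard scalar
kernel. -/
lemma HasTimeProfile.integral {α : Fin d → ℝ} {a : ℝ}
    {f : EuclideanSpace ℝ (Fin d) → EuclideanSpace ℝ (Fin d) → ℝ → ℝ} (hf : HasTimeProfile α a f)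
    {μ : Measure ℝ} (hμ : μ (Set.Iic 0) = 0) {φ : ℝ → ℂ} (hφ : AEStronglyMeasurable φ μ) {M : ℝ}
    (hM : 0 < M)
    (hint : ∀ r > 0, ∫⁻ t, ENNReal.ofReal (timeProfile α a r t * ‖φ t‖) ∂μ ≤ ENNReal.ofReal M) :
    (∀ x ∈ orthant d, ∀ y ∈ orthant d, x ≠ y →
      Integrable (fun t => (f x y t : ℂ) * φ t) μ) ∧
    IsStandardKernel α (fun x y => ∫ t, (f x y t : ℂ) * φ t ∂μ) := by
  have key : ∀ g : ℝ → ℝ, ContinuousOn g (Set.Ioi 0) → ∀ r > 0, ∀ c, 0 ≤ c →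
      (∀ t > 0, |g t| ≤ c * timeProfile α a r t) →
      Integrable (fun t => (g t : ℂ) * φ t) μ ∧ ‖∫ t, (g t : ℂ) * φ t ∂μ‖ ≤ c * M := by
    intro g hg r hr c hc hb
    have h1 : ∫⁻ t, ‖(g t : ℂ) * φ t‖ₑ ∂μ ≤ ENNReal.ofReal (c * M) := by
      calc ∫⁻ t, ‖(g t : ℂ) * φ t‖ₑ ∂μ
          ≤ ∫⁻ t, ENNReal.ofReal c * ENNReal.ofReal (timeProfile α a r t * ‖φ t‖) ∂μ := by
            refine lintegral_mono_ae ?_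
            filter_upwards [ae_pos_of_measure_Iic hμ] with t ht
            rw [← ENNReal.ofReal_mul hc, ← ofReal_norm, norm_mul, Complex.norm_real,
              Real.norm_eq_abs, ← mul_assoc]
            exact ENNReal.ofReal_le_ofReal
              (mul_le_mul_of_nonneg_right (hb t ht) (norm_nonneg _))
        _ = ENNReal.ofReal c * ∫⁻ t, ENNReal.ofReal (timeProfile α a r t * ‖φ t‖) ∂μ :=
            lintegral_const_mul' _ _ ENNReal.ofReal_ne_top
        _ ≤ ENNReal.ofReal c * ENNReal.ofReal M := by gcongr; exact hint r hr
        _ = _ := (ENNReal.ofReal_mul hc).symm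
    have hm : AEStronglyMeasurable (fun t => (g t : ℂ) * φ t) μ :=
      (Complex.continuous_ofReal.comp_aestronglyMeasurable
        (aestronglyMeasurable_of_continuousOn_Ioi hμ hg)).mul hφ
    refine ⟨⟨hm, h1.trans_lt ENNReal.ofReal_lt_top⟩, ?_⟩
    refine (norm_integral_le_lintegral_norm _).trans ?_
    refine ENNReal.toReal_le_of_le_ofReal (by positivity) ?_
    simpa only [ofReal_norm] using h1
  obtain ⟨C1, hC1, hg⟩ := hf.growth
  have hmu : ∀ x r, 0 ≤ 1 / muBall α x r := fun x r => by
    unfold muBall; positivity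
  have hI : ∀ x ∈ orthant d, ∀ y ∈ orthant d, x ≠ y →
      Integrable (fun t => (f x y t : ℂ) * φ t) μ := fun x hx y hy hxy =>
    (key _ (hf.continuousOn x hx y hy) _ (norm_pos_iff.2 (sub_ne_zero.2 hxy)) _
      (mul_nonneg hC1.le (hmu _ _)) (hg x hx y hy hxy)).1
  refine ⟨hI, hf.isStandardKernel hM (fun x hx y hy hxy c hc hb => ?_)
    (fun x hx y hy x' hx' y' hy' hxy hxy' c hc hb => ?_)⟩
  · exact (key _ (hf.continuousOn x hx y hy) _ (norm_pos_iff.2 (sub_ne_zero.2 hxy)) c hc hb).2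
  · rw [← integral_sub (hI x hx y hy hxy) (hI x' hx' y' hy' hxy')]
    have h3 := (key _ ((hf.continuousOn x hx y hy).sub (hf.continuousOn x' hx' y' hy')) _
      (norm_pos_iff.2 (sub_ne_zero.2 hxy)) c hc hb).2
    refine le_trans (le_of_eq ?_) h3
    congr 2
    funext t
    rw [Pi.sub_apply, Complex.ofReal_sub]
    ring

/-- A family whose time profile is bounded in `L^p` is a standard `L^p`-valued kernel. -/
lemma HasTimeProfile.isStandardLpKernel {α : Fin d → ℝ} {a : ℝ}
    {f : EuclideanSpace ℝ (Fin d) → EuclideanSpace ℝ (Fin d) → ℝ → ℝ} (hf : HasTimeProfile α a f)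
    {μ : Measure ℝ} (hμ : μ (Set.Iic 0) = 0) {p : ENNReal} [Fact (1 ≤ p)] {M : ℝ} (hM : 0 < M)
    (hint : ∀ r > 0, eLpNorm (timeProfile α a r) p μ ≤ ENNReal.ofReal M) :
    IsStandardLpKernel α p μ (fun x y t => (f x y t : ℂ)) := by
  have key : ∀ g : ℝ → ℝ, ContinuousOn g (Set.Ioi 0) → ∀ r > 0, ∀ c, 0 ≤ c →
      (∀ t > 0, |g t| ≤ c * timeProfile α a r t) →
      MemLp (fun t => (g t : ℂ)) p μ ∧
        eLpNorm (fun t => (g t : ℂ)) p μ ≤ ENNReal.ofReal (c * M) := by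
    intro g hg r hr c hc hb
    have h1 : eLpNorm (fun t => (g t : ℂ)) p μ ≤ ENNReal.ofReal (c * M) := by
      calc eLpNorm (fun t => (g t : ℂ)) p μ
          ≤ ENNReal.ofReal c * eLpNorm (timeProfile α a r) p μ := by
            refine eLpNorm_le_mul_eLpNorm_of_ae_le_mul ?_ p
            filter_upwards [ae_pos_of_measure_Iic hμ] with t ht
            rw [Complex.norm_real, Real.norm_eq_abs,
              Real.norm_of_nonneg (timeProfile_nonneg α a hr ht)]
            exact hb t ht
        _ ≤ ENNReal.ofReal c * ENNReal.ofReal M := by gcongr; exact hint r hr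
        _ = _ := (ENNReal.ofReal_mul hc).symm
    exact ⟨⟨Complex.continuous_ofReal.comp_aestronglyMeasurable
      (aestronglyMeasurable_of_continuousOn_Ioi hμ hg), h1.trans_lt ENNReal.ofReal_lt_top⟩, h1⟩
  obtain ⟨C1, hC1, hg⟩ := hf.growth
  have hmu : ∀ x r, 0 ≤ 1 / muBall α x r := fun x r => by
    unfold muBall; positivity
  have hI : ∀ x ∈ orthant d, ∀ y ∈ orthant d, x ≠ y → MemLp (fun t => (f x y t : ℂ)) p μ :=
    fun x hx y hy hxy =>
    (key _ (hf.continuousOn x hx y hy) _ (norm_pos_iff.2 (sub_ne_zero.2 hxy)) _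
      (mul_nonneg hC1.le (hmu _ _)) (hg x hx y hy hxy)).1
  classical
  refine ⟨fun x y => if h : MemLp (fun t => (f x y t : ℂ)) p μ then h.toLp _ else 0,
    fun x hx y hy hxy => ?_, hf.isStandardKernel hM (fun x hx y hy hxy c hc hb => ?_)
    (fun x hx y hy x' hx' y' hy' hxy hxy' c hc hb => ?_)⟩
  · beta_reduce
    rw [dif_pos (hI x hx y hy hxy)]
    exact MemLp.coeFn_toLp _
  · rw [dif_pos (hI x hx y hy hxy), Lp.norm_toLp]
    exact ENNReal.toReal_le_of_le_ofReal (by positivity)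
      (key _ (hf.continuousOn x hx y hy) _ (norm_pos_iff.2 (sub_ne_zero.2 hxy)) c hc hb).2
  · rw [dif_pos (hI x hx y hy hxy), dif_pos (hI x' hx' y' hy' hxy'), ← MemLp.toLp_sub,
      Lp.norm_toLp]
    refine ENNReal.toReal_le_of_le_ofReal (by positivity) ?_
    have h3 := (key _ ((hf.continuousOn x hx y hy).sub (hf.continuousOn x' hx' y' hy')) _
      (norm_pos_iff.2 (sub_ne_zero.2 hxy)) c hc hb).2
    refine le_trans (le_of_eq ?_) h3
    congr 1
    funext t
    simp

lemma IsStandardKernel.const_mul {α : Fin d → ℝ}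
    {K : EuclideanSpace ℝ (Fin d) → EuclideanSpace ℝ (Fin d) → ℂ} (hK : IsStandardKernel α K)
    (c : ℂ) : IsStandardKernel α (fun x y => c * K x y) := by
  have hle : ‖c‖ ≤ ‖c‖ + 1 := by linarith
  obtain ⟨⟨C1, hC1, h1⟩, ⟨C2, hC2, h2⟩, ⟨C3, hC3, h3⟩⟩ := hK
  refine ⟨⟨(‖c‖ + 1) * C1, by positivity, fun x hx y hy hxy => ?_⟩,
    ⟨(‖c‖ + 1) * C2, by positivity, fun x hx x' hx' y hy hr => ?_⟩,
    ⟨(‖c‖ + 1) * C3, by positivity, fun x hx y hy y' hy' hr => ?_⟩⟩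
  · rw [norm_mul, mul_assoc]
    exact mul_le_mul hle (h1 x hx y hy hxy) (norm_nonneg _) (by positivity)
  · rw [← mul_sub, norm_mul, mul_assoc]
    exact mul_le_mul hle (h2 x hx x' hx' y hy hr) (norm_nonneg _) (by positivity)
  · rw [← mul_sub, norm_mul, mul_assoc]
    exact mul_le_mul hle (h3 x hx y hy y' hy' hr) (norm_nonneg _) (by positivity)

/-! ### The five families of kernels -/

lemma timeMeasure_Iic : timeMeasure (Set.Iic 0) = 0 := by
  unfold timeMeasure
  rw [Measure.restrict_apply measurableSet_Iic, Set.Iic_inter_Ioi, Set.Ioc_self, measure_empty]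

lemma powerMeasure_Iic (c : ℝ) : powerMeasure c (Set.Iic 0) = 0 :=
  withDensity_absolutelyContinuous _ _ timeMeasure_Iic

lemma timeProfile_zero_le_exp (hd : 1 ≤ d) {α : Fin d → ℝ} (hα : ∀ i, -1 < α i) {r t : ℝ}
    (hr : 0 < r) (ht : 0 < t) :
    timeProfile α 0 r t ≤ Real.exp (-t * (2 * d + 2 * ∑ i, α i)) := by
  have hτ0 : 0 < min t 1 := lt_min ht one_pos
  have hb := bump_le_one (lowerDim_pos hd hα).le (by positivity : 0 < r / √(min t 1))
  unfold timeProfile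
  rw [neg_zero, Real.rpow_zero, mul_one]
  exact mul_le_of_le_one_right (Real.exp_pos _).le hb

/-- Squaring doubles the singular exponent, and the other two factors are at most one. -/
lemma timeProfile_sq_le (hd : 1 ≤ d) {α : Fin d → ℝ} (hα : ∀ i, -1 < α i) (a : ℝ) {r t : ℝ}
    (hr : 0 < r) (ht : 0 < t) : timeProfile α a r t ^ 2 ≤ timeProfile α (2 * a) r t := by
  have hτ0 : 0 < min t 1 := lt_min ht one_pos
  have hu : 0 < r / √(min t 1) := by positivity
  have hb := bump_le_one (lowerDim_pos hd hα).le hu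
  have hb0 := bump_nonneg (lowerDim α) hu
  have hE : Real.exp (-t * (2 * d + 2 * ∑ i, α i)) ≤ 1 := by
    rw [Real.exp_le_one_iff]; have := mul_pos ht (rate_pos hd hα); linarith
  have hp : min t 1 ^ (-(2 * a)) = (min t 1 ^ (-a)) ^ 2 := by
    rw [← Real.rpow_natCast, ← Real.rpow_mul hτ0.le]; congr 1; push_cast; ring
  unfold timeProfile
  rw [hp, mul_pow, mul_pow]
  have h1 := pow_le_of_le_one (Real.exp_pos _).le hE two_ne_zero
  have h2 := pow_le_of_le_one hb0 hb two_ne_zero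
  gcongr

lemma exists_eLpNorm_timeProfile_le (hd : 1 ≤ d) {α : Fin d → ℝ} (hα : ∀ i, -1 < α i) (a : ℝ) :
    ∃ M > 0, ∀ r > 0, eLpNorm (timeProfile α a r) 2 (powerMeasure (2 * a - 1)) ≤
      ENNReal.ofReal M := by
  obtain ⟨M, hM, h⟩ := exists_lintegral_timeProfile_le hd hα (2 * a)
  refine ⟨M ^ (1 / 2 : ℝ), by positivity, fun r hr => ?_⟩
  rw [eLpNorm_eq_lintegral_rpow_enorm_toReal two_ne_zero ENNReal.ofNat_ne_top,
    ← ENNReal.ofReal_rpow_of_pos hM]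
  simp only [ENNReal.toReal_ofNat]
  refine ENNReal.rpow_le_rpow ?_ (by norm_num)
  refine le_trans ?_ (h r hr)
  unfold powerMeasure
  rw [lintegral_withDensity_eq_lintegral_mul_non_measurable _ (by fun_prop)
    (Filter.Eventually.of_forall fun t => ENNReal.ofReal_lt_top)]
  refine lintegral_mono_ae ?_
  filter_upwards [ae_pos_of_measure_Iic timeMeasure_Iic] with t ht
  have hp := timeProfile_nonneg α a hr ht
  rw [Pi.mul_apply, ← ofReal_norm, Real.norm_of_nonneg hp,
    ENNReal.ofReal_rpow_of_nonneg hp two_pos.le, ← ENNReal.ofReal_mul (by positivity), mul_comm]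
  refine ENNReal.ofReal_le_ofReal ?_
  have := timeProfile_sq_le hd hα a hr ht
  rw [Real.rpow_two]
  gcongr

lemma mixedHeat_zero (α : Fin d → ℝ) (n : Fin d → ℕ) (t : ℝ) (x y : EuclideanSpace ℝ (Fin d)) :
    mixedHeat α n 0 t x y = deltaHeat α n t x y := by
  unfold mixedHeat
  rw [iteratedDeriv_zero]

lemma deltaHeat_zero (α : Fin d → ℝ) (t : ℝ) (x y : EuclideanSpace ℝ (Fin d)) :
    deltaHeat α 0 t x y = heatKernel α t x y := by
  have h : ∀ l : List (Fin d),
      ((l.map (fun i => (laguerreDeriv i)^[(0 : Fin d → ℕ) i])).foldr (fun g h => g ∘ h) id)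
        = id := by
    intro l
    induction l with
    | nil => rfl
    | cons i l ih => rw [List.map_cons, List.foldr_cons, ih]; rfl
  unfold deltaHeat laguerreDerivMulti
  rw [h]
  rfl

lemma mixedHeat_one (α : Fin d → ℝ) (t : ℝ) (x y : EuclideanSpace ℝ (Fin d)) :
    mixedHeat α 0 1 t x y = deriv (fun s => heatKernel α s x y) t := by
  unfold mixedHeat
  simp only [deltaHeat_zero, iteratedDeriv_one]

theorem hasTimeProfile_heatKernel (hd : 1 ≤ d) {α : Fin d → ℝ} (hα : ∀ i, -1 < α i) :
    HasTimeProfile α 0 (fun x y t => heatKernel α t x y) := by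
  simpa [mixedHeat_zero, deltaHeat_zero] using hasTimeProfile_mixedHeat hd hα 0 0

theorem isStandardLpKernel_heat (hd : 1 ≤ d) {α : Fin d → ℝ} (hα : ∀ i, -1 < α i) :
    IsStandardLpKernel α ⊤ timeMeasure (fun x y t => (heatKernel α t x y : ℂ)) := by
  refine (hasTimeProfile_heatKernel hd hα).isStandardLpKernel timeMeasure_Iic one_pos fun r hr => ?_
  rw [eLpNorm_exponent_top]
  refine eLpNormEssSup_le_of_ae_bound ?_
  filter_upwards [ae_pos_of_measure_Iic timeMeasure_Iic] with t ht
  rw [Real.norm_of_nonneg (timeProfile_nonneg α 0 hr ht)]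
  refine (timeProfile_zero_le_exp hd hα hr ht).trans ?_
  rw [Real.exp_le_one_iff]
  have := mul_pos ht (rate_pos hd hα)
  linarith

theorem isStandardKernel_riesz (hd : 1 ≤ d) {α : Fin d → ℝ} (hα : ∀ i, -1 < α i)
    (n : Fin d → ℕ) :
    (∀ x ∈ orthant d, ∀ y ∈ orthant d, x ≠ y →
      Integrable (fun t => deltaHeat α n t x y * t ^ (((∑ i, n i : ℕ) : ℝ) / 2 - 1))
        timeMeasure) ∧
    IsStandardKernel α (rieszKernel α n) := by
  have hf : HasTimeProfile α (((∑ i, n i : ℕ) : ℝ) / 2) (fun x y t => deltaHeat α n t x y) := by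
    simpa [mixedHeat_zero] using hasTimeProfile_mixedHeat hd hα n 0
  obtain ⟨M, hM, h⟩ := exists_lintegral_timeProfile_le hd hα (((∑ i, n i : ℕ) : ℝ) / 2)
  obtain ⟨h1, h2⟩ := hf.integral timeMeasure_Iic
    (φ := fun t => ((t ^ (((∑ i, n i : ℕ) : ℝ) / 2 - 1) : ℝ) : ℂ))
    (Measurable.aestronglyMeasurable (by fun_prop)) hM fun r hr => by
      refine le_trans (lintegral_mono_ae ?_) (h r hr)
      filter_upwards [ae_pos_of_measure_Iic timeMeasure_Iic] with t ht
      rw [Complex.norm_real, Real.norm_of_nonneg (by positivity)]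
  constructor
  · intro x hx y hy hxy
    have h3 := (h1 x hx y hy hxy).re
    simpa [← Complex.ofReal_mul, -Complex.ofReal_mul] using h3
  · have h3 := h2.const_mul ((1 / Real.Gamma (((∑ i, n i : ℕ) : ℝ) / 2) : ℝ) : ℂ)
    convert h3 using 1
    funext x y
    unfold rieszKernel
    rw [Complex.ofReal_mul, ← integral_complex_ofReal]
    simp only [Complex.ofReal_mul]

theorem isStandardLpKernel_mixed (hd : 1 ≤ d) {α : Fin d → ℝ} (hα : ∀ i, -1 < α i)
    (n : Fin d → ℕ) (m : ℕ) :
    IsStandardLpKernel α 2 (powerMeasure (((∑ i, n i : ℕ) : ℝ) + 2 * m - 1))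
      (fun x y t => (mixedHeat α n m t x y : ℂ)) := by
  obtain ⟨M, hM, h⟩ := exists_eLpNorm_timeProfile_le hd hα (m + ((∑ i, n i : ℕ) : ℝ) / 2)
  have e : 2 * ((m : ℝ) + ((∑ i, n i : ℕ) : ℝ) / 2) - 1 = ((∑ i, n i : ℕ) : ℝ) + 2 * m - 1 := by
    ring
  rw [e] at h
  exact (hasTimeProfile_mixedHeat hd hα n m).isStandardLpKernel (powerMeasure_Iic _) hM h

theorem isStandardKernel_laplace (hd : 1 ≤ d) {α : Fin d → ℝ} (hα : ∀ i, -1 < α i)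
    {ψ : ℝ → ℂ} (hψ : MemLp ψ ⊤ timeMeasure) :
    (∀ x ∈ orthant d, ∀ y ∈ orthant d, x ≠ y →
      Integrable (fun t => ψ t * ((deriv (fun s => heatKernel α s x y) t : ℝ) : ℂ)) timeMeasure) ∧
    IsStandardKernel α (laplaceKernel α ψ) := by
  have hf : HasTimeProfile α 1 (fun x y t => deriv (fun s => heatKernel α s x y) t) := by
    simpa [mixedHeat_one] using hasTimeProfile_mixedHeat hd hα 0 1
  obtain ⟨M, hM, h⟩ := exists_lintegral_timeProfile_le hd hα 1
  obtain ⟨S, hS⟩ : ∃ S : ℝ, ∀ᵐ t ∂timeMeasure, ‖ψ t‖ ≤ S := by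
    refine ⟨(eLpNorm ψ ⊤ timeMeasure).toReal, ?_⟩
    filter_upwards [ae_le_eLpNormEssSup (f := ψ) (μ := timeMeasure)] with t ht
    rw [← eLpNorm_exponent_top] at ht
    rw [← toReal_enorm]
    exact ENNReal.toReal_mono hψ.2.ne ht
  obtain ⟨h1, h2⟩ := hf.integral timeMeasure_Iic hψ.1 (M := (|S| + 1) * M) (by positivity)
    fun r hr => by
      calc _ ≤ ∫⁻ t, ENNReal.ofReal (|S| + 1) *
            ENNReal.ofReal (timeProfile α 1 r t * t ^ ((1 : ℝ) - 1)) ∂timeMeasure := by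
            refine lintegral_mono_ae ?_
            filter_upwards [ae_pos_of_measure_Iic timeMeasure_Iic, hS] with t ht hSt
            rw [← ENNReal.ofReal_mul (by positivity), sub_self, Real.rpow_zero, mul_one, mul_comm]
            refine ENNReal.ofReal_le_ofReal ?_
            have := timeProfile_nonneg α 1 hr ht
            have := le_abs_self S
            gcongr
            linarith
        _ = ENNReal.ofReal (|S| + 1) *
            ∫⁻ t, ENNReal.ofReal (timeProfile α 1 r t * t ^ ((1 : ℝ) - 1)) ∂timeMeasure :=
            lintegral_const_mul' _ _ ENNReal.ofReal_ne_top
        _ ≤ ENNReal.ofReal (|S| + 1) * ENNReal.ofReal M := by gcongr; exact h r hr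
        _ = _ := (ENNReal.ofReal_mul (by positivity)).symm
  constructor
  · intro x hx y hy hxy
    simpa only [mul_comm] using h1 x hx y hy hxy
  · have h3 := h2.const_mul (-1)
    convert h3 using 1
    funext x y
    unfold laplaceKernel
    rw [neg_one_mul]
    congr 2
    funext t
    ring

theorem isStandardKernel_stieltjes (hd : 1 ≤ d) {α : Fin d → ℝ} (hα : ∀ i, -1 < α i)
    (ν : ComplexBorelMeasure)
    (hν : ∫⁻ t, ENNReal.ofReal (Real.exp (-t * (2 * d + 2 * ∑ i, α i))) ∂ν.variation < ⊤) :
    (∀ x ∈ orthant d, ∀ y ∈ orthant d, x ≠ y →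
      Integrable (fun t => (heatKernel α t x y : ℂ) * ν.phase t) ν.variation) ∧
    IsStandardKernel α (stieltjesKernel α ν) := by
  refine (hasTimeProfile_heatKernel hd hα).integral ν.variation_Iic
    ν.measurable_phase.aestronglyMeasurable (M := (∫⁻ t, ENNReal.ofReal (Real.exp
      (-t * (2 * d + 2 * ∑ i, α i))) ∂ν.variation).toReal + 1) (by positivity) fun r hr => ?_
  calc _ ≤ ∫⁻ t, ENNReal.ofReal (Real.exp (-t * (2 * d + 2 * ∑ i, α i))) ∂ν.variation := by
        refine lintegral_mono_ae ?_
        filter_upwards [ae_pos_of_measure_Iic ν.variation_Iic] with t ht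
        rw [ν.norm_phase, mul_one]
        exact ENNReal.ofReal_le_ofReal (timeProfile_zero_le_exp hd hα hr ht)
    _ = ENNReal.ofReal (∫⁻ t, ENNReal.ofReal (Real.exp
      (-t * (2 * d + 2 * ∑ i, α i))) ∂ν.variation).toReal := (ENNReal.ofReal_toReal hν.ne).symm
    _ ≤ _ := ENNReal.ofReal_le_ofReal (by linarith)

end LaguerreCZ

theorem theorem3p1 (d : ℕ) (hd : 1 ≤ d) (α : Fin d → ℝ) (hα : ∀ i, -1 < α i) :
    -- the heat maximal kernel, valued in `L^∞(dt)`
    IsStandardLpKernel α ⊤ timeMeasure (fun x y t => (heatKernel α t x y : ℂ)) ∧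
    -- the Riesz-Laguerre kernels
    (∀ n : Fin d → ℕ, 0 < ∑ i, n i →
      (∀ x ∈ orthant d, ∀ y ∈ orthant d, x ≠ y →
        Integrable (fun t => deltaHeat α n t x y * t ^ (((∑ i, n i : ℕ) : ℝ) / 2 - 1))
          timeMeasure) ∧
      IsStandardKernel α (rieszKernel α n)) ∧
    -- the mixed square function kernels, valued in `L^2(t^(|n| + 2m - 1) dt)`
    (∀ (n : Fin d → ℕ) (m : ℕ), 0 < (∑ i, n i) + m →
      IsStandardLpKernel α 2 (powerMeasure (((∑ i, n i : ℕ) : ℝ) + 2 * m - 1))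
        (fun x y t => (mixedHeat α n m t x y : ℂ))) ∧
    -- the Laplace transform type multiplier kernels
    (∀ ψ : ℝ → ℂ, MemLp ψ ⊤ timeMeasure →
      (∀ x ∈ orthant d, ∀ y ∈ orthant d, x ≠ y →
        Integrable (fun t => ψ t * ((deriv (fun s => heatKernel α s x y) t : ℝ) : ℂ)) timeMeasure) ∧
      IsStandardKernel α (laplaceKernel α ψ)) ∧
    -- the Laplace-Stieltjes transform type multiplier kernels
    (∀ ν : ComplexBorelMeasure,
      ∫⁻ t, ENNReal.ofReal (Real.exp (-t * (2 * d + 2 * ∑ i, α i))) ∂ν.variation < ⊤ →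
      (∀ x ∈ orthant d, ∀ y ∈ orthant d, x ≠ y →
        Integrable (fun t => (heatKernel α t x y : ℂ) * ν.phase t) ν.variation) ∧
      IsStandardKernel α (stieltjesKernel α ν)) :=
  ⟨isStandardLpKernel_heat hd hα, fun n _ => isStandardKernel_riesz hd hα n,
    fun n m _ => isStandardLpKernel_mixed hd hα n m,
    fun _ hψ => isStandardKernel_laplace hd hα hψ,
    fun ν hν => isStandardKernel_stieltjes hd hα ν hν⟩
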